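/- Let $(\mathcal V,\mu)$ and $(\mathcal Z,\nu)$ be probability spaces and let $\phi:\mathbb R^d\times\mathcal V\times\mathcal Z\to\mathbb R$ be a (randomized) featurization map, measurable in $(w,z)$ for each $x$, with $\phi(x;w,\cdot)\in L^1(\nu)$ and average $\bar\phi(x;w)=\mathbb E_{z\sim\nu}\,\phi(x;w,z)$. Fix data $x_1,\dots,x_n\in\mathbb R^d$, $y\in\mathbb R^n$. For $w\in\mathcal V$ and $z=(z_1,\dots,z_n)\in\mathcal Z^n$ put $\phi_n(w,z)=(\phi(x_1;w,z_1),\dots,\phi(x_n;w,z_n))\in\mathbb R^n$, and let $\mathbb E_{w,z}$, $\mathbb P$ refer to $w\sim\mu$ and $z_1,\dots,z_n\sim\nu$, all independent. Let $K_n=\mathbb E_{w,z}[\phi_n\phi_n^{\mathsf T}]$ and $\psi_n=K_n^{-1/2}\phi_n$. A random vector $Z$ is called $\gamma^2$-sub-Gaussian if $\mathbb E\, e^{\langle v,Z\rangle}\le e^{\gamma^2\|v\|_2^2/2}$ for all $v$. Let $p\in(1,2]$, $Q=p/(p-1)$, $\rho(x)=|x|^p/p$, $\rho^*(x)=\sup_{u\in\mathbb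 R}\{xu-\rho(u)\}$ and $s=(\rho^*)'$. Let $C,c,r_0>0$. Consider the following assumptions with parameters $\tau,\eta$. FEAT1: $1\le\tau\le n^C$; for each fixed $x$ with $\|x\|_2\le r_0\sqrt d$, $\bar\phi(x;w)$ is $\tau^2$-sub-Gaussian when $w\sim\mu$; and $\psi_n$ is $\tau^2$-sub-Gaussian. FEAT2: there is a measurable $L:\mathcal V\to[0,\infty)$ such that for every $w$ the function $\bar\phi(\cdot\,;w)$ is $L(w)$-Lipschitz on $\mathbb R^d$ and $\bar\phi(0;w)\le L(w)$, and $\mu(L(w)\ge t)\le Ce^{-t^2/(2\tau^2)}$ for all $t>0$. FEAT3: $n^{-C}\le\eta\le1$, $\eta>0$, and $\mathbb P(|\langle u,\psi_n\rangle|\ge\eta,\ |\langle v,\psi_n\rangle|\ge\eta)\ge c$ for all unit vectors $u,v\in\mathbb R^n$. Let $(w_j,(z_{ij})_{i\le n})_{j\le N}$ be independent, with $w_j\sim\mu$, $z_{ij}\sim\nu$ all independent, put $\phi_{n,j}=\phi_n(w_j,(z_{ij})_{i\le n})$, and for $\lambda\in\mathbb R^n$ define the dual objectives and predictors $$F(\lambda)=\langle\lambda,y\rangle-\mathbb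 E_{w,z}\,\rho^*(\langle\phi_n,\lambda\rangle),\qquad F_N(\lambda)=\langle\lambda,y\rangle-\frac1N\sum_{j=1}^N\rho^*(\langle\phi_{n,j},\lambda\rangle),$$ $$\hat f(x;\lambda)=\mathbb E_{w,z}\big[\bar\phi(x;w)\,s(\langle\phi_n,\lambda\rangle)\big],\qquad \hat f_N(x;\lambda)=\frac1N\sum_{j=1}^N\bar\phi(x;w_j)\,s(\langle\phi_{n,j},\lambda\rangle).$$ Then there exist constants $C',c'>0$ depending only on $p,C,c,r_0$ such that the following holds for all such $n,d,\mu,\nu,\phi,y,\tau,\eta$ and all $x_1,\dots,x_n$ with $\|x_i\|_2\le r_0\sqrt d$ for which FEAT1, FEAT2, FEAT3 hold, and for every probability distribution $\mathsf P$ on $\mathbb R^d$ supported on $\{\|x\|_2\le r_0\sqrt d\}$. If $N\ge1$, $n\ge c'd$ and $$N\ge C'\Big[\Big(\frac{\tau^{Q}}{\eta^{Q\vee3}}\Big)^2 n\log n\ \vee\ \frac{\tau^{Q}}{\eta^{Q\vee3}}(n\log n)^{Q/2}\Big],$$ then $F$ has a unique maximizer $\hat\lambda$, and with probability at least $1-C'N^{-c'n}$,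 $F_N$ has a unique maximizer $\hat\lambda_N$ and $$\|\hat f_N(\cdot\,;\hat\lambda_N)-\hat f(\cdot\,;\hat\lambda)\|_{L^2(\mathsf P)}\le C'\,\frac{\tau^{2Q}}{\eta^{Q\vee3}}\Big(\sqrt{\frac{n\log N}{N}}\vee\frac{(n\log N)^{Q/2}}{N}\Big)\|K_n^{-1/2}y\|_2.$$ -/

import Mathlib

open MeasureTheory

/-! Random features approximation of minimum-complexity interpolation.

`𝒱` (with law `μ`) is the space of weights, `𝒵` (with law `ν`) the space of the additional feature
randomness, `φ x w z` the randomized featurization map, `x : Fin n → ℝᵈ` the training inputs and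
`y ∈ ℝⁿ` the responses. A single feature uses one weight `w` and independent `z₁, …, zₙ`, one for
each training input. -/

noncomputable section

namespace RandomFeatures

/-! ### Penalty, conjugate, and link function -/

/-- The penalty `ρ(x) = |x|^p / p`. -/
def powerPenalty (p : ℝ) (x : ℝ) : ℝ := |x| ^ p / p

/-- The convex conjugate `ρ*(x) = sup_y {x y - ρ(y)}`. -/
def convexConj (ρ : ℝ → ℝ) (x : ℝ) : ℝ := ⨆ y : ℝ, (x * y - ρ y)

/-- `s = (ρ*)'`. -/
def link (ρ : ℝ → ℝ) : ℝ → ℝ := deriv (convexConj ρ)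

/-! ### Probabilistic and linear-algebraic vocabulary -/

/-- `Z` is `γ2`-sub-Gaussian (`γ2` is the variance proxy): `E exp⟨v, Z⟩ ≤ exp(γ2 ‖v‖² / 2)` for all
`v`. With `F = ℝ` this is the notion for scalar random variables. -/
def IsSubGaussian {Ω F : Type*} [MeasurableSpace Ω] [NormedAddCommGroup F] [InnerProductSpace ℝ F]
    (Z : Ω → F) (γ2 : ℝ) (P : Measure Ω) : Prop :=
  ∀ v : F, Integrable (fun ω => Real.exp (inner ℝ v (Z ω))) P ∧
    ∫ ω, Real.exp (inner ℝ v (Z ω)) ∂P ≤ Real.exp (γ2 * ‖v‖ ^ 2 / 2)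

/-- `K^{-1/2}` for a symmetric positive definite matrix `K`, by functional calculus. -/
def invSqrt {n : ℕ} (K : Matrix (Fin n) (Fin n) ℝ) : Matrix (Fin n) (Fin n) ℝ :=
  cfc (fun t : ℝ => (√t)⁻¹) K

/-- A matrix acting on Euclidean space. -/
def act {n : ℕ} (A : Matrix (Fin n) (Fin n) ℝ) (v : EuclideanSpace ℝ (Fin n)) :
    EuclideanSpace ℝ (Fin n) :=
  WithLp.toLp 2 (A.mulVec (WithLp.ofLp v))

/-- `a` is the maximizer of `f`: the maximum is attained at `a` and only there. -/
def IsArgmax {α : Type*} (f : α → ℝ) (a : α) : Prop := ∀ b, b ≠ a → f b < f a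

/-! ### Features -/

section Features

variable {𝒱 𝒵 : Type*} [MeasurableSpace 𝒱] [MeasurableSpace 𝒵] {n d N : ℕ}

/-- The joint law `μ ⊗ ν^{⊗ n}` of a weight and the `n` randomization variables attached to it. -/
def featLaw (n : ℕ) (μ : Measure 𝒱) (ν : Measure 𝒵) : Measure (𝒱 × (Fin n → 𝒵)) :=
  μ.prod (Measure.pi fun _ : Fin n => ν)

/-- The law of the whole sample `(w_j, (z_{ij})_{i ≤ n})_{j ≤ N}`, all variables independent with
`w_j ∼ μ`, `z_{ij} ∼ ν`. -/
def sampleLaw (N n : ℕ) (μ : Measure 𝒱) (ν : Measure 𝒵) :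
    Measure (Fin N → 𝒱 × (Fin n → 𝒵)) :=
  Measure.pi fun _ : Fin N => featLaw n μ ν

/-- The averaged feature `φ̄(x; w) = E_z φ(x; w, z)`. -/
def avgFeat (φ : EuclideanSpace ℝ (Fin d) → 𝒱 → 𝒵 → ℝ) (ν : Measure 𝒵)
    (x : EuclideanSpace ℝ (Fin d)) (w : 𝒱) : ℝ :=
  ∫ z, φ x w z ∂ν

/-- The feature vector `φ_n = (φ(x_1; w, z_1), …, φ(x_n; w, z_n))`. -/
def featVec (φ : EuclideanSpace ℝ (Fin d) → 𝒱 → 𝒵 → ℝ) (x : Fin n → EuclideanSpace ℝ (Fin d))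
    (q : 𝒱 × (Fin n → 𝒵)) : EuclideanSpace ℝ (Fin n) :=
  WithLp.toLp 2 fun i => φ (x i) q.1 (q.2 i)

/-- The empirical kernel matrix `K_n = E_{w,z}[φ_n φ_nᵀ]`. -/
def kernelMatrix (φ : EuclideanSpace ℝ (Fin d) → 𝒱 → 𝒵 → ℝ) (μ : Measure 𝒱) (ν : Measure 𝒵)
    (x : Fin n → EuclideanSpace ℝ (Fin d)) : Matrix (Fin n) (Fin n) ℝ :=
  fun i k => ∫ q, featVec φ x q i * featVec φ x q k ∂(featLaw n μ ν)

/-- The whitened feature vector `ψ_n = K_n^{-1/2} φ_n`. -/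
def whitened (φ : EuclideanSpace ℝ (Fin d) → 𝒱 → 𝒵 → ℝ) (μ : Measure 𝒱) (ν : Measure 𝒵)
    (x : Fin n → EuclideanSpace ℝ (Fin d)) (q : 𝒱 × (Fin n → 𝒵)) : EuclideanSpace ℝ (Fin n) :=
  act (invSqrt (kernelMatrix φ μ ν x)) (featVec φ x q)

/-! ### Assumptions on the features -/

/-- Sub-Gaussianity, with parameter `1 ≤ τ ≤ n^C`. -/
structure FEAT1 (C r₀ τ : ℝ) (φ : EuclideanSpace ℝ (Fin d) → 𝒱 → 𝒵 → ℝ) (μ : Measure 𝒱)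
    (ν : Measure 𝒵) (x : Fin n → EuclideanSpace ℝ (Fin d)) : Prop where
  one_le : 1 ≤ τ
  le_pow : τ ≤ (n : ℝ) ^ C
  avg_subGaussian : ∀ x' : EuclideanSpace ℝ (Fin d), ‖x'‖ ≤ r₀ * √(d : ℝ) →
    IsSubGaussian (fun w => avgFeat φ ν x' w) (τ ^ 2) μ
  whitened_subGaussian : IsSubGaussian (whitened φ μ ν x) (τ ^ 2) (featLaw n μ ν)

/-- Lipschitz continuity of the averaged features, with a sub-Gaussian Lipschitz constant. -/
def FEAT2 (C τ : ℝ) (φ : EuclideanSpace ℝ (Fin d) → 𝒱 → 𝒵 → ℝ) (μ : Measure 𝒱)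
    (ν : Measure 𝒵) : Prop :=
  ∃ L : 𝒱 → NNReal, Measurable L ∧
    (∀ w, LipschitzWith (L w) fun x' => avgFeat φ ν x' w) ∧
    (∀ w, avgFeat φ ν 0 w ≤ L w) ∧
    ∀ t : ℝ, 0 < t → μ.real {w | t ≤ L w} ≤ C * Real.exp (-t ^ 2 / (2 * τ ^ 2))

/-- Small-ball property of the whitened features, with parameter `n^{-C} ≤ η ≤ 1`. -/
structure FEAT3 (C c η : ℝ) (φ : EuclideanSpace ℝ (Fin d) → 𝒱 → 𝒵 → ℝ) (μ : Measure 𝒱)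
    (ν : Measure 𝒵) (x : Fin n → EuclideanSpace ℝ (Fin d)) : Prop where
  pos : 0 < η
  le_one : η ≤ 1
  pow_le : (n : ℝ) ^ (-C) ≤ η
  small_ball : ∀ u v : EuclideanSpace ℝ (Fin n), ‖u‖ = 1 → ‖v‖ = 1 →
    c ≤ (featLaw n μ ν).real
      {q | η ≤ |inner ℝ u (whitened φ μ ν x q)| ∧ η ≤ |inner ℝ v (whitened φ μ ν x q)|}

/-! ### Dual problems and predictors -/

/-- The infinite-width dual objective `F(λ) = ⟨λ, y⟩ - E_{w,z} ρ*(⟨φ_n, λ⟩)`. -/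
def dualInf (ρ : ℝ → ℝ) (φ : EuclideanSpace ℝ (Fin d) → 𝒱 → 𝒵 → ℝ) (μ : Measure 𝒱)
    (ν : Measure 𝒵) (x : Fin n → EuclideanSpace ℝ (Fin d)) (y lam : EuclideanSpace ℝ (Fin n)) : ℝ :=
  inner ℝ lam y - ∫ q, convexConj ρ (inner ℝ (featVec φ x q) lam) ∂(featLaw n μ ν)

/-- The finite-width dual objective `F_N(λ) = ⟨λ, y⟩ - N⁻¹ ∑_j ρ*(⟨φ_{n,j}, λ⟩)`. -/
def dualFin (ρ : ℝ → ℝ) (φ : EuclideanSpace ℝ (Fin d) → 𝒱 → 𝒵 → ℝ)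
    (x : Fin n → EuclideanSpace ℝ (Fin d)) (y : EuclideanSpace ℝ (Fin n))
    (ω : Fin N → 𝒱 × (Fin n → 𝒵)) (lam : EuclideanSpace ℝ (Fin n)) : ℝ :=
  inner ℝ lam y - (1 / (N : ℝ)) * ∑ j, convexConj ρ (inner ℝ (featVec φ x (ω j)) lam)

/-- The infinite-width predictor `f̂(x'; λ) = E_{w,z}[φ̄(x'; w) s(⟨φ_n, λ⟩)]`. -/
def predInf (ρ : ℝ → ℝ) (φ : EuclideanSpace ℝ (Fin d) → 𝒱 → 𝒵 → ℝ) (μ : Measure 𝒱)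
    (ν : Measure 𝒵) (x : Fin n → EuclideanSpace ℝ (Fin d)) (lam : EuclideanSpace ℝ (Fin n))
    (x' : EuclideanSpace ℝ (Fin d)) : ℝ :=
  ∫ q, avgFeat φ ν x' q.1 * link ρ (inner ℝ (featVec φ x q) lam) ∂(featLaw n μ ν)

/-- The finite-width predictor `f̂_N(x'; λ) = N⁻¹ ∑_j φ̄(x'; w_j) s(⟨φ_{n,j}, λ⟩)`. -/
def predFin (ρ : ℝ → ℝ) (φ : EuclideanSpace ℝ (Fin d) → 𝒱 → 𝒵 → ℝ) (ν : Measure 𝒵)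
    (x : Fin n → EuclideanSpace ℝ (Fin d)) (ω : Fin N → 𝒱 × (Fin n → 𝒵))
    (lam : EuclideanSpace ℝ (Fin n)) (x' : EuclideanSpace ℝ (Fin d)) : ℝ :=
  (1 / (N : ℝ)) * ∑ j, avgFeat φ ν x' (ω j).1 * link ρ (inner ℝ (featVec φ x (ω j)) lam)

end Features

end RandomFeatures

end

/-! Here `ρ*(x) = |x|^Q / Q` with `Q ≥ 2`, and `s` is `powLink Q`, homogeneous of degree `Q - 1`.
Substituting `λ = K_n^{-1/2} θ` replaces the features by the isotropic sub-Gaussian vector `ψ_n` and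
`y` by `K_n^{-1/2} y`, so everything is proved in the variable `θ` (`exists_dual_concentration`).
The small-ball assumption makes the substitution legitimate: a direction killed by `K_n^{-1/2}`
would be one in which `ψ_n` vanishes.

Isotropy and Jensen give `E|⟨ψ, θ⟩|^Q ≥ ‖θ‖^Q`. Hence the population maximizer `T • u`, `‖u‖ = 1`,
exists, is unique and satisfies `T^(Q-1) ≤ ‖K_n^{-1/2} y‖`. Being deterministic, it is the only
point at which the empirical gradient has to be controlled, and homogeneity moves that point to the
unit vector `u`.

The link is strongly monotone: `(s(b) - s(a))(b - a) ≥ |a|^(Q-2) (b - a)² / 2`. Suppose a fixed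
fraction of the samples has both `|⟨ψ, u⟩| ≥ η` and `|⟨ψ, v⟩| ≥ η / 2`, for every unit `v`. Then the
empirical objective is strongly concave as seen from `T • u`, and its maximizer lies within a
constant times `η^(-Q) ‖g‖ T` of `T • u`, where `g` is the gradient deviation at `u`
(`norm_sub_le_of_smallBall`). A Lipschitz bound on `s` turns this into a bound on predictors
(`abs_mean_mul_powLink_sub_le`), and the predictor deviation at `T • u` itself is one more empirical
mean.

All these empirical means involve variables with `E|Y|^k ≤ (A k^(Q/2))^k`. For `Q > 2` such
variables need not have exponential moments, so the proof bounds a moment of order `m` comparable to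
`n log N`, using a truncated exponential generating function that is submultiplicative over
independent sums (`sum_moments_le_pow`, `exists_mean_moment_bound`). Markov's inequality then gives
failure probability `N^(-κ n)`, which survives a union bound over a net of the sphere. The `L²(P)`
norms need no net in `x'`: Fubini exchanges the integral over `x'` with the one over samples. -/

noncomputable section

namespace RandomFeatures

/-! ### The conjugate of a power and its derivative -/

/-- The derivative `x |x|^(Q-2)` of `|x|^Q / Q`. -/
def powLink (Q x : ℝ) : ℝ := |x| ^ (Q - 2) * x

lemma abs_powLink {Q : ℝ} (hQ : 1 < Q) (x : ℝ) : |powLink Q x| = |x| ^ (Q - 1) := by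
  unfold powLink
  rcases eq_or_ne x 0 with rfl | hx
  · simp [Real.zero_rpow (by linarith : Q - 1 ≠ 0)]
  · have h : 0 < |x| := abs_pos.mpr hx
    rw [abs_mul, abs_of_nonneg (Real.rpow_nonneg h.le _), ← Real.rpow_add_one h.ne']
    congr 1; ring

lemma mul_powLink {Q : ℝ} (hQ : 1 < Q) (x : ℝ) : x * powLink Q x = |x| ^ Q := by
  unfold powLink
  rcases eq_or_ne x 0 with rfl | hx
  · simp [Real.zero_rpow (by linarith : Q ≠ 0)]
  · have h : 0 < |x| := abs_pos.mpr hx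
    have : x * (|x| ^ (Q - 2) * x) = |x| ^ (Q - 2) * |x| ^ (2 : ℝ) := by
      rw [Real.rpow_two, sq_abs]; ring
    rw [this, ← Real.rpow_add h]
    congr 1; ring

lemma powLink_mul {Q a : ℝ} (hQ : 1 < Q) (ha : 0 ≤ a) (x : ℝ) :
    powLink Q (a * x) = a ^ (Q - 1) * powLink Q x := by
  unfold powLink
  rcases ha.eq_or_lt with rfl | ha
  · simp [Real.zero_rpow (by linarith : Q - 1 ≠ 0)]
  · have : a ^ (Q - 1) = a ^ (Q - 2) * a := by
      rw [← Real.rpow_add_one ha.ne']; congr 1; ring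
    rw [abs_mul, abs_of_pos ha, Real.mul_rpow ha.le (abs_nonneg x), this]
    ring

lemma hasDerivAt_abs_rpow_div {Q : ℝ} (hQ : 1 < Q) (x : ℝ) :
    HasDerivAt (fun x : ℝ => |x| ^ Q / Q) (powLink Q x) x := by
  have h := (hasDerivAt_abs_rpow x hQ).div_const Q
  have e : Q * |x| ^ (Q - 2) * x / Q = powLink Q x := by
    unfold powLink
    field_simp
  rwa [e] at h

lemma measurable_powLink (Q : ℝ) : Measurable (powLink Q) := by
  unfold powLink
  fun_prop

/-- The product splits exactly into the average of the two weights times `(b - a)²`, plus a product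
of two differences that have the same sign because `|·|^(Q-2)` and `|·|^2` are both monotone in the
absolute value. This strong monotonicity drives both uniqueness and stability of maximizers. -/
lemma half_mul_sq_le_powLink_sub_mul {Q : ℝ} (hQ : 2 ≤ Q) (a b : ℝ) :
    1 / 2 * |a| ^ (Q - 2) * (b - a) ^ 2 ≤ (powLink Q b - powLink Q a) * (b - a) := by
  unfold powLink
  have key : (|b| ^ (Q - 2) * b - |a| ^ (Q - 2) * a) * (b - a)
      = 1 / 2 * (|a| ^ (Q - 2) + |b| ^ (Q - 2)) * (b - a) ^ 2
        + 1 / 2 * ((|a| ^ (Q - 2) - |b| ^ (Q - 2)) * (|a| ^ 2 - |b| ^ 2)) := by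
    rw [sq_abs, sq_abs]; ring
  have hb : 0 ≤ |b| ^ (Q - 2) := Real.rpow_nonneg (abs_nonneg b) _
  have h2 : 0 ≤ (|a| ^ (Q - 2) - |b| ^ (Q - 2)) * (|a| ^ 2 - |b| ^ 2) := by
    rcases le_total (|a|) (|b|) with h | h
    · apply mul_nonneg_of_nonpos_of_nonpos
      · linarith [Real.rpow_le_rpow (abs_nonneg a) h (by linarith : 0 ≤ Q - 2)]
      · linarith [pow_le_pow_left₀ (abs_nonneg a) h 2]
    · apply mul_nonneg
      · linarith [Real.rpow_le_rpow (abs_nonneg b) h (by linarith : 0 ≤ Q - 2)]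
      · linarith [pow_le_pow_left₀ (abs_nonneg b) h 2]
  nlinarith [mul_nonneg hb (sq_nonneg (b - a))]

lemma hasDerivAt_powLink {Q : ℝ} (hQ : 2 < Q) (x : ℝ) :
    HasDerivAt (powLink Q) ((Q - 1) * |x| ^ (Q - 2)) x := by
  rcases eq_or_ne x 0 with rfl | hx
  · have : (Q - 1) * |(0 : ℝ)| ^ (Q - 2) = 0 := by
      simp [Real.zero_rpow (by linarith : Q - 2 ≠ 0)]
    rw [this, hasDerivAt_iff_tendsto_slope]
    have hc : ContinuousAt (fun y : ℝ => |y| ^ (Q - 2)) 0 :=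
      continuousAt_id.abs.rpow_const (Or.inr (by linarith))
    have ht : Filter.Tendsto (fun y : ℝ => |y| ^ (Q - 2)) (nhdsWithin 0 {0}ᶜ) (nhds 0) := by
      have := hc.tendsto.mono_left (nhdsWithin_le_nhds (s := {(0:ℝ)}ᶜ))
      simpa [Real.zero_rpow (by linarith : Q - 2 ≠ 0)] using this
    refine ht.congr' ?_
    filter_upwards [self_mem_nhdsWithin] with y hy
    have hy : y ≠ 0 := hy
    simp [slope_def_field, powLink]
    field_simp
  · have h1 : HasDerivAt (fun y : ℝ => |y| ^ (Q - 2))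
        ((SignType.sign x : ℝ) * (Q - 2) * |x| ^ (Q - 2 - 1)) x :=
      (hasDerivAt_abs hx).rpow_const (Or.inl (abs_ne_zero.mpr hx))
    have h2 := h1.mul (hasDerivAt_id x)
    refine h2.congr_deriv ?_
    have h : 0 < |x| := abs_pos.mpr hx
    have e : |x| ^ (Q - 2) = |x| ^ (Q - 2 - 1) * |x| := by
      rw [← Real.rpow_add_one h.ne']; congr 1; ring
    have e2 : (SignType.sign x : ℝ) * x = |x| := sign_mul_self x
    rw [id, e]
    linear_combination ((Q - 2) * |x| ^ (Q - 2 - 1)) * e2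

/-- Mean value inequality: between `a` and `b` the derivative is controlled by its size at the
endpoint of larger absolute value, hence by the sum of both. -/
lemma abs_powLink_sub_le {Q : ℝ} (hQ : 2 ≤ Q) (a b : ℝ) :
    |powLink Q b - powLink Q a| ≤ (Q - 1) * (|a| ^ (Q - 2) + |b| ^ (Q - 2)) * |b - a| := by
  rcases hQ.eq_or_lt with rfl | hQ
  · simp [powLink]
    linarith [abs_nonneg (b - a)]
  have hsum : ∀ x ∈ Set.uIcc a b, |x| ^ (Q - 2) ≤ |a| ^ (Q - 2) + |b| ^ (Q - 2) := by
    intro x hx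
    have ha : 0 ≤ |a| ^ (Q - 2) := Real.rpow_nonneg (abs_nonneg _) _
    have hb : 0 ≤ |b| ^ (Q - 2) := Real.rpow_nonneg (abs_nonneg _) _
    have hx' : |x| ≤ max |a| |b| := by
      rcases Set.mem_uIcc.mp hx with h | h
      · exact abs_le_max_abs_abs h.1 h.2
      · rw [max_comm]; exact abs_le_max_abs_abs h.1 h.2
    rcases le_max_iff.mp hx' with h | h
    · linarith [Real.rpow_le_rpow (abs_nonneg x) h (by linarith : 0 ≤ Q - 2)]
    · linarith [Real.rpow_le_rpow (abs_nonneg x) h (by linarith : 0 ≤ Q - 2)]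
  have := (convex_uIcc a b).norm_image_sub_le_of_norm_hasDerivWithin_le (f := powLink Q)
    (C := (Q - 1) * (|a| ^ (Q - 2) + |b| ^ (Q - 2)))
    (fun x _ => (hasDerivAt_powLink hQ x).hasDerivWithinAt)
    (fun x hx => by
      rw [Real.norm_eq_abs, abs_of_nonneg (mul_nonneg (by linarith)
        (Real.rpow_nonneg (abs_nonneg _) _))]
      exact mul_le_mul_of_nonneg_left (hsum x hx) (by linarith))
    (Set.left_mem_uIcc) (Set.right_mem_uIcc)
  simpa using this

/-- Young's inequality bounds the supremum, and equality is attained at `powLink Q x`. -/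
lemma convexConj_powerPenalty {p Q : ℝ} (hp : 1 < p) (hQ : Q = p / (p - 1)) (x : ℝ) :
    convexConj (powerPenalty p) x = |x| ^ Q / Q := by
  have hpQ : p.HolderConjugate Q := by
    rw [hQ]; exact Real.HolderConjugate.conjExponent hp
  have hub : ∀ y : ℝ, x * y - |y| ^ p / p ≤ |x| ^ Q / Q := fun y => by
    linarith [Real.young_inequality x y hpQ.symm]
  unfold convexConj powerPenalty
  apply le_antisymm
  · exact ciSup_le hub
  · have hQ1 : 1 < Q := hpQ.symm.lt
    refine le_trans (le_of_eq ?_) (le_ciSup (f := fun y : ℝ => x * y - |y| ^ p / p)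
      ⟨|x| ^ Q / Q, by rintro _ ⟨y, rfl⟩; exact hub y⟩ (powLink Q x))
    have e : (Q - 1) * p = Q := by
      rw [hQ]; field_simp [show p - 1 ≠ 0 by linarith]; ring
    simp only [mul_powLink hQ1, abs_powLink hQ1]
    rw [← Real.rpow_mul (abs_nonneg x), e]
    have := hpQ.inv_add_inv_eq_one
    have h3 : Q⁻¹ = 1 - p⁻¹ := by linarith
    rw [div_eq_mul_inv, div_eq_mul_inv, h3]; ring

lemma link_powerPenalty {p Q : ℝ} (hp : 1 < p) (hQ : Q = p / (p - 1)) :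
    link (powerPenalty p) = powLink Q := by
  have hpQ : p.HolderConjugate Q := by
    rw [hQ]; exact Real.HolderConjugate.conjExponent hp
  funext x
  unfold link
  rw [show convexConj (powerPenalty p) = fun x => |x| ^ Q / Q from
    funext (convexConj_powerPenalty hp hQ)]
  exact (hasDerivAt_abs_rpow_div hpQ.symm.lt x).deriv

end RandomFeatures

end

noncomputable section

namespace RandomFeatures

open ProbabilityTheory

/-! ### Moments of sums of independent variables -/

/-- The left side keeps only the pairs with `i + j < n` of the square on the right, and every term
is nonnegative. -/
lemma sum_range_antidiagonal_le (f g : ℕ → ℝ) (hf : ∀ i, 0 ≤ f i) (hg : ∀ i, 0 ≤ g i) (n : ℕ) :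
    ∑ k ∈ Finset.range n, ∑ ij ∈ Finset.HasAntidiagonal.antidiagonal k, f ij.1 * g ij.2
      ≤ (∑ i ∈ Finset.range n, f i) * ∑ j ∈ Finset.range n, g j := by
  have h : ∀ k, ∑ ij ∈ Finset.HasAntidiagonal.antidiagonal k, f ij.1 * g ij.2
      = ∑ i ∈ Finset.range (k + 1), f i * g (k - i) := fun k =>
    Finset.Nat.sum_antidiagonal_eq_sum_range_succ (fun i j => f i * g j) k
  simp_rw [h]
  rw [Finset.sum_range_diag_flip n (fun i j => f i * g j), Finset.sum_mul]
  refine Finset.sum_le_sum fun i _ => ?_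
  rw [← Finset.mul_sum]
  refine mul_le_mul_of_nonneg_left ?_ (hf i)
  exact Finset.sum_le_sum_of_subset_of_nonneg
    (Finset.range_mono (Nat.sub_le n i)) fun j _ _ => hg j

/-- Dividing moments by `k!` absorbs the binomial coefficients, so independence turns the moments of
a sum into a Cauchy product. -/
lemma integrable_add_pow_and_integral {Ω : Type*} [MeasurableSpace Ω] {P : Measure Ω}
    {X Y : Ω → ℝ} (hXY : X ⟂ᵢ[P] Y)
    (hX : ∀ k : ℕ, Integrable (fun ω => X ω ^ k) P)
    (hY : ∀ k : ℕ, Integrable (fun ω => Y ω ^ k) P) (k : ℕ) :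
    Integrable (fun ω => (X ω + Y ω) ^ k) P ∧
      (∫ ω, (X ω + Y ω) ^ k ∂P) / k.factorial =
        ∑ ij ∈ Finset.HasAntidiagonal.antidiagonal k, (∫ ω, X ω ^ ij.1 ∂P) / ij.1.factorial *
          ((∫ ω, Y ω ^ ij.2 ∂P) / ij.2.factorial) := by
  have hind : ∀ i j : ℕ, (fun ω => X ω ^ i) ⟂ᵢ[P] (fun ω => Y ω ^ j) := fun i j =>
    hXY.comp (φ := fun x => x ^ i) (ψ := fun x => x ^ j) (by fun_prop) (by fun_prop)
  have hint : ∀ i j : ℕ, Integrable (fun ω => X ω ^ i * Y ω ^ j) P := fun i j =>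
    (hind i j).integrable_mul (hX i) (hY j)
  have hmul : ∀ i j : ℕ, ∫ ω, X ω ^ i * Y ω ^ j ∂P = (∫ ω, X ω ^ i ∂P) * ∫ ω, Y ω ^ j ∂P :=
    fun i j => (hind i j).integral_mul_eq_mul_integral (hX i).1 (hY j).1
  have hexp : (fun ω => (X ω + Y ω) ^ k) = fun ω => ∑ ij ∈ Finset.HasAntidiagonal.antidiagonal k,
      (k.choose ij.1 : ℝ) * (X ω ^ ij.1 * Y ω ^ ij.2) := by
    funext ω
    rw [(Commute.all (X ω) (Y ω)).add_pow']
    simp [nsmul_eq_mul]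
  constructor
  · rw [hexp]
    exact integrable_finsetSum _ fun ij _ => (hint _ _).const_mul _
  · rw [hexp, integral_finsetSum _ fun ij _ => (hint _ _).const_mul _, Finset.sum_div]
    refine Finset.sum_congr rfl fun ij hij => ?_
    rw [integral_const_mul, hmul]
    obtain ⟨i, j⟩ := ij
    have hij : i + j = k := by simpa using hij
    subst hij
    simp only
    have h := Nat.add_choose_mul_factorial_mul_factorial i j
    rw [← Nat.choose_symm_add] at h
    have h' : ((i + j).choose i : ℝ) * i.factorial * j.factorial = (i + j).factorial := by
      exact_mod_cast h
    have h1 : (i.factorial : ℝ) ≠ 0 := by positivity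
    have h2 : (j.factorial : ℝ) ≠ 0 := by positivity
    rw [← h']
    have h3 : ((i + j).choose i : ℝ) ≠ 0 := by
      have := Nat.choose_pos (Nat.le_add_right i j)
      positivity
    field_simp

/-- The substitute for the moment generating function: truncated at order `m`, the series is still
submultiplicative over independent summands, and it is finite even when no exponential moment
exists. -/
lemma sum_moments_le_pow {Ω ι : Type*} [MeasurableSpace Ω] {P : Measure Ω}
    [IsProbabilityMeasure P] {X : ι → Ω → ℝ} (hind : iIndepFun X P) (hm : ∀ i, Measurable (X i))
    (hint : ∀ i (k : ℕ), Integrable (fun ω => X i ω ^ k) P) {b : ℕ → ℝ}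
    (hb : ∀ i (k : ℕ), |∫ ω, X i ω ^ k ∂P| / k.factorial ≤ b k) (s : Finset ι) :
    (∀ k : ℕ, Integrable (fun ω => (∑ i ∈ s, X i ω) ^ k) P) ∧
      ∀ (m : ℕ) (l : ℝ), 0 ≤ l →
        ∑ k ∈ Finset.range (m + 1), |∫ ω, (∑ i ∈ s, X i ω) ^ k ∂P| / k.factorial * l ^ k
          ≤ (∑ k ∈ Finset.range (m + 1), b k * l ^ k) ^ s.card := by
  classical
  induction s using Finset.induction_on with
  | empty =>
    constructor
    · intro k; simp
    · intro m l _
      rw [Finset.sum_eq_single_of_mem 0 (by simp)]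
      · simp
      · intro k _ hk; simp [hk]
  | insert i s his ih =>
    obtain ⟨ihint, ih⟩ := ih
    have hXS : X i ⟂ᵢ[P] (fun ω => ∑ j ∈ s, X j ω) := by
      have := (hind.indepFun_finsetSum_of_notMem hm his).symm
      convert this using 1
      funext ω; simp
    have hadd := integrable_add_pow_and_integral hXS (hint i) ihint
    simp_rw [Finset.sum_insert his]
    refine ⟨fun k => (hadd k).1, fun m l hl => ?_⟩
    rw [Finset.card_insert_of_notMem his, pow_succ']
    set f : ℕ → ℝ := fun k => |∫ ω, X i ω ^ k ∂P| / k.factorial * l ^ k with hf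
    set g : ℕ → ℝ := fun k => |∫ ω, (∑ j ∈ s, X j ω) ^ k ∂P| / k.factorial * l ^ k with hg
    have hf0 : ∀ k, 0 ≤ f k := fun k => by positivity
    have hg0 : ∀ k, 0 ≤ g k := fun k => by positivity
    calc _ ≤ ∑ k ∈ Finset.range (m + 1), ∑ ij ∈ Finset.HasAntidiagonal.antidiagonal k, f ij.1 * g ij.2 := by
          refine Finset.sum_le_sum fun k _ => ?_
          have hk : |∫ ω, (X i ω + ∑ j ∈ s, X j ω) ^ k ∂P| / k.factorial
              = |(∫ ω, (X i ω + ∑ j ∈ s, X j ω) ^ k ∂P) / k.factorial| := by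
            rw [abs_div, Nat.abs_cast]
          rw [hk, (hadd k).2]
          refine (mul_le_mul_of_nonneg_right (Finset.abs_sum_le_sum_abs _ _)
            (pow_nonneg hl k)).trans ?_
          rw [Finset.sum_mul]
          refine Finset.sum_le_sum fun ij hij => le_of_eq ?_
          rw [← Finset.HasAntidiagonal.mem_antidiagonal.mp hij, hf, hg]
          simp only [abs_mul, abs_div, Nat.abs_cast, pow_add]
          ring
      _ ≤ (∑ k ∈ Finset.range (m + 1), f k) * ∑ k ∈ Finset.range (m + 1), g k :=
          sum_range_antidiagonal_le f g hf0 hg0 _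
      _ ≤ _ := by
          refine mul_le_mul ?_ (ih m l hl) (Finset.sum_nonneg fun k _ => hg0 k) ?_
          · exact Finset.sum_le_sum fun k _ =>
              mul_le_mul_of_nonneg_right (hb i k) (pow_nonneg hl k)
          · refine Finset.sum_nonneg fun k _ => mul_nonneg ?_ (pow_nonneg hl k)
            exact le_trans (by positivity) (hb i k)

/-- The series controlling truncated exponential moments of variables with moments `(A k^q)^k`. -/
lemma exists_truncated_exp_moment_bound {q : ℝ} (hq : 1 ≤ q) :
    ∃ D : ℝ, 0 < D ∧ ∀ (m : ℕ) (t : ℝ), 0 ≤ t →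
      t ≤ (4 * Real.exp 1)⁻¹ * (m : ℝ) ^ (1 - q) →
      ∑ k ∈ Finset.range (m + 1), (if k = 0 then 1 else if k = 1 then 0 else
          t ^ k * ((k : ℝ) ^ q) ^ k / k.factorial) ≤ Real.exp (D * t ^ 2) := by
  -- Once `t²` has been factored out of the `k`-th term, the remaining growth is `k^(2(q-1))`
  -- against `4^(-k)`; rounding the exponent up to a natural number gives a standard summable
  -- series.
  set r : ℕ := ⌈2 * (q - 1)⌉₊ with hr
  set a : ℕ → ℝ := fun k => 16 * Real.exp 1 ^ 2 * ((k : ℝ) ^ r * (1 / 4 : ℝ) ^ k) with ha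
  have ha0 : ∀ k, 0 ≤ a k := fun k => by positivity
  have hs : Summable a :=
    (summable_pow_mul_geometric_of_norm_lt_one r (by norm_num : ‖(1 / 4 : ℝ)‖ < 1)).mul_left _
  refine ⟨∑' k, a k + 1, by have : 0 ≤ ∑' k, a k := tsum_nonneg ha0; linarith, fun m t ht htm => ?_⟩
  have hterm : ∀ k ∈ Finset.range (m + 1), (if k = 0 then 1 else if k = 1 then 0 else
      t ^ k * ((k : ℝ) ^ q) ^ k / k.factorial) ≤ (if k = 0 then 1 else 0) + t ^ 2 * a k := by
    intro k hk
    rcases eq_or_ne k 0 with rfl | hk0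
    · simp; exact mul_nonneg (sq_nonneg t) (ha0 0)
    rcases eq_or_ne k 1 with rfl | hk1
    · simp; exact mul_nonneg (sq_nonneg t) (ha0 1)
    simp only [hk0, hk1, if_false, zero_add]
    have hk2 : 2 ≤ k := by omega
    have hkm : k ≤ m := by have := Finset.mem_range.mp hk; omega
    have hkpos : (0 : ℝ) < k := by positivity
    have hk1' : (1 : ℝ) ≤ k := by exact_mod_cast (by omega : 1 ≤ k)
    have hfac : (k : ℝ) ^ k / Real.exp 1 ^ k ≤ k.factorial := by
      rw [div_le_iff₀ (by positivity), ← Real.exp_nat_mul, mul_one]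
      have := Real.pow_div_factorial_le_exp (k : ℝ) hkpos.le k
      rw [div_le_iff₀ (by positivity)] at this
      linarith
    -- As `1 - q ≤ 0`, the bound on `t` at the top order `m` is the most restrictive one and holds
    -- at every `k ≤ m`.
    have htk : t ≤ (4 * Real.exp 1)⁻¹ * (k : ℝ) ^ (1 - q) := by
      refine htm.trans (mul_le_mul_of_nonneg_left ?_ (by positivity))
      exact Real.rpow_le_rpow_of_nonpos hkpos (by exact_mod_cast hkm) (by linarith)
    have e1 : t ^ k = t ^ 2 * t ^ (k - 2) := by rw [← pow_add]; congr 1; omega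
    have e2 : t ^ (k - 2) ≤ ((4 * Real.exp 1)⁻¹ * (k : ℝ) ^ (1 - q)) ^ (k - 2) :=
      pow_le_pow_left₀ ht htk _
    have e3 : ((4 * Real.exp 1)⁻¹ * (k : ℝ) ^ (1 - q)) ^ (k - 2) =
        16 * Real.exp 1 ^ 2 * (1 / 4) ^ k * (Real.exp 1 ^ k)⁻¹ * ((k : ℝ) ^ (1 - q)) ^ (k - 2) := by
      rw [mul_pow]
      congr 1
      obtain ⟨j, rfl⟩ := Nat.exists_eq_add_of_le hk2
      simp only [Nat.add_sub_cancel_left, inv_pow, mul_pow, pow_add, one_div]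
      field_simp
      norm_num
    have e4 : ((k : ℝ) ^ (1 - q)) ^ (k - 2) * ((k : ℝ) ^ q) ^ k = (k : ℝ) ^ (2 * (q - 1)) * (k : ℝ) ^ k := by
      rw [← Real.rpow_natCast ((k : ℝ) ^ (1 - q)), ← Real.rpow_natCast ((k : ℝ) ^ q),
        ← Real.rpow_mul hkpos.le, ← Real.rpow_mul hkpos.le, ← Real.rpow_natCast (k : ℝ) k,
        ← Real.rpow_add hkpos, ← Real.rpow_add hkpos]
      congr 1
      push_cast [Nat.cast_sub hk2]
      ring
    have e5 : (k : ℝ) ^ (2 * (q - 1)) ≤ (k : ℝ) ^ r := by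
      rw [← Real.rpow_natCast (k : ℝ) r]
      exact Real.rpow_le_rpow_of_exponent_le hk1' (Nat.le_ceil _)
    calc t ^ k * ((k : ℝ) ^ q) ^ k / k.factorial
        ≤ t ^ k * ((k : ℝ) ^ q) ^ k / ((k : ℝ) ^ k / Real.exp 1 ^ k) := by
          gcongr
      _ ≤ t ^ 2 * (16 * Real.exp 1 ^ 2 * (1 / 4) ^ k * (Real.exp 1 ^ k)⁻¹ *
            ((k : ℝ) ^ (1 - q)) ^ (k - 2)) * ((k : ℝ) ^ q) ^ k / ((k : ℝ) ^ k / Real.exp 1 ^ k) := by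
          rw [e1, ← e3]
          gcongr
      _ = t ^ 2 * (16 * Real.exp 1 ^ 2 * (1 / 4) ^ k) * (Real.exp 1 ^ k)⁻¹ *
            (((k : ℝ) ^ (1 - q)) ^ (k - 2) * ((k : ℝ) ^ q) ^ k) / ((k : ℝ) ^ k / Real.exp 1 ^ k) := by
          ring
      _ = t ^ 2 * (16 * Real.exp 1 ^ 2 * (1 / 4) ^ k) * (k : ℝ) ^ (2 * (q - 1)) := by
          rw [e4]; field_simp
      _ ≤ t ^ 2 * (16 * Real.exp 1 ^ 2 * (1 / 4) ^ k) * (k : ℝ) ^ r := by gcongr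
      _ = t ^ 2 * a k := by rw [ha]; ring
  calc _ ≤ ∑ k ∈ Finset.range (m + 1), ((if k = 0 then 1 else 0) + t ^ 2 * a k) :=
        Finset.sum_le_sum hterm
    _ = 1 + t ^ 2 * ∑ k ∈ Finset.range (m + 1), a k := by
        rw [Finset.sum_add_distrib, ← Finset.mul_sum]; simp
    _ ≤ 1 + t ^ 2 * ∑' k, a k := by
        gcongr; exact hs.sum_le_tsum _ fun k _ => ha0 k
    _ ≤ Real.exp (t ^ 2 * ∑' k, a k) := by linarith [Real.add_one_le_exp (t ^ 2 * ∑' k, a k)]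
    _ ≤ _ := Real.exp_le_exp.mpr (by nlinarith [sq_nonneg t])

end RandomFeatures

end

/-! ### Moment growth and centered empirical means -/

noncomputable section

namespace RandomFeatures

open ProbabilityTheory

/-- All absolute moments of `Y` exist and `E|Y|^k ≤ (A k^q)^k`. -/
def MomentGrowth {Ω : Type*} [MeasurableSpace Ω] (A q : ℝ) (Y : Ω → ℝ) (P : Measure Ω) : Prop :=
  ∀ k : ℕ, Integrable (fun ω => |Y ω| ^ k) P ∧ ∫ ω, |Y ω| ^ k ∂P ≤ (A * (k : ℝ) ^ q) ^ k

lemma MomentGrowth.integrable_abs {Ω : Type*} [MeasurableSpace Ω] {A q : ℝ} {Y : Ω → ℝ}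
    {P : Measure Ω} (h : MomentGrowth A q Y P) : Integrable (fun ω => |Y ω|) P := by
  simpa using (h 1).1

lemma MomentGrowth.integral_abs_le {Ω : Type*} [MeasurableSpace Ω] {A q : ℝ} {Y : Ω → ℝ}
    {P : Measure Ω} (h : MomentGrowth A q Y P) : ∫ ω, |Y ω| ∂P ≤ A := by
  simpa using (h 1).2

lemma MomentGrowth.abs_integral_le {Ω : Type*} [MeasurableSpace Ω] {A q : ℝ} {Y : Ω → ℝ}
    {P : Measure Ω} (h : MomentGrowth A q Y P) : |∫ ω, Y ω ∂P| ≤ A :=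
  (abs_integral_le_integral_abs).trans h.integral_abs_le

/-- Centering costs a factor `2`, by convexity of the `k`-th power. The first moment becomes exactly
zero, which is why the truncated series has no linear term and is bounded by `exp (D t²)`. -/
lemma MomentGrowth.centered_moment {Ω : Type*} [MeasurableSpace Ω] {A q : ℝ} {Y : Ω → ℝ}
    {P : Measure Ω} [IsProbabilityMeasure P] (h : MomentGrowth A q Y P) (hq : 0 ≤ q)
    (hY : Measurable Y) (k : ℕ) :
    Integrable (fun ω => (Y ω - ∫ ω', Y ω' ∂P) ^ k) P ∧
      |∫ ω, (Y ω - ∫ ω', Y ω' ∂P) ^ k ∂P| ≤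
        if k = 0 then 1 else if k = 1 then 0 else (2 * A * (k : ℝ) ^ q) ^ k := by
  set e := ∫ ω', Y ω' ∂P with he
  have hYint : Integrable Y P := (integrable_norm_iff hY.aestronglyMeasurable).mp h.integrable_abs
  have hA : 0 ≤ A := (integral_nonneg fun _ => abs_nonneg _).trans h.integral_abs_le
  have hdom : ∀ ω, |Y ω - e| ^ k ≤ 2 ^ (k - 1) * (|Y ω| ^ k + |e| ^ k) := fun ω =>
    (pow_le_pow_left₀ (abs_nonneg _) (abs_sub _ _) k).trans
      (add_pow_le (abs_nonneg _) (abs_nonneg _) k)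
  have hdomint : Integrable (fun ω => 2 ^ (k - 1) * (|Y ω| ^ k + |e| ^ k)) P :=
    ((h k).1.add (integrable_const _)).const_mul _
  have hint : Integrable (fun ω => (Y ω - e) ^ k) P := by
    refine hdomint.mono' (by fun_prop) (Filter.Eventually.of_forall fun ω => ?_)
    rw [Real.norm_eq_abs, abs_pow]; exact hdom ω
  refine ⟨hint, ?_⟩
  split_ifs with h0 h1
  · subst h0; simp
  · subst h1
    simp only [pow_one]
    rw [integral_sub hYint (integrable_const _)]
    simp [he]
  · calc |∫ ω, (Y ω - e) ^ k ∂P| ≤ ∫ ω, |(Y ω - e) ^ k| ∂P := abs_integral_le_integral_abs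
      _ ≤ ∫ ω, 2 ^ (k - 1) * (|Y ω| ^ k + |e| ^ k) ∂P := by
          refine integral_mono hint.abs hdomint fun ω => ?_
          simp only [abs_pow]; exact hdom ω
      _ = 2 ^ (k - 1) * (∫ ω, |Y ω| ^ k ∂P + |e| ^ k) := by
          rw [integral_const_mul, integral_add (h k).1 (integrable_const _)]; simp
      _ ≤ 2 ^ (k - 1) * ((A * (k : ℝ) ^ q) ^ k + (A * (k : ℝ) ^ q) ^ k) := by
          have hk : (1 : ℝ) ≤ (k : ℝ) ^ q :=
            Real.one_le_rpow (by exact_mod_cast (by omega : 1 ≤ k)) hq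
          gcongr
          · exact (h k).2
          · exact h.abs_integral_le.trans (by nlinarith)
      _ = (2 * A * (k : ℝ) ^ q) ^ k := by
          obtain ⟨j, rfl⟩ := Nat.exists_eq_succ_of_ne_zero h0
          simp only [Nat.succ_eq_add_one, Nat.add_sub_cancel, mul_pow, pow_succ]
          ring

/-- Moments of the centered mean of `N` independent copies of a variable whose moments grow like
`(A k^q)^k`. -/
lemma exists_mean_moment_bound {q : ℝ} (hq : 1 ≤ q) :
    ∃ K : ℝ, 0 < K ∧ ∀ {Ω : Type*} [MeasurableSpace Ω] (μ : Measure Ω) [IsProbabilityMeasure μ]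
      (Y : Ω → ℝ) (A : ℝ), 0 < A → Measurable Y → MomentGrowth A q Y μ →
      ∀ N m : ℕ, 0 < N → 0 < m → Even m →
        Integrable (fun ω : Fin N → Ω => |1 / (N : ℝ) * ∑ j, Y (ω j) - ∫ a, Y a ∂μ| ^ m)
          (Measure.pi fun _ => μ) ∧
        ∫ ω : Fin N → Ω, |1 / (N : ℝ) * ∑ j, Y (ω j) - ∫ a, Y a ∂μ| ^ m ∂(Measure.pi fun _ => μ)
          ≤ (K * A * max √(m / N) ((m : ℝ) ^ q / N)) ^ m := by
  obtain ⟨D, hD, hDb⟩ := exists_truncated_exp_moment_bound hq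
  refine ⟨8 * Real.exp 1 * Real.exp D, by positivity, ?_⟩
  intro Ω _ μ _ Y A hA hY hmom N m hN hm hme
  have hNr : (0 : ℝ) < N := by exact_mod_cast hN
  have hmr : (0 : ℝ) < m := by exact_mod_cast hm
  set e := ∫ a, Y a ∂μ with he
  have hcm := hmom.centered_moment (by linarith) hY
  set X : Fin N → (Fin N → Ω) → ℝ := fun j ω => Y (ω j) - e with hX
  have hXind : iIndepFun X (Measure.pi fun _ : Fin N => μ) :=
    iIndepFun_pi (X := fun _ a => Y a - e) fun _ => (hY.sub_const e).aemeasurable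
  have hXm : ∀ i, Measurable (X i) := fun i => by fun_prop
  have hXint : ∀ i (k : ℕ), Integrable (fun ω => X i ω ^ k) (Measure.pi fun _ : Fin N => μ) :=
    fun i k => (measurePreserving_eval (fun _ : Fin N => μ) i).integrable_comp_of_integrable
      (hcm k).1
  set b : ℕ → ℝ := fun k => if k = 0 then 1 else if k = 1 then 0 else
    (2 * A * (k : ℝ) ^ q) ^ k / k.factorial with hb
  have hXb : ∀ i (k : ℕ), |∫ ω, X i ω ^ k ∂(Measure.pi fun _ : Fin N => μ)| / k.factorial ≤ b k := by
    intro i k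
    have h1 : ∫ ω, X i ω ^ k ∂(Measure.pi fun _ : Fin N => μ) = ∫ a, (Y a - e) ^ k ∂μ :=
      integral_comp_eval (μ := fun _ : Fin N => μ) (i := i) (f := fun a => (Y a - e) ^ k)
        (hcm k).1.1
    rw [h1, div_le_iff₀ (by positivity)]
    refine (hcm k).2.trans (le_of_eq ?_)
    rw [hb]
    rcases eq_or_ne k 0 with rfl | h0
    · simp
    rcases eq_or_ne k 1 with rfl | h1
    · simp
    simp only [h0, h1, if_false]
    field_simp
  obtain ⟨hSint, hS⟩ := sum_moments_le_pow hXind hXm hXint hXb Finset.univ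
  -- Evenness of `m` removes the absolute value, so that the signed moments of the sum suffice.
  have hmean : ∀ ω : Fin N → Ω, |1 / (N : ℝ) * ∑ j, Y (ω j) - e| ^ m
      = (1 / (N : ℝ)) ^ m * (∑ j, X j ω) ^ m := by
    intro ω
    rw [hme.pow_abs, ← mul_pow]
    congr 1
    simp only [hX, Finset.sum_sub_distrib, Finset.sum_const, Finset.card_univ, Fintype.card_fin,
      nsmul_eq_mul]
    field_simp
  simp_rw [hmean]
  refine ⟨(hSint m).const_mul _, ?_⟩
  rw [integral_const_mul]
  -- The first entry makes the product of `N` factors `exp (D t²)` at most `exp (D m)`; the second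
  -- keeps the truncated series under control. They yield the two regimes of the final maximum.
  set t : ℝ := min √(m / N) ((4 * Real.exp 1)⁻¹ * (m : ℝ) ^ (1 - q)) with ht
  have htpos : 0 < t := lt_min (Real.sqrt_pos.mpr (by positivity)) (by positivity)
  set l : ℝ := t / (2 * A) with hl
  have hlpos : 0 < l := by positivity
  have h1 := hS m l hlpos.le
  have hterm : ∑ k ∈ Finset.range (m + 1), b k * l ^ k ≤ Real.exp (D * t ^ 2) := by
    refine le_trans (le_of_eq (Finset.sum_congr rfl fun k _ => ?_)) (hDb m t htpos.le (min_le_right _ _))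
    rw [hb]
    rcases eq_or_ne k 0 with rfl | h0
    · simp
    rcases eq_or_ne k 1 with rfl | h1
    · simp
    simp only [h0, h1, if_false, hl, mul_pow, div_pow]
    field_simp
  have hb0 : ∀ k, 0 ≤ b k := fun k => by
    simp only [hb]; split_ifs <;> positivity
  -- Only the top term `k = m` of the nonnegative truncated series is kept.
  have h2 : |∫ ω, (∑ j, X j ω) ^ m ∂(Measure.pi fun _ : Fin N => μ)| / m.factorial * l ^ m
      ≤ Real.exp (D * m) := by
    refine (Finset.single_le_sum (f := fun k : ℕ => |∫ ω, (∑ j, X j ω) ^ k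
      ∂(Measure.pi fun _ : Fin N => μ)| / k.factorial * l ^ k) (fun k _ => by positivity)
      (Finset.self_mem_range_succ m)).trans (h1.trans ?_)
    refine (pow_le_pow_left₀ (Finset.sum_nonneg fun k _ => mul_nonneg (hb0 k) (by positivity))
      hterm _).trans ?_
    rw [← Real.exp_nat_mul, Finset.card_univ, Fintype.card_fin]
    apply Real.exp_le_exp.mpr
    have : t ^ 2 ≤ m / N := by
      calc t ^ 2 ≤ √(m / N) ^ 2 := pow_le_pow_left₀ htpos.le (min_le_left _ _) 2
        _ = m / N := Real.sq_sqrt (by positivity)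
    rw [le_div_iff₀ hNr] at this
    nlinarith
  have hfac : (m.factorial : ℝ) ≤ (m : ℝ) ^ m := by exact_mod_cast Nat.factorial_le_pow m
  have hmt : m / (N * t) ≤ 4 * Real.exp 1 * max √(m / N) ((m : ℝ) ^ q / N) := by
    have he1 : 1 ≤ Real.exp 1 := Real.one_le_exp zero_le_one
    rcases min_choice √(m / N) ((4 * Real.exp 1)⁻¹ * (m : ℝ) ^ (1 - q)) with h | h
    · rw [ht, h]
      have : (m : ℝ) / (N * √(m / N)) = √(m / N) := by
        have hs := Real.mul_self_sqrt (show 0 ≤ (m : ℝ) / N by positivity)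
        have : 0 < √((m : ℝ) / N) := Real.sqrt_pos.mpr (by positivity)
        rw [div_eq_iff (by positivity)]
        rw [mul_comm (N : ℝ), ← mul_assoc, hs]; field_simp
      rw [this]
      have h0 : 0 ≤ √((m : ℝ) / N) := Real.sqrt_nonneg _
      have := le_max_left √((m : ℝ) / N) ((m : ℝ) ^ q / N)
      nlinarith
    · rw [ht, h]
      have : (m : ℝ) / (N * ((4 * Real.exp 1)⁻¹ * (m : ℝ) ^ (1 - q)))
          = 4 * Real.exp 1 * ((m : ℝ) ^ q / N) := by
        rw [Real.rpow_sub hmr, Real.rpow_one]; field_simp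
      rw [this]
      exact mul_le_mul_of_nonneg_left (le_max_right _ _) (by positivity)
  calc (1 / (N : ℝ)) ^ m * ∫ ω, (∑ j, X j ω) ^ m ∂(Measure.pi fun _ : Fin N => μ)
      ≤ (1 / (N : ℝ)) ^ m * (Real.exp (D * m) * m.factorial / l ^ m) := by
        refine mul_le_mul_of_nonneg_left ((le_abs_self _).trans ?_) (by positivity)
        rw [le_div_iff₀ (by positivity)]
        rw [div_mul_eq_mul_div, div_le_iff₀ (by positivity)] at h2
        exact h2
    _ ≤ (1 / (N : ℝ)) ^ m * (Real.exp (D * m) * (m : ℝ) ^ m / l ^ m) := by gcongr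
    _ = (2 * A * Real.exp D * (m / (N * t))) ^ m := by
        rw [show D * (m : ℝ) = m * D by ring, Real.exp_nat_mul, ← mul_pow, ← div_pow, ← mul_pow, hl]
        congr 1; field_simp
    _ ≤ (8 * Real.exp 1 * Real.exp D * A * max √(m / N) ((m : ℝ) ^ q / N)) ^ m := by
        refine pow_le_pow_left₀ (by positivity) ?_ m
        calc _ ≤ 2 * A * Real.exp D * (4 * Real.exp 1 * max √(m / N) ((m : ℝ) ^ q / N)) := by gcongr
          _ = _ := by ring

end RandomFeatures

end

noncomputable section

namespace RandomFeatures

open ProbabilityTheory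

/-! ### Deviation of empirical means at level `N^{-κ n}` -/

/-- The deviation rate `√(n log N / N) ∨ (n log N)^q / N`. -/
def devRate (q : ℝ) (n N : ℕ) : ℝ :=
  max √(n * Real.log N / N) ((n * Real.log N) ^ q / N)

lemma devRate_nonneg (q : ℝ) (n N : ℕ) : 0 ≤ devRate q n N :=
  (Real.sqrt_nonneg _).trans (le_max_left _ _)

lemma one_le_log_of_three_le {N : ℕ} (hN : 3 ≤ N) : 1 ≤ Real.log N := by
  have h3 : (3 : ℝ) ≤ N := by exact_mod_cast hN
  rw [Real.le_log_iff_exp_le (by linarith)]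
  linarith [Real.exp_one_lt_d9]

lemma one_le_mul_log {n N : ℕ} (hn : 1 ≤ n) (hN : 3 ≤ N) : 1 ≤ n * Real.log N := by
  have h1 : (1 : ℝ) ≤ n := by exact_mod_cast hn
  nlinarith [one_le_log_of_three_le hN]

lemma devRate_pos {q : ℝ} {n N : ℕ} (hn : 1 ≤ n) (hN : 3 ≤ N) : 0 < devRate q n N := by
  have := one_le_mul_log hn hN
  have hNr : (0 : ℝ) < N := by positivity
  exact lt_max_of_lt_left (Real.sqrt_pos.mpr (by positivity))

/-- An even moment order comparable to `n log N`. -/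
lemma exists_even_order {q : ℝ} (hq : 1 ≤ q) {n N : ℕ} (hn : 1 ≤ n) (hN : 3 ≤ N) :
    ∃ m : ℕ, 2 ≤ m ∧ Even m ∧ n * Real.log N ≤ m ∧
      max √(m / N) ((m : ℝ) ^ q / N) ≤ 4 ^ q * devRate q n N := by
  have hL := one_le_mul_log hn hN
  set L := n * Real.log N with hLdef
  have hNr : (0 : ℝ) < N := by positivity
  have hc1 : L ≤ ⌈L⌉₊ := Nat.le_ceil L
  have hc2 : (⌈L⌉₊ : ℝ) < L + 1 := Nat.ceil_lt_add_one (by linarith)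
  have hc3 : 1 ≤ ⌈L⌉₊ := Nat.one_le_ceil_iff.mpr (by linarith)
  -- Since `L ≥ 1`, this order is at most `4 * L`, whence the factor `4 ^ q`.
  refine ⟨2 * ⌈L⌉₊, by omega, even_two_mul _, by push_cast; linarith, ?_⟩
  have hm : ((2 * ⌈L⌉₊ : ℕ) : ℝ) ≤ 4 * L := by push_cast; linarith
  have h4 : (4 : ℝ) ≤ 4 ^ q := by
    simpa using Real.rpow_le_rpow_of_exponent_le (by norm_num : (1 : ℝ) ≤ 4) hq
  unfold devRate
  rw [← hLdef]
  apply max_le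
  · calc √(((2 * ⌈L⌉₊ : ℕ) : ℝ) / N) ≤ √(4 ^ 2 * (L / N)) := by
          apply Real.sqrt_le_sqrt
          rw [← mul_div_assoc]
          gcongr
          linarith
      _ = 4 * √(L / N) := by
          rw [Real.sqrt_mul (by norm_num), Real.sqrt_sq (by norm_num)]
      _ ≤ 4 ^ q * max √(L / N) (L ^ q / N) := by
          gcongr
          exact le_max_left _ _
  · calc ((2 * ⌈L⌉₊ : ℕ) : ℝ) ^ q / N ≤ (4 * L) ^ q / N := by gcongr
      _ = 4 ^ q * (L ^ q / N) := by rw [Real.mul_rpow (by norm_num) (by linarith)]; ring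
      _ ≤ _ := by gcongr; exact le_max_right _ _

/-- Monotonicity of `L^p` norms on a probability space. The right side is an integral of `m`-th
powers, to which Fubini applies. -/
lemma eLpNorm_two_le_of_lintegral_pow {𝒳 : Type*} [MeasurableSpace 𝒳] {P : Measure 𝒳}
    [IsProbabilityMeasure P] {h : 𝒳 → ℝ} (hh : Measurable h) {m : ℕ} (hm : 2 ≤ m) :
    eLpNorm h 2 P ^ m ≤ ∫⁻ x, ‖h x‖ₑ ^ m ∂P := by
  have hm0 : (m : ENNReal) ≠ 0 := by simp; omega
  have h1 : eLpNorm h 2 P ≤ eLpNorm h m P :=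
    eLpNorm_le_eLpNorm_of_exponent_le (by exact_mod_cast hm) hh.aestronglyMeasurable
  refine (pow_le_pow_left₀ (zero_le) h1 m).trans (le_of_eq ?_)
  rw [eLpNorm_eq_lintegral_rpow_enorm_toReal hm0 (ENNReal.natCast_ne_top m)]
  simp only [ENNReal.toReal_natCast, ENNReal.rpow_natCast]
  rw [← ENNReal.rpow_natCast, ← ENNReal.rpow_mul]
  have : (1 / (m : ℝ)) * m = 1 := by
    have : (m : ℝ) ≠ 0 := by positivity
    field_simp
  rw [this, ENNReal.rpow_one]

/-- Uniform-in-`L²(P)` deviation of empirical means of a family of variables. -/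
lemma exists_eLpNorm_mean_tail {q : ℝ} (hq : 1 ≤ q) (κ : ℝ) (hκ : 0 ≤ κ) :
    ∃ K : ℝ, 0 < K ∧ ∀ {Ω 𝒳 : Type*} [MeasurableSpace Ω] [MeasurableSpace 𝒳]
      (μ : Measure Ω) [IsProbabilityMeasure μ] (P : Measure 𝒳) [IsProbabilityMeasure P]
      (Y : 𝒳 → Ω → ℝ) (A : ℝ), 0 < A → Measurable (Function.uncurry Y) →
      (∀ᵐ x ∂P, MomentGrowth A q (Y x) μ) →
      ∀ n N : ℕ, 1 ≤ n → 3 ≤ N →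
        (Measure.pi fun _ => μ) {ω : Fin N → Ω | ENNReal.ofReal (K * A * devRate q n N) <
          eLpNorm (fun x => 1 / (N : ℝ) * ∑ j, Y x (ω j) - ∫ a, Y x a ∂μ) 2 P}
          ≤ ENNReal.ofReal ((N : ℝ) ^ (-(κ * n))) := by
  obtain ⟨K, hK, hKb⟩ := exists_mean_moment_bound hq
  -- The factor `exp κ` in the threshold becomes `exp (-κ m)` after Markov's inequality at order
  -- `m`, and `m ≥ n log N` turns that into `N^(-κ n)`.
  refine ⟨Real.exp κ * (K * 4 ^ q), by positivity, ?_⟩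
  intro Ω 𝒳 _ _ μ _ P _ Y A hA hY hmom n N hn hN
  obtain ⟨m, hm2, hme, hmL, hmR⟩ := exists_even_order hq hn hN
  have hNr : (0 : ℝ) < N := by positivity
  have hR := devRate_pos (q := q) hn hN
  set h : (Fin N → Ω) → 𝒳 → ℝ := fun ω x => 1 / (N : ℝ) * ∑ j, Y x (ω j) - ∫ a, Y x a ∂μ with hh
  have hYx : Measurable fun x => ∫ a, Y x a ∂μ :=
    (StronglyMeasurable.integral_prod_right (f := Y) hY.stronglyMeasurable).measurable
  have hYj : ∀ j : Fin N, Measurable fun p : (Fin N → Ω) × 𝒳 => Y p.2 (p.1 j) := fun j =>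
    hY.comp (measurable_snd.prodMk ((measurable_pi_apply j).comp measurable_fst))
  have hhm : Measurable (Function.uncurry h) := by
    apply Measurable.sub
    · exact (Finset.measurable_sum _ fun j _ => hYj j).const_mul _
    · exact hYx.comp measurable_snd
  set B := K * A * (4 ^ q * devRate q n N) with hB
  have hBpos : 0 < B := by positivity
  set T := Real.exp κ * (K * 4 ^ q) * A * devRate q n N with hT
  have hTB : T = Real.exp κ * B := by rw [hT, hB]; ring
  have hTpos : 0 < T := by rw [hTB]; positivity
  have hint : ∫⁻ ω, ∫⁻ x, ‖h ω x‖ₑ ^ m ∂P ∂(Measure.pi fun _ : Fin N => μ)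
      ≤ ENNReal.ofReal (B ^ m) := by
    -- After the exchange, the moment bound is needed only for each fixed `x` outside a null set.
    rw [lintegral_lintegral_swap (by
      exact ((hhm.enorm).pow_const m).aemeasurable)]
    calc _ ≤ ∫⁻ x, ENNReal.ofReal (B ^ m) ∂P := by
          refine lintegral_mono_ae ?_
          filter_upwards [hmom] with x hx
          obtain ⟨h1, h2⟩ := hKb μ (Y x) A hA (hY.comp measurable_prodMk_left) hx N m
            (by omega) (by omega) hme
          have h3 : ∀ ω, ‖h ω x‖ₑ ^ m = ENNReal.ofReal (|h ω x| ^ m) := fun ω => by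
            rw [Real.enorm_eq_ofReal_abs, ENNReal.ofReal_pow (abs_nonneg _)]
          simp_rw [h3]
          rw [← ofReal_integral_eq_lintegral_ofReal h1
            (Filter.Eventually.of_forall fun ω => by positivity)]
          apply ENNReal.ofReal_le_ofReal
          refine h2.trans ?_
          refine pow_le_pow_left₀ (by positivity) ?_ m
          rw [hB]; gcongr
      _ = _ := by simp
  have hmeas : Measurable fun ω => ∫⁻ x, ‖h ω x‖ₑ ^ m ∂P :=
    Measurable.lintegral_prod_right (f := fun ω x => ‖h ω x‖ₑ ^ m)
      ((hhm.enorm).pow_const m)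
  have hTm : ENNReal.ofReal (T ^ m) ≠ 0 := by
    rw [ENNReal.ofReal_ne_zero_iff]; positivity
  calc (Measure.pi fun _ => μ) {ω : Fin N → Ω | ENNReal.ofReal T < eLpNorm (h ω) 2 P}
      ≤ (Measure.pi fun _ => μ) {ω : Fin N → Ω | ENNReal.ofReal (T ^ m) ≤ ∫⁻ x, ‖h ω x‖ₑ ^ m ∂P} := by
        refine measure_mono fun ω hω => ?_
        simp only [Set.mem_ofPred_eq] at hω ⊢
        refine le_trans ?_ (eLpNorm_two_le_of_lintegral_pow (hhm.comp measurable_prodMk_left) hm2)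
        rw [ENNReal.ofReal_pow hTpos.le]
        exact pow_le_pow_left₀ (zero_le) hω.le m
    _ ≤ (∫⁻ ω, ∫⁻ x, ‖h ω x‖ₑ ^ m ∂P ∂(Measure.pi fun _ : Fin N => μ)) / ENNReal.ofReal (T ^ m) :=
        meas_ge_le_lintegral_div hmeas.aemeasurable hTm ENNReal.ofReal_ne_top
    _ ≤ ENNReal.ofReal (B ^ m) / ENNReal.ofReal (T ^ m) := by gcongr
    _ = ENNReal.ofReal (B ^ m / T ^ m) := (ENNReal.ofReal_div_of_pos (by positivity)).symm
    _ ≤ _ := by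
        apply ENNReal.ofReal_le_ofReal
        have : B ^ m / T ^ m = Real.exp (-(κ * m)) := by
          rw [hTB, mul_pow (Real.exp κ), ← Real.exp_nat_mul, Real.exp_neg, mul_comm (m : ℝ)]
          field_simp
        rw [this, Real.rpow_def_of_pos hNr]
        apply Real.exp_le_exp.mpr
        nlinarith

/-- Deviation of the empirical mean of a single variable. -/
lemma exists_mean_tail {q : ℝ} (hq : 1 ≤ q) (κ : ℝ) (hκ : 0 ≤ κ) :
    ∃ K : ℝ, 0 < K ∧ ∀ {Ω : Type*} [MeasurableSpace Ω]
      (μ : Measure Ω) [IsProbabilityMeasure μ] (Y : Ω → ℝ) (A : ℝ), 0 < A → Measurable Y →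
      MomentGrowth A q Y μ → ∀ n N : ℕ, 1 ≤ n → 3 ≤ N →
        (Measure.pi fun _ => μ) {ω : Fin N → Ω | K * A * devRate q n N <
          |1 / (N : ℝ) * ∑ j, Y (ω j) - ∫ a, Y a ∂μ|}
          ≤ ENNReal.ofReal ((N : ℝ) ^ (-(κ * n))) := by
  obtain ⟨K, hK, hKb⟩ := exists_eLpNorm_mean_tail.{_, 0} hq κ hκ
  refine ⟨K, hK, ?_⟩
  intro Ω _ μ _ Y A hA hY hmom n N hn hN
  -- On a one-point space with a Dirac mass the `L²` norm is the absolute value.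
  refine le_trans (measure_mono fun ω hω => ?_)
    (hKb μ (Measure.dirac ()) (fun _ => Y) A hA (hY.comp measurable_snd)
      (Filter.Eventually.of_forall fun _ => hmom) n N hn hN)
  simp only [Set.mem_ofPred_eq] at hω ⊢
  rw [eLpNorm_const _ (by simp) (IsProbabilityMeasure.ne_zero _)]
  simp only [measure_univ, ENNReal.one_rpow, mul_one, Real.enorm_eq_ofReal_abs]
  exact (ENNReal.ofReal_lt_ofReal_iff_of_nonneg (mul_nonneg (mul_nonneg hK.le hA.le)
    (devRate_nonneg _ _ _))).mpr hω

end RandomFeatures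

end

noncomputable section

namespace RandomFeatures

open ProbabilityTheory

/-! ### A net of the unit sphere -/

/-- Cut the cube into cells of side `δ / n` and choose one point of the sphere in each cell that
meets it; points of a common cell differ by at most `δ / n` in each coordinate. The extra `n^n`
compared with a volumetric net is harmless, since powers `N^(κ n)` are affordable later. -/
lemma exists_sphere_net {n : ℕ} (hn : 1 ≤ n) {δ : ℝ} (hδ : 0 < δ) (hδ1 : δ ≤ 1) :
    ∃ S : Finset (EuclideanSpace ℝ (Fin n)), (∀ v ∈ S, ‖v‖ = 1) ∧
      (S.card : ℝ) ≤ (5 * n / δ) ^ n ∧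
      ∀ v : EuclideanSpace ℝ (Fin n), ‖v‖ = 1 → ∃ w ∈ S, ‖v - w‖ ≤ δ := by
  classical
  have hn1 : (1 : ℝ) ≤ n := by exact_mod_cast hn
  set M : ℕ := ⌈n / δ⌉₊ with hM
  have hM1 : n / δ ≤ M := Nat.le_ceil _
  have hM2 : (M : ℝ) < n / δ + 1 := Nat.ceil_lt_add_one (by positivity)
  set cell : EuclideanSpace ℝ (Fin n) → Fin n → ℤ := fun v i => ⌊v i * (n / δ)⌋ with hcell
  set G : Finset (Fin n → ℤ) := Fintype.piFinset fun _ => Finset.Icc (-(M : ℤ)) M with hG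
  have hcellG : ∀ v : EuclideanSpace ℝ (Fin n), ‖v‖ = 1 → cell v ∈ G := by
    intro v hv
    rw [hG, Fintype.mem_piFinset]
    intro i
    have h1 : |v i| ≤ 1 := by
      have := EuclideanSpace.norm_sq_eq v
      rw [hv] at this
      have h2 : ‖v i‖ ^ 2 ≤ ∑ i, ‖v i‖ ^ 2 :=
        Finset.single_le_sum (f := fun i => ‖v i‖ ^ 2) (fun _ _ => sq_nonneg _) (Finset.mem_univ i)
      rw [Real.norm_eq_abs] at h2
      nlinarith [abs_nonneg (v i)]
    have hnδ : 0 < n / δ := by positivity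
    have hab := abs_le.mp h1
    rw [Finset.mem_Icc, hcell]
    constructor
    · apply Int.le_floor.mpr
      push_cast
      nlinarith
    · have : (⌊v i * (n / δ)⌋ : ℝ) ≤ M := (Int.floor_le _).trans (by nlinarith)
      exact_mod_cast this
  choose! rep hrep using fun (g : Fin n → ℤ)
    (hg : ∃ v : EuclideanSpace ℝ (Fin n), ‖v‖ = 1 ∧ cell v = g) => hg
  set S := (G.filter fun g => ∃ v : EuclideanSpace ℝ (Fin n), ‖v‖ = 1 ∧ cell v = g).image rep
  refine ⟨S, ?_, ?_, ?_⟩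
  · intro v hv
    obtain ⟨g, hg, rfl⟩ := Finset.mem_image.mp hv
    exact (hrep g (Finset.mem_filter.mp hg).2).1
  · have h1 : S.card ≤ G.card := Finset.card_image_le.trans (Finset.card_filter_le _ _)
    have h2 : G.card = (2 * M + 1) ^ n := by
      rw [hG, Fintype.card_piFinset]
      simp only [Int.card_Icc, Finset.prod_const, Finset.card_univ, Fintype.card_fin]
      congr 1
      omega
    calc (S.card : ℝ) ≤ ((2 * M + 1) ^ n : ℕ) := by rw [← h2]; exact_mod_cast h1
      _ = (2 * (M : ℝ) + 1) ^ n := by push_cast; ring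
      _ ≤ (5 * n / δ) ^ n := by
          refine pow_le_pow_left₀ (by positivity) ?_ n
          have : 1 ≤ n / δ := by rw [le_div_iff₀ hδ]; linarith
          rw [mul_div_assoc]
          linarith
  · intro v hv
    have hex : ∃ v' : EuclideanSpace ℝ (Fin n), ‖v'‖ = 1 ∧ cell v' = cell v := ⟨v, hv, rfl⟩
    refine ⟨rep (cell v), Finset.mem_image_of_mem _
      (Finset.mem_filter.mpr ⟨hcellG v hv, hex⟩), ?_⟩
    have hc := (hrep (cell v) hex).2
    have hi : ∀ i, ‖(v - rep (cell v)) i‖ ^ 2 ≤ (δ / n) ^ 2 := by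
      intro i
      have h1 : ⌊v i * (n / δ)⌋ = ⌊(rep (cell v)) i * (n / δ)⌋ := (congrFun hc i).symm
      have h2 := Int.abs_sub_lt_one_of_floor_eq_floor h1
      rw [← sub_mul, abs_mul, abs_of_pos (show (0 : ℝ) < n / δ by positivity)] at h2
      refine pow_le_pow_left₀ (norm_nonneg _) ?_ 2
      rw [PiLp.sub_apply, Real.norm_eq_abs, le_div_iff₀ (by positivity)]
      have h3 : |v i - rep (cell v) i| * n = |v i - rep (cell v) i| * (n / δ) * δ := by
        field_simp
      nlinarith
    have hsq : ‖v - rep (cell v)‖ ^ 2 ≤ δ ^ 2 := by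
      rw [EuclideanSpace.norm_sq_eq]
      calc _ ≤ ∑ _i : Fin n, (δ / n) ^ 2 := Finset.sum_le_sum fun i _ => hi i
        _ = δ ^ 2 / n := by simp; field_simp
        _ ≤ δ ^ 2 := div_le_self (sq_nonneg δ) hn1
    exact (pow_le_pow_iff_left₀ (norm_nonneg _) hδ.le two_ne_zero).mp hsq

/-! ### Maximizers of the dual objective -/

variable {n : ℕ}

lemma integrable_abs_inner_rpow {Ω : Type*} [MeasurableSpace Ω] {μ : Measure Ω}
    {X : Ω → EuclideanSpace ℝ (Fin n)} (hX : Measurable X) {Q : ℝ} (hQ : 0 ≤ Q)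
    (hint : Integrable (fun ω => ‖X ω‖ ^ Q) μ) (θ : EuclideanSpace ℝ (Fin n)) :
    Integrable (fun ω => |inner ℝ (X ω) θ| ^ Q) μ := by
  refine (hint.mul_const (‖θ‖ ^ Q)).mono' (by fun_prop) (Filter.Eventually.of_forall fun ω => ?_)
  rw [Real.norm_of_nonneg (by positivity), ← Real.mul_rpow (norm_nonneg _) (norm_nonneg _)]
  exact Real.rpow_le_rpow (abs_nonneg _) (abs_real_inner_le_norm _ _) hQ

lemma abs_inner_mul_powLink_le {Q R : ℝ} (hQ : 2 ≤ Q) (a v θ : EuclideanSpace ℝ (Fin n))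
    (hθ : ‖θ‖ ≤ R) :
    |inner ℝ a v * powLink Q (inner ℝ a θ)| ≤ ‖v‖ * R ^ (Q - 1) * ‖a‖ ^ Q := by
  rw [abs_mul, abs_powLink (by linarith)]
  have hR : 0 ≤ R := (norm_nonneg _).trans hθ
  have h1 : |inner ℝ a θ| ≤ ‖a‖ * R :=
    (abs_real_inner_le_norm _ _).trans (mul_le_mul_of_nonneg_left hθ (norm_nonneg _))
  have h2 : ‖a‖ ^ Q = ‖a‖ * ‖a‖ ^ (Q - 1) := by
    rcases (norm_nonneg a).eq_or_lt with h | h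
    · rw [← h, Real.zero_rpow (by linarith)]; simp
    · rw [mul_comm, ← Real.rpow_add_one h.ne']; congr 1; ring
  calc _ ≤ (‖a‖ * ‖v‖) * (‖a‖ * R) ^ (Q - 1) := by
        refine mul_le_mul (abs_real_inner_le_norm _ _)
          (Real.rpow_le_rpow (abs_nonneg _) h1 (by linarith)) (by positivity) (by positivity)
    _ = _ := by rw [Real.mul_rpow (norm_nonneg _) hR, h2]; ring

lemma integrable_inner_mul_powLink {Ω : Type*} [MeasurableSpace Ω] {μ : Measure Ω}
    {X : Ω → EuclideanSpace ℝ (Fin n)} (hX : Measurable X) {Q : ℝ} (hQ : 2 ≤ Q)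
    (hint : Integrable (fun ω => ‖X ω‖ ^ Q) μ) (v θ : EuclideanSpace ℝ (Fin n)) :
    Integrable (fun ω => inner ℝ (X ω) v * powLink Q (inner ℝ (X ω) θ)) μ := by
  have := measurable_powLink Q
  refine (hint.const_mul (‖v‖ * ‖θ‖ ^ (Q - 1))).mono' (by fun_prop)
    (Filter.Eventually.of_forall fun ω => ?_)
  exact abs_inner_mul_powLink_le hQ _ _ _ le_rfl

/-- Differentiation under the integral along a line; for `|t| ≤ 1` the derivative is dominated by a
multiple of `‖X‖^Q`. -/
lemma hasDerivAt_dual {Ω : Type*} [MeasurableSpace Ω] {μ : Measure Ω}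
    {X : Ω → EuclideanSpace ℝ (Fin n)} (hX : Measurable X) {Q : ℝ} (hQ : 2 ≤ Q)
    (hint : Integrable (fun ω => ‖X ω‖ ^ Q) μ) (y θ v : EuclideanSpace ℝ (Fin n)) :
    HasDerivAt (fun t : ℝ => inner ℝ (θ + t • v) y - ∫ ω, |inner ℝ (X ω) (θ + t • v)| ^ Q / Q ∂μ)
      (inner ℝ v y - ∫ ω, inner ℝ (X ω) v * powLink Q (inner ℝ (X ω) θ) ∂μ) 0 := by
  have hpl := measurable_powLink Q
  have h1 : HasDerivAt (fun t : ℝ => inner ℝ (θ + t • v) y) (inner ℝ v y) 0 := by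
    simp only [inner_add_left, real_inner_smul_left]
    simpa using ((hasDerivAt_id (0 : ℝ)).mul_const (inner ℝ v y)).const_add (inner ℝ θ y)
  have h2 := (hasDerivAt_integral_of_dominated_loc_of_deriv_le (μ := μ) (𝕜 := ℝ)
    (F := fun (t : ℝ) ω => |inner ℝ (X ω) (θ + t • v)| ^ Q / Q)
    (F' := fun (t : ℝ) ω => inner ℝ (X ω) v * powLink Q (inner ℝ (X ω) (θ + t • v)))
    (x₀ := 0) (s := Metric.ball 0 1)
    (bound := fun ω => ‖v‖ * (‖θ‖ + ‖v‖) ^ (Q - 1) * ‖X ω‖ ^ Q)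
    (Metric.ball_mem_nhds _ one_pos)
    (Filter.Eventually.of_forall fun t => Measurable.aestronglyMeasurable (by fun_prop))
    ((integrable_abs_inner_rpow hX (by linarith) hint _).div_const Q)
    (by fun_prop)
    (Filter.Eventually.of_forall fun ω t ht => by
      rw [Real.norm_eq_abs]
      refine abs_inner_mul_powLink_le hQ _ _ _ ((norm_add_le _ _).trans ?_)
      rw [norm_smul]
      have : ‖t‖ ≤ 1 := by simpa using (Metric.mem_ball.mp ht).le
      nlinarith [norm_nonneg v])
    (hint.const_mul _)
    (Filter.Eventually.of_forall fun ω t _ => by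
      have h3 : HasDerivAt (fun t : ℝ => inner ℝ (X ω) (θ + t • v)) (inner ℝ (X ω) v) t := by
        simp only [inner_add_right, real_inner_smul_right]
        simpa using ((hasDerivAt_id t).mul_const (inner ℝ (X ω) v)).const_add (inner ℝ (X ω) θ)
      have h4 := (hasDerivAt_abs_rpow_div (by linarith : 1 < Q)
        (inner ℝ (X ω) (θ + t • v))).comp t h3
      rw [mul_comm] at h4
      exact h4)).2
  simp only [zero_smul, add_zero] at h2
  exact h1.sub h2

lemma continuous_integral_abs_inner_rpow {Ω : Type*} [MeasurableSpace Ω] {μ : Measure Ω}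
    {X : Ω → EuclideanSpace ℝ (Fin n)} (hX : Measurable X) {Q : ℝ} (hQ : 2 ≤ Q)
    (hint : Integrable (fun ω => ‖X ω‖ ^ Q) μ) :
    Continuous fun θ : EuclideanSpace ℝ (Fin n) => ∫ ω, |inner ℝ (X ω) θ| ^ Q / Q ∂μ := by
  rw [continuous_iff_continuousAt]
  intro θ
  refine continuousAt_of_dominated (bound := fun ω => ‖X ω‖ ^ Q * (‖θ‖ + 1) ^ Q / Q)
    (Filter.Eventually.of_forall fun θ => Measurable.aestronglyMeasurable (by fun_prop)) ?_ ((hint.mul_const _).div_const _)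
    (Filter.Eventually.of_forall fun ω => ?_)
  · filter_upwards [Metric.ball_mem_nhds θ one_pos] with θ' hθ'
    refine Filter.Eventually.of_forall fun ω => ?_
    have h : ‖θ'‖ ≤ ‖θ‖ + 1 := by
      have h1 := norm_sub_norm_le θ' θ
      have h2 : ‖θ' - θ‖ < 1 := by simpa [dist_eq_norm] using hθ'
      linarith
    rw [Real.norm_of_nonneg (by positivity), ← Real.mul_rpow (norm_nonneg _) (by positivity)]
    gcongr
    exact (abs_real_inner_le_norm _ _).trans (by gcongr)
  · have : Continuous fun θ' : EuclideanSpace ℝ (Fin n) => |inner ℝ (X ω) θ'| ^ Q / Q :=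
      ((continuous_const.inner continuous_id).abs.rpow_const fun _ => Or.inr (by linarith)).div_const _
    exact this.continuousAt

/-- Existence and uniqueness of the maximizer of a coercive dual objective, with its first-order
condition. -/
lemma exists_isArgmax_dual {Ω : Type*} [MeasurableSpace Ω] {μ : Measure Ω}
    {X : Ω → EuclideanSpace ℝ (Fin n)} (hX : Measurable X) {Q : ℝ} (hQ : 2 ≤ Q)
    (hint : Integrable (fun ω => ‖X ω‖ ^ Q) μ) {m₀ : ℝ} (hm₀ : 0 < m₀)
    (hcoer : ∀ θ, m₀ * ‖θ‖ ^ Q ≤ ∫ ω, |inner ℝ (X ω) θ| ^ Q ∂μ) (y : EuclideanSpace ℝ (Fin n)) :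
    ∃ θ₀, IsArgmax (fun θ => inner ℝ θ y - ∫ ω, |inner ℝ (X ω) θ| ^ Q / Q ∂μ) θ₀ ∧
      ∀ v, ∫ ω, inner ℝ (X ω) v * powLink Q (inner ℝ (X ω) θ₀) ∂μ = inner ℝ v y := by
  set F : EuclideanSpace ℝ (Fin n) → ℝ :=
    fun θ => inner ℝ θ y - ∫ ω, |inner ℝ (X ω) θ| ^ Q / Q ∂μ with hF
  have hFc : Continuous F :=
    (continuous_id.inner continuous_const).sub (continuous_integral_abs_inner_rpow hX hQ hint)
  have hF0 : F 0 = 0 := by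
    simp [hF, Real.zero_rpow (by linarith : Q ≠ 0)]
  have hub : ∀ θ, F θ ≤ ‖θ‖ * ‖y‖ - m₀ / Q * ‖θ‖ ^ Q := by
    intro θ
    simp only [hF]
    rw [integral_div]
    have h1 := real_inner_le_norm θ y
    have h2 := div_le_div_of_nonneg_right (hcoer θ) (by linarith : 0 ≤ Q)
    have h3 : m₀ / Q * ‖θ‖ ^ Q = m₀ * ‖θ‖ ^ Q / Q := by ring
    linarith
  -- Beyond this radius `m₀ / Q * ‖θ‖^Q ≥ m₀ / Q * ‖θ‖² ≥ ‖θ‖ * ‖y‖`, so `F θ ≤ 0 = F 0` and a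
  -- maximum over the ball is global.
  set R : ℝ := 1 + ‖y‖ * Q / m₀ with hR
  have hR1 : 1 ≤ R := by
    have : 0 ≤ ‖y‖ * Q / m₀ := by have := norm_nonneg y; positivity
    linarith
  obtain ⟨θ₀, -, hmax⟩ := (isCompact_closedBall (0 : EuclideanSpace ℝ (Fin n)) R).exists_isMaxOn
    ⟨0, by simp; linarith⟩ hFc.continuousOn
  have hglob : ∀ θ, F θ ≤ F θ₀ := by
    intro θ
    by_cases hθ : ‖θ‖ ≤ R
    · exact hmax (by simpa using hθ)
    · push Not at hθ
      have h0 : F 0 ≤ F θ₀ := hmax (by simp; linarith)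
      refine le_trans ?_ h0
      rw [hF0]
      refine (hub θ).trans ?_
      have hθ1 : 1 ≤ ‖θ‖ := by linarith
      have h2 : ‖θ‖ * ‖θ‖ ≤ ‖θ‖ ^ Q := by
        have := Real.rpow_le_rpow_of_exponent_le hθ1 hQ
        rw [Real.rpow_two] at this; nlinarith
      have h3 : ‖y‖ ≤ m₀ / Q * ‖θ‖ := by
        have : ‖y‖ * Q / m₀ ≤ ‖θ‖ := by linarith
        rw [div_le_iff₀ hm₀] at this
        rw [div_mul_eq_mul_div, le_div_iff₀ (by linarith)]
        linarith
      have h4 : 0 ≤ m₀ / Q := by positivity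
      nlinarith [mul_le_mul_of_nonneg_left h2 h4, mul_le_mul_of_nonneg_left h3 (norm_nonneg θ)]
  have hfoc : ∀ θ, (∀ θ', F θ' ≤ F θ) →
      ∀ v, ∫ ω, inner ℝ (X ω) v * powLink Q (inner ℝ (X ω) θ) ∂μ = inner ℝ v y := by
    intro θ hθ v
    have hd := hasDerivAt_dual hX hQ hint y θ v
    have hloc : IsLocalMax (fun t : ℝ => F (θ + t • v)) 0 :=
      Filter.Eventually.of_forall fun t => by simpa using hθ (θ + t • v)
    have := hloc.hasDerivAt_eq_zero hd
    linarith
  refine ⟨θ₀, ?_, hfoc θ₀ hglob⟩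
  intro b hb
  by_contra hlt
  push Not at hlt
  have hbmax : ∀ θ, F θ ≤ F b := fun θ => (hglob θ).trans hlt
  have e1 := hfoc θ₀ hglob (b - θ₀)
  have e2 := hfoc b hbmax (b - θ₀)
  have hi1 := integrable_inner_mul_powLink hX hQ hint (b - θ₀) θ₀
  have hi2 := integrable_inner_mul_powLink hX hQ hint (b - θ₀) b
  have hz : ∫ ω, (inner ℝ (X ω) (b - θ₀) * powLink Q (inner ℝ (X ω) b)
      - inner ℝ (X ω) (b - θ₀) * powLink Q (inner ℝ (X ω) θ₀)) ∂μ = 0 := by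
    rw [integral_sub hi2 hi1, e1, e2, sub_self]
  have hlow : ∀ ω, (1 / 2) * |inner ℝ (X ω) b - inner ℝ (X ω) θ₀| ^ 2 *
      |inner ℝ (X ω) θ₀| ^ (Q - 2) ≤ inner ℝ (X ω) (b - θ₀) * powLink Q (inner ℝ (X ω) b)
      - inner ℝ (X ω) (b - θ₀) * powLink Q (inner ℝ (X ω) θ₀) := by
    intro ω
    have := half_mul_sq_le_powLink_sub_mul hQ (inner ℝ (X ω) θ₀) (inner ℝ (X ω) b)
    rw [inner_sub_right, sq_abs]
    nlinarith
  -- Both weights are needed, as either may vanish; two distinct inner products cannot both be zero.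
  have hlow' : ∀ ω, (1 / 2) * |inner ℝ (X ω) b - inner ℝ (X ω) θ₀| ^ 2 *
      |inner ℝ (X ω) b| ^ (Q - 2) ≤ inner ℝ (X ω) (b - θ₀) * powLink Q (inner ℝ (X ω) b)
      - inner ℝ (X ω) (b - θ₀) * powLink Q (inner ℝ (X ω) θ₀) := by
    intro ω
    have := half_mul_sq_le_powLink_sub_mul hQ (inner ℝ (X ω) b) (inner ℝ (X ω) θ₀)
    rw [inner_sub_right, sq_abs]
    nlinarith
  have hnn : ∀ ω, 0 ≤ inner ℝ (X ω) (b - θ₀) * powLink Q (inner ℝ (X ω) b)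
      - inner ℝ (X ω) (b - θ₀) * powLink Q (inner ℝ (X ω) θ₀) := fun ω =>
    le_trans (by positivity) (hlow ω)
  have hae := (integral_eq_zero_iff_of_nonneg hnn (hi2.sub hi1)).mp hz
  have hae0 : ∀ᵐ ω ∂μ, inner ℝ (X ω) (b - θ₀) = (0 : ℝ) := by
    filter_upwards [hae] with ω hω
    have hω : inner ℝ (X ω) (b - θ₀) * powLink Q (inner ℝ (X ω) b)
      - inner ℝ (X ω) (b - θ₀) * powLink Q (inner ℝ (X ω) θ₀) = 0 := hω
    by_contra hne
    have hd : inner ℝ (X ω) b - inner ℝ (X ω) θ₀ ≠ (0 : ℝ) := by rwa [← inner_sub_right]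
    have hd2 : 0 < |inner ℝ (X ω) b - inner ℝ (X ω) θ₀| ^ 2 := by positivity
    have l1 := hlow ω
    have l2 := hlow' ω
    rw [hω] at l1 l2
    rcases eq_or_ne (inner ℝ (X ω) θ₀ : ℝ) 0 with h0 | h0
    · have hbne : (inner ℝ (X ω) b : ℝ) ≠ 0 := by intro h; apply hd; rw [h, h0, sub_zero]
      have : 0 < |(inner ℝ (X ω) b : ℝ)| ^ (Q - 2) := Real.rpow_pos_of_pos (abs_pos.mpr hbne) _
      nlinarith [mul_pos hd2 this]
    · have : 0 < |(inner ℝ (X ω) θ₀ : ℝ)| ^ (Q - 2) := Real.rpow_pos_of_pos (abs_pos.mpr h0) _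
      nlinarith [mul_pos hd2 this]
  have hz2 : ∫ ω, |inner ℝ (X ω) (b - θ₀)| ^ Q ∂μ = 0 := by
    rw [integral_eq_zero_of_ae]
    filter_upwards [hae0] with ω hω
    simp [hω, Real.zero_rpow (by linarith : Q ≠ 0)]
  have h5 := hcoer (b - θ₀)
  rw [hz2] at h5
  have h6 : 0 < ‖b - θ₀‖ := norm_pos_iff.mpr (sub_ne_zero.mpr hb)
  have := Real.rpow_pos_of_pos h6 Q
  nlinarith

end RandomFeatures

end

noncomputable section

namespace RandomFeatures

open ProbabilityTheory

/-! ### Moments of sub-Gaussian variables -/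

/-- All moments of order `r ≥ 1` exist and `E|X|^r ≤ (B √r)^r`. -/
def SqrtMoments {Ω : Type*} [MeasurableSpace Ω] (B : ℝ) (X : Ω → ℝ) (P : Measure Ω) : Prop :=
  ∀ r : ℝ, 1 ≤ r → Integrable (fun ω => |X ω| ^ r) P ∧ ∫ ω, |X ω| ^ r ∂P ≤ (B * √r) ^ r

/-- Bound `|X|^r` by `(r / t)^r * exp (t |X|)` and optimize: `t = √r / σ` makes the exponential
moment `exp (r / 2)`. -/
lemma sqrtMoments_of_exp_moments {Ω : Type*} [MeasurableSpace Ω] {P : Measure Ω} {X : Ω → ℝ}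
    (hX : Measurable X) {σ : ℝ} (hσ : 0 < σ)
    (h : ∀ t : ℝ, Integrable (fun ω => Real.exp (t * X ω)) P ∧
      ∫ ω, Real.exp (t * X ω) ∂P ≤ Real.exp (σ ^ 2 * t ^ 2 / 2)) :
    SqrtMoments (2 * Real.exp 1 * σ) X P := by
  intro r hr
  have hr0 : 0 < r := by linarith
  have hsr : 0 < √r := Real.sqrt_pos.mpr hr0
  have hss : √r * √r = r := Real.mul_self_sqrt hr0.le
  set t := √r / σ with ht
  have htpos : 0 < t := by positivity
  have hdom : ∀ ω, |X ω| ^ r ≤ (σ * √r) ^ r * (Real.exp (t * X ω) + Real.exp (-t * X ω)) := by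
    intro ω
    set z := |X ω| with hz
    have h1 : z = (σ * √r) * (t * z / r) := by
      rw [ht]; field_simp; rw [Real.sq_sqrt hr0.le]
    have h2 : (t * z / r) ^ r ≤ Real.exp (t * z) := by
      have h3 : t * z / r ≤ Real.exp (t * z / r) := by
        linarith [Real.add_one_le_exp (t * z / r)]
      calc (t * z / r) ^ r ≤ Real.exp (t * z / r) ^ r :=
            Real.rpow_le_rpow (by positivity) h3 hr0.le
        _ = Real.exp (t * z) := by
            rw [← Real.exp_mul]; congr 1; field_simp
    have h4 : Real.exp (t * z) ≤ Real.exp (t * X ω) + Real.exp (-t * X ω) := by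
      rcases abs_cases (X ω) with ⟨h5, -⟩ | ⟨h5, -⟩
      · rw [hz, h5]; linarith [Real.exp_pos (-t * X ω)]
      · rw [hz, h5, mul_neg, ← neg_mul]; linarith [Real.exp_pos (t * X ω)]
    calc z ^ r = (σ * √r) ^ r * (t * z / r) ^ r := by
          rw [← Real.mul_rpow (by positivity) (by positivity), ← h1]
      _ ≤ _ := by gcongr; exact h2.trans h4
  have hint : Integrable (fun ω => (σ * √r) ^ r * (Real.exp (t * X ω) + Real.exp (-t * X ω))) P :=
    ((h t).1.add (h (-t)).1).const_mul _
  have hXint : Integrable (fun ω => |X ω| ^ r) P := by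
    refine hint.mono' (Measurable.aestronglyMeasurable (by fun_prop))
      (Filter.Eventually.of_forall fun ω => ?_)
    rw [Real.norm_of_nonneg (by positivity)]
    exact hdom ω
  refine ⟨hXint, ?_⟩
  have hexp : σ ^ 2 * t ^ 2 / 2 = r / 2 := by
    rw [ht]; field_simp; rw [Real.sq_sqrt hr0.le]
  calc ∫ ω, |X ω| ^ r ∂P
      ≤ ∫ ω, (σ * √r) ^ r * (Real.exp (t * X ω) + Real.exp (-t * X ω)) ∂P :=
        integral_mono hXint hint hdom
    _ = (σ * √r) ^ r * (∫ ω, Real.exp (t * X ω) ∂P + ∫ ω, Real.exp (-t * X ω) ∂P) := by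
        rw [integral_const_mul, integral_add (h t).1 (h (-t)).1]
    _ ≤ (σ * √r) ^ r * (Real.exp (r / 2) + Real.exp (r / 2)) := by
        have h1 := (h t).2
        have h2 := (h (-t)).2
        rw [neg_sq] at h2
        rw [hexp] at h1 h2
        gcongr
    _ ≤ (σ * √r) ^ r * (2 ^ r * Real.exp 1 ^ r) := by
        have h2 : (2 : ℝ) ≤ 2 ^ r := by
          simpa using Real.rpow_le_rpow_of_exponent_le (by norm_num : (1 : ℝ) ≤ 2) hr
        have h3 : Real.exp (r / 2) ≤ Real.exp 1 ^ r := by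
          rw [← Real.exp_mul]; apply Real.exp_le_exp.mpr; linarith
        gcongr
        nlinarith [Real.exp_pos (r / 2)]
    _ = (2 * Real.exp 1 * σ * √r) ^ r := by
        rw [← Real.mul_rpow (by norm_num) (by positivity),
          ← Real.mul_rpow (by positivity) (by positivity)]
        congr 1; ring

lemma mul_rpow_le_rpow_add_rpow {Q a b : ℝ} (hQ : 1 ≤ Q) (ha : 0 ≤ a) (hb : 0 ≤ b) :
    a * b ^ (Q - 1) ≤ max a b ^ Q := by
  have hm : 0 ≤ max a b := le_max_of_le_left ha
  calc a * b ^ (Q - 1) ≤ max a b * max a b ^ (Q - 1) := by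
        refine mul_le_mul (le_max_left _ _)
          (Real.rpow_le_rpow hb (le_max_right _ _) (by linarith)) (by positivity) hm
    _ ≤ max a b ^ Q := by
        rcases hm.eq_or_lt with h | h
        · rw [← h]; simp; positivity
        · rw [mul_comm, ← Real.rpow_add_one h.ne']; simp

/-- The constant in the moment growth of products of `Q` sub-Gaussian factors. -/
def prodConst (Q : ℝ) : ℝ := 2 * (2 * Real.exp 1 * √Q) ^ Q

lemma prodConst_pos {Q : ℝ} (hQ : 0 < Q) : 0 < prodConst Q := by
  unfold prodConst
  have := Real.sqrt_pos.mpr hQ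
  positivity

/-- The `k`-th moment of `Y` costs moments of order `Q * k` of the factors, and `√(Q k)^(Q k)` is
the `k`-th power of `√Q^Q * k^(Q/2)`; hence the growth exponent `Q / 2`. Except for the bounded
small-ball indicators, all averaged variables (moments, gradient, predictor) have this product form.
-/
lemma momentGrowth_of_abs_le_mul_rpow {Ω : Type*} [MeasurableSpace Ω] {P : Measure Ω}
    [IsProbabilityMeasure P] {X₁ X₂ Y : Ω → ℝ} (hY : Measurable Y) {Q τ : ℝ} (hQ : 1 ≤ Q)
    (hτ : 0 < τ) (h₁ : SqrtMoments (2 * Real.exp 1 * τ) X₁ P)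
    (h₂ : SqrtMoments (2 * Real.exp 1 * τ) X₂ P) (h : ∀ ω, |Y ω| ≤ |X₁ ω| * |X₂ ω| ^ (Q - 1)) :
    MomentGrowth (prodConst Q * τ ^ Q) (Q / 2) Y P := by
  intro k
  rcases Nat.eq_zero_or_pos k with rfl | hk
  · simp
  have hk1 : (1 : ℝ) ≤ k := by exact_mod_cast hk
  have hr : 1 ≤ Q * k := by nlinarith
  obtain ⟨i1, b1⟩ := h₁ _ hr
  obtain ⟨i2, b2⟩ := h₂ _ hr
  have hdom : ∀ ω, |Y ω| ^ k ≤ |X₁ ω| ^ (Q * k) + |X₂ ω| ^ (Q * k) := by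
    intro ω
    calc |Y ω| ^ k ≤ (max |X₁ ω| |X₂ ω| ^ Q) ^ k :=
          pow_le_pow_left₀ (abs_nonneg _) ((h ω).trans
            (mul_rpow_le_rpow_add_rpow hQ (abs_nonneg _) (abs_nonneg _))) k
      _ = max |X₁ ω| |X₂ ω| ^ (Q * k) := by
          rw [Real.rpow_mul (le_max_of_le_left (abs_nonneg _)), Real.rpow_natCast]
      _ ≤ _ := by
          rcases max_choice |X₁ ω| |X₂ ω| with h | h <;> rw [h]
          · linarith [Real.rpow_nonneg (abs_nonneg (X₂ ω)) (Q * k)]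
          · linarith [Real.rpow_nonneg (abs_nonneg (X₁ ω)) (Q * k)]
  have hint : Integrable (fun ω => |Y ω| ^ k) P := by
    refine (i1.add i2).mono' (by fun_prop) (Filter.Eventually.of_forall fun ω => ?_)
    rw [Real.norm_of_nonneg (by positivity)]
    exact hdom ω
  refine ⟨hint, ?_⟩
  have e : (2 * Real.exp 1 * τ * √(Q * k)) ^ (Q * k)
      = ((2 * Real.exp 1 * √Q) ^ Q * τ ^ Q * (k : ℝ) ^ (Q / 2)) ^ k := by
    rw [Real.sqrt_mul (by linarith), Real.rpow_mul (by positivity), Real.rpow_natCast]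
    congr 1
    rw [← Real.mul_rpow (by positivity) (by positivity), Real.rpow_div_two_eq_sqrt _ (by positivity),
      ← Real.mul_rpow (by positivity) (by positivity)]
    congr 1; ring
  calc ∫ ω, |Y ω| ^ k ∂P ≤ ∫ ω, (|X₁ ω| ^ (Q * k) + |X₂ ω| ^ (Q * k)) ∂P :=
        integral_mono hint (i1.add i2) hdom
    _ = ∫ ω, |X₁ ω| ^ (Q * k) ∂P + ∫ ω, |X₂ ω| ^ (Q * k) ∂P := integral_add i1 i2
    _ ≤ 2 * ((2 * Real.exp 1 * √Q) ^ Q * τ ^ Q * (k : ℝ) ^ (Q / 2)) ^ k := by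
        rw [← e]; linarith
    _ ≤ 2 ^ k * ((2 * Real.exp 1 * √Q) ^ Q * τ ^ Q * (k : ℝ) ^ (Q / 2)) ^ k := by
        gcongr
        simpa using pow_le_pow_right₀ (by norm_num : (1 : ℝ) ≤ 2) hk
    _ = _ := by rw [← mul_pow]; congr 1; unfold prodConst; ring

lemma momentGrowth_of_bounded {Ω : Type*} [MeasurableSpace Ω] {P : Measure Ω}
    [IsProbabilityMeasure P] {Y : Ω → ℝ} (hY : Measurable Y) (h : ∀ ω, |Y ω| ≤ 1) {q : ℝ}
    (hq : 0 ≤ q) : MomentGrowth 1 q Y P := by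
  intro k
  have hb : ∀ ω, |Y ω| ^ k ≤ 1 := fun ω => pow_le_one₀ (abs_nonneg _) (h ω)
  have hint : Integrable (fun ω => |Y ω| ^ k) P := by
    refine (integrable_const (1 : ℝ)).mono' (by fun_prop) (Filter.Eventually.of_forall fun ω => ?_)
    rw [Real.norm_of_nonneg (by positivity)]
    exact hb ω
  refine ⟨hint, ?_⟩
  calc ∫ ω, |Y ω| ^ k ∂P ≤ ∫ _ω, (1 : ℝ) ∂P := integral_mono hint (integrable_const _) hb
    _ = 1 := by simp
    _ ≤ (1 * (k : ℝ) ^ q) ^ k := by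
        rcases Nat.eq_zero_or_pos k with rfl | hk
        · simp
        · rw [one_mul]
          exact one_le_pow₀ (Real.one_le_rpow (by exact_mod_cast hk) hq)

/-! ### The rate under the sample size condition -/

/-- The sample size condition contains `log n` and the rate `log N`. If `log N ≤ κ' log n` they are
interchangeable up to constants. Otherwise `N > n^κ'`, and one factor `√N` absorbs the powers of `A`
and `n` while the other absorbs the logarithm. -/
lemma exists_devRate_bound {q κ ε : ℝ} (hq : 1 ≤ q) (hκ : 0 ≤ κ) (hε : 0 < ε) :
    ∃ (C₀ : ℝ) (N₁ : ℕ), 0 < C₀ ∧ ∀ (n N : ℕ) (A : ℝ), 1 ≤ n → N₁ ≤ N → 1 ≤ N → 1 ≤ A →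
      A ≤ (n : ℝ) ^ κ →
      C₀ * max (A ^ 2 * (n * Real.log n)) (A * (n * Real.log n) ^ q) ≤ N →
      A * devRate q n N ≤ ε := by
  -- Large enough that the exponents `2κ + 1` of `A² n` and `κ + q` of `A n^q` are both at most `κ'
  -- / 2`.
  set κ' : ℝ := 2 * (2 * κ + 1) + 2 * (κ + q) with hκ'
  have hκ'pos : 0 < κ' := by positivity
  have ev1 : ∀ᶠ N : ℕ in Filter.atTop, Real.log N ≤ ε ^ 2 * (N : ℝ) ^ (1 / 2 : ℝ) := by
    have h := (isLittleO_log_rpow_atTop (r := 1 / 2) (by norm_num)).bound (sq_pos_of_pos hε)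
    have h2 := tendsto_natCast_atTop_atTop (R := ℝ) |>.eventually h
    filter_upwards [h2] with N hN
    rw [Real.norm_of_nonneg (Real.rpow_nonneg (Nat.cast_nonneg N) _)] at hN
    exact (le_abs_self _).trans hN
  have ev2 : ∀ᶠ N : ℕ in Filter.atTop, Real.log N ^ q ≤ ε * (N : ℝ) ^ (1 / 2 : ℝ) := by
    have h := (isLittleO_log_rpow_rpow_atTop (s := 1 / 2) q (by norm_num)).bound hε
    have h2 := tendsto_natCast_atTop_atTop (R := ℝ) |>.eventually h
    filter_upwards [h2] with N hN
    rw [Real.norm_of_nonneg (Real.rpow_nonneg (Nat.cast_nonneg N) _)] at hN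
    exact (le_abs_self _).trans hN
  obtain ⟨N₁, hN₁⟩ := Filter.eventually_atTop.mp (ev1.and ev2)
  refine ⟨κ' / ε ^ 2 + κ' ^ q / ε, N₁, by positivity, ?_⟩
  intro n N A hn hN hN1 hA1 hA hmax
  obtain ⟨hl1, hl2⟩ := hN₁ N hN
  have hNr : (0 : ℝ) < N := by exact_mod_cast hN1
  have hnr : (1 : ℝ) ≤ n := by exact_mod_cast hn
  have hlogN : 0 ≤ Real.log N := Real.log_natCast_nonneg N
  have hlogn : 0 ≤ Real.log n := Real.log_natCast_nonneg n
  have hroot : (N : ℝ) ^ (1 / 2 : ℝ) * (N : ℝ) ^ (1 / 2 : ℝ) = N := by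
    rw [← Real.rpow_add hNr]; norm_num
  have key : A ^ 2 * (n * Real.log N) ≤ ε ^ 2 * N ∧ A * (n * Real.log N) ^ q ≤ ε * N := by
    have m1 : (κ' / ε ^ 2) * (A ^ 2 * (n * Real.log n)) ≤ N := by
      refine le_trans ?_ hmax
      exact mul_le_mul (by have : 0 ≤ κ' ^ q / ε := by positivity
                           linarith) (le_max_left _ _) (by positivity) (by positivity)
    have m2 : (κ' ^ q / ε) * (A * (n * Real.log n) ^ q) ≤ N := by
      refine le_trans ?_ hmax
      exact mul_le_mul (by have : 0 ≤ κ' / ε ^ 2 := by positivity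
                           linarith) (le_max_right _ _) (by positivity) (by positivity)
    rcases le_or_gt (Real.log N) (κ' * Real.log n) with hc | hc
    · constructor
      · calc A ^ 2 * (n * Real.log N) ≤ A ^ 2 * (n * (κ' * Real.log n)) := by gcongr
          _ = ε ^ 2 * ((κ' / ε ^ 2) * (A ^ 2 * (n * Real.log n))) := by field_simp
          _ ≤ ε ^ 2 * N := by gcongr
      · calc A * (n * Real.log N) ^ q ≤ A * (n * (κ' * Real.log n)) ^ q := by gcongr
          _ = A * (κ' * (n * Real.log n)) ^ q := by congr 2; ring
          _ = ε * ((κ' ^ q / ε) * (A * (n * Real.log n) ^ q)) := by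
              rw [Real.mul_rpow hκ'pos.le (by positivity)]; field_simp
          _ ≤ ε * N := by gcongr
    · have hnN : (n : ℝ) ^ κ' ≤ N := by
        rw [Real.rpow_def_of_pos (by linarith), ← Real.le_log_iff_exp_le hNr]
        linarith
      have hpow : ∀ e : ℝ, 2 * e ≤ κ' → (n : ℝ) ^ e ≤ (N : ℝ) ^ (1 / 2 : ℝ) := by
        intro e he
        calc (n : ℝ) ^ e ≤ (n : ℝ) ^ (κ' * (1 / 2)) :=
              Real.rpow_le_rpow_of_exponent_le hnr (by linarith)
          _ = ((n : ℝ) ^ κ') ^ (1 / 2 : ℝ) := Real.rpow_mul (by linarith) _ _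
          _ ≤ _ := Real.rpow_le_rpow (by positivity) hnN (by norm_num)
      constructor
      · have h1 : A ^ 2 * n ≤ (N : ℝ) ^ (1 / 2 : ℝ) := by
          refine le_trans ?_ (hpow (2 * κ + 1) (by rw [hκ']; linarith))
          calc A ^ 2 * n ≤ ((n : ℝ) ^ κ) ^ 2 * n := by gcongr
            _ = (n : ℝ) ^ (2 * κ + 1) := by
                rw [Real.rpow_add (by linarith), Real.rpow_one, mul_comm 2 κ,
                  Real.rpow_mul (by linarith), Real.rpow_two]
        calc A ^ 2 * (n * Real.log N) = (A ^ 2 * n) * Real.log N := by ring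
          _ ≤ (N : ℝ) ^ (1 / 2 : ℝ) * (ε ^ 2 * (N : ℝ) ^ (1 / 2 : ℝ)) := by gcongr
          _ = ε ^ 2 * ((N : ℝ) ^ (1 / 2 : ℝ) * (N : ℝ) ^ (1 / 2 : ℝ)) := by ring
          _ = _ := by rw [hroot]
      · have h1 : A * (n : ℝ) ^ q ≤ (N : ℝ) ^ (1 / 2 : ℝ) := by
          refine le_trans ?_ (hpow (κ + q) (by rw [hκ']; linarith))
          rw [Real.rpow_add (by linarith)]
          gcongr
        calc A * (n * Real.log N) ^ q = (A * (n : ℝ) ^ q) * Real.log N ^ q := by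
              rw [Real.mul_rpow (by linarith) hlogN]; ring
          _ ≤ (N : ℝ) ^ (1 / 2 : ℝ) * (ε * (N : ℝ) ^ (1 / 2 : ℝ)) := by gcongr
          _ = ε * ((N : ℝ) ^ (1 / 2 : ℝ) * (N : ℝ) ^ (1 / 2 : ℝ)) := by ring
          _ = _ := by rw [hroot]
  unfold devRate
  rw [mul_max_of_nonneg _ _ (by linarith)]
  apply max_le
  · have : A * √(n * Real.log N / N) = √(A ^ 2 * (n * Real.log N / N)) := by
      rw [Real.sqrt_mul (by positivity), Real.sqrt_sq (by linarith)]
    rw [this, Real.sqrt_le_left hε.le, ← mul_div_assoc, div_le_iff₀ hNr]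
    exact key.1
  · rw [← mul_div_assoc, div_le_iff₀ hNr]
    exact key.2

end RandomFeatures

end

noncomputable section

namespace RandomFeatures

open ProbabilityTheory

/-! ### Uniform control from a net -/

variable {n N : ℕ}

lemma abs_add_rpow_le {Q : ℝ} (hQ : 1 ≤ Q) (a b : ℝ) :
    |a + b| ^ Q ≤ 2 ^ (Q - 1) * (|a| ^ Q + |b| ^ Q) := by
  have h1 : |a + b| ^ Q ≤ (|a| + |b|) ^ Q :=
    Real.rpow_le_rpow (abs_nonneg _) (abs_add_le _ _) (by linarith)
  refine h1.trans ?_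
  have := NNReal.rpow_add_le_mul_rpow_add_rpow ⟨|a|, abs_nonneg a⟩ ⟨|b|, abs_nonneg b⟩ hQ
  exact_mod_cast this

lemma norm_inv_norm_smul {v : EuclideanSpace ℝ (Fin n)} (hv : v ≠ 0) : ‖‖v‖⁻¹ • v‖ = 1 := by
  rw [norm_smul, norm_inv, norm_norm, inv_mul_cancel₀ (norm_ne_zero_iff.mpr hv)]

lemma norm_smul_inv_norm_smul {v : EuclideanSpace ℝ (Fin n)} (hv : v ≠ 0) :
    v = ‖v‖ • (‖v‖⁻¹ • v) := by
  rw [smul_smul, mul_inv_cancel₀ (norm_ne_zero_iff.mpr hv), one_smul]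

/-- The empirical `Q`-th moment of a projection. -/
def empMoment (Q : ℝ) (ψ : Fin N → EuclideanSpace ℝ (Fin n)) (v : EuclideanSpace ℝ (Fin n)) : ℝ :=
  1 / (N : ℝ) * ∑ j, |inner ℝ (ψ j) v| ^ Q

lemma empMoment_nonneg (Q : ℝ) (ψ : Fin N → EuclideanSpace ℝ (Fin n))
    (v : EuclideanSpace ℝ (Fin n)) : 0 ≤ empMoment Q ψ v :=
  mul_nonneg (by positivity) (Finset.sum_nonneg fun _ _ => by positivity)

lemma empMoment_smul {Q : ℝ} (ψ : Fin N → EuclideanSpace ℝ (Fin n))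
    (v : EuclideanSpace ℝ (Fin n)) {a : ℝ} (ha : 0 ≤ a) :
    empMoment Q ψ (a • v) = a ^ Q * empMoment Q ψ v := by
  unfold empMoment
  simp only [real_inner_smul_right, abs_mul, abs_of_nonneg ha, Real.mul_rpow ha (abs_nonneg _),
    ← Finset.mul_sum]
  ring

lemma empMoment_le_of_sphere {Q M : ℝ} (hQ : 0 < Q) (ψ : Fin N → EuclideanSpace ℝ (Fin n))
    (h : ∀ v, ‖v‖ = 1 → empMoment Q ψ v ≤ M) (v : EuclideanSpace ℝ (Fin n)) :
    empMoment Q ψ v ≤ M * ‖v‖ ^ Q := by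
  rcases eq_or_ne v 0 with rfl | hv
  · simp [empMoment, Real.zero_rpow hQ.ne']
  · conv_lhs => rw [norm_smul_inv_norm_smul hv]
    rw [empMoment_smul _ _ (norm_nonneg v), mul_comm]
    exact mul_le_mul_of_nonneg_right (h _ (norm_inv_norm_smul hv)) (by positivity)

/-- Self-bounding at a maximizer `v₀` on the sphere: replacing `v₀` by a net point leaves a
remainder `2^(Q-1) * (1/2)^Q = 1/2` times the maximum itself, which is moved to the left side. -/
lemma empMoment_le_of_net {Q M δ : ℝ} (hQ : 1 ≤ Q) (hδ : δ ≤ 1 / 2)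
    (ψ : Fin N → EuclideanSpace ℝ (Fin n)) {S : Finset (EuclideanSpace ℝ (Fin n))}
    (hS : ∀ v : EuclideanSpace ℝ (Fin n), ‖v‖ = 1 → ∃ w ∈ S, ‖v - w‖ ≤ δ)
    (hM : ∀ w ∈ S, empMoment Q ψ w ≤ M) (v : EuclideanSpace ℝ (Fin n)) :
    empMoment Q ψ v ≤ 2 ^ Q * M * ‖v‖ ^ Q := by
  refine empMoment_le_of_sphere (by linarith) ψ (fun v hv => ?_) v
  have hcont : Continuous (empMoment Q ψ) := by
    unfold empMoment
    refine continuous_const.mul (continuous_finsetSum _ fun j _ => ?_)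
    have : Continuous fun θ : EuclideanSpace ℝ (Fin n) => |inner ℝ (ψ j) θ| ^ Q :=
      Continuous.rpow_const (by fun_prop) fun _ => Or.inr (by linarith)
    exact this
  obtain ⟨v₀, hv₀, hmax⟩ := (isCompact_sphere (0 : EuclideanSpace ℝ (Fin n)) 1).exists_isMaxOn
    ⟨v, by simpa using hv⟩ hcont.continuousOn
  have hv₀ : ‖v₀‖ = 1 := by simpa using hv₀
  have hle : ∀ v', ‖v'‖ = 1 → empMoment Q ψ v' ≤ empMoment Q ψ v₀ := fun v' hv' =>
    hmax (by simpa using hv')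
  obtain ⟨w, hwS, hw⟩ := hS v₀ hv₀
  have h1 : empMoment Q ψ v₀ ≤ 2 ^ (Q - 1) * (empMoment Q ψ w + empMoment Q ψ (v₀ - w)) := by
    unfold empMoment
    rw [← mul_add, ← Finset.sum_add_distrib, mul_left_comm,
      Finset.mul_sum (a := (2 : ℝ) ^ (Q - 1))]
    refine mul_le_mul_of_nonneg_left (Finset.sum_le_sum fun j _ => ?_) (by positivity)
    have := abs_add_rpow_le hQ (inner ℝ (ψ j) w) (inner ℝ (ψ j) (v₀ - w))
    rwa [← inner_add_right, add_sub_cancel] at this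
  have h2 : empMoment Q ψ (v₀ - w) ≤ empMoment Q ψ v₀ * (1 / 2) ^ Q :=
    (empMoment_le_of_sphere (by linarith) ψ hle _).trans
      (mul_le_mul_of_nonneg_left (Real.rpow_le_rpow (norm_nonneg _) (hw.trans hδ) (by linarith))
        (empMoment_nonneg _ _ _))
  have h3 : (2 : ℝ) ^ (Q - 1) * (1 / 2) ^ Q = 1 / 2 := by
    rw [Real.rpow_sub_one (by norm_num), Real.div_rpow (by norm_num) (by norm_num), Real.one_rpow]
    have : (0 : ℝ) < 2 ^ Q := by positivity
    field_simp
  have h4 : (2 : ℝ) ^ Q = 2 * 2 ^ (Q - 1) := by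
    rw [Real.rpow_sub_one (by norm_num)]; ring
  have h5 : (0 : ℝ) < 2 ^ (Q - 1) := by positivity
  have h6 := hM w hwS
  have h7 := hle v hv
  have h8 : (2 : ℝ) ^ (Q - 1) * empMoment Q ψ (v₀ - w) ≤ empMoment Q ψ v₀ * (1 / 2) := by
    rw [← h3]
    calc _ ≤ (2 : ℝ) ^ (Q - 1) * (empMoment Q ψ v₀ * (1 / 2) ^ Q) := by gcongr
      _ = _ := by ring
  have h9 := mul_le_mul_of_nonneg_left h6 h5.le
  rw [h4, mul_assoc]
  linarith

/-- Test `g` against a net point near its own direction; the error is at most `‖g‖ / 2`. -/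
lemma norm_le_of_net {δ M : ℝ} (hδ : δ ≤ 1 / 2) (hM0 : 0 ≤ M)
    {S : Finset (EuclideanSpace ℝ (Fin n))}
    (hS : ∀ v : EuclideanSpace ℝ (Fin n), ‖v‖ = 1 → ∃ w ∈ S, ‖v - w‖ ≤ δ)
    (g : EuclideanSpace ℝ (Fin n)) (hM : ∀ w ∈ S, |inner ℝ g w| ≤ M) : ‖g‖ ≤ 2 * M := by
  rcases eq_or_ne g 0 with rfl | hg
  · simpa using hM0
  obtain ⟨w, hwS, hw⟩ := hS _ (norm_inv_norm_smul hg)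
  have h1 : inner ℝ g (‖g‖⁻¹ • g) = ‖g‖ := by
    rw [real_inner_smul_right, real_inner_self_eq_norm_sq]
    have := norm_ne_zero_iff.mpr hg
    field_simp
  have h2 : inner ℝ g (‖g‖⁻¹ • g) = inner ℝ g w + inner ℝ g (‖g‖⁻¹ • g - w) := by
    rw [← inner_add_right, add_sub_cancel]
  have h3 := real_inner_le_norm g (‖g‖⁻¹ • g - w)
  have h4 := (le_abs_self _).trans (hM w hwS)
  nlinarith [norm_nonneg g, mul_le_mul_of_nonneg_left (hw.trans hδ) (norm_nonneg g)]

/-- The indicator of `|a| ≥ α` and `|b| ≥ β`. -/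
def bothLarge (α β a b : ℝ) : ℝ := {z : ℝ × ℝ | α ≤ |z.1| ∧ β ≤ |z.2|}.indicator 1 (a, b)

lemma bothLarge_of_le {α β a b : ℝ} (ha : α ≤ |a|) (hb : β ≤ |b|) : bothLarge α β a b = 1 :=
  Set.indicator_of_mem (s := {z : ℝ × ℝ | α ≤ |z.1| ∧ β ≤ |z.2|}) ⟨ha, hb⟩ _

lemma bothLarge_of_not {α β a b : ℝ} (h : ¬ (α ≤ |a| ∧ β ≤ |b|)) : bothLarge α β a b = 0 :=
  Set.indicator_of_notMem (s := {z : ℝ × ℝ | α ≤ |z.1| ∧ β ≤ |z.2|}) h _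

lemma bothLarge_nonneg (α β a b : ℝ) : 0 ≤ bothLarge α β a b :=
  Set.indicator_nonneg (fun _ _ => zero_le_one) _

lemma bothLarge_le_one (α β a b : ℝ) : bothLarge α β a b ≤ 1 :=
  Set.indicator_le_self' (fun _ _ => zero_le_one) _

lemma measurable_bothLarge (α β : ℝ) : Measurable fun z : ℝ × ℝ => bothLarge α β z.1 z.2 := by
  refine (measurable_one.indicator ?_)
  exact (measurableSet_le measurable_const measurable_fst.abs).inter
    (measurableSet_le measurable_const measurable_snd.abs)

/-- Moving from a net point `w` to `v` spoils only samples with `|⟨ψ, v - w⟩| ≥ η / 2`, and Markov's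
inequality for the empirical `Q`-th moment bounds their fraction by `c / 4`. The direction `u` stays
fixed, so it keeps the full threshold `η`. -/
lemma smallBall_of_net {Q M η δ c : ℝ} (hQ : 1 ≤ Q) (hη : 0 < η) (hM0 : 0 ≤ M)
    (ψ : Fin N → EuclideanSpace ℝ (Fin n)) {S : Finset (EuclideanSpace ℝ (Fin n))}
    (hS : ∀ v : EuclideanSpace ℝ (Fin n), ‖v‖ = 1 → ∃ w ∈ S, ‖v - w‖ ≤ δ)
    (hM : ∀ v, empMoment Q ψ v ≤ M * ‖v‖ ^ Q) (hδ : M * δ ^ Q ≤ c / 4 * (η / 2) ^ Q)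
    (u : EuclideanSpace ℝ (Fin n))
    (hu : ∀ w ∈ S, 3 * c / 4 ≤ 1 / (N : ℝ) * ∑ j, bothLarge η η (inner ℝ u (ψ j)) (inner ℝ w (ψ j)))
    (v : EuclideanSpace ℝ (Fin n)) (hv : ‖v‖ = 1) :
    c / 2 ≤ 1 / (N : ℝ) * ∑ j, bothLarge η (η / 2) (inner ℝ u (ψ j)) (inner ℝ v (ψ j)) := by
  obtain ⟨w, hwS, hw⟩ := hS v hv
  have hη2 : 0 < (η / 2) ^ Q := by positivity
  have hterm : ∀ j, bothLarge η η (inner ℝ u (ψ j)) (inner ℝ w (ψ j)) ≤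
      bothLarge η (η / 2) (inner ℝ u (ψ j)) (inner ℝ v (ψ j)) +
        |inner ℝ (ψ j) (v - w)| ^ Q / (η / 2) ^ Q := by
    intro j
    have h0 : 0 ≤ |inner ℝ (ψ j) (v - w)| ^ Q / (η / 2) ^ Q := by positivity
    by_cases h1 : η ≤ |inner ℝ u (ψ j)| ∧ η ≤ |inner ℝ w (ψ j)|
    · rw [bothLarge_of_le h1.1 h1.2]
      by_cases h2 : η / 2 ≤ |inner ℝ v (ψ j)|
      · rw [bothLarge_of_le h1.1 h2]; linarith
      · have h3 : η / 2 ≤ |inner ℝ (ψ j) (v - w)| := by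
          rw [inner_sub_right, real_inner_comm v, real_inner_comm w, abs_sub_comm]
          have := abs_sub_abs_le_abs_sub (inner ℝ w (ψ j)) (inner ℝ v (ψ j))
          push Not at h2
          linarith [h1.2]
        have h4 : 1 ≤ |inner ℝ (ψ j) (v - w)| ^ Q / (η / 2) ^ Q := by
          rw [one_le_div hη2]
          exact Real.rpow_le_rpow (by positivity) h3 (by linarith)
        linarith [bothLarge_nonneg η (η / 2) (inner ℝ u (ψ j)) (inner ℝ v (ψ j))]
    · rw [bothLarge_of_not h1]
      linarith [bothLarge_nonneg η (η / 2) (inner ℝ u (ψ j)) (inner ℝ v (ψ j))]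
  have h1 := hu w hwS
  have h2 : 1 / (N : ℝ) * ∑ j, bothLarge η η (inner ℝ u (ψ j)) (inner ℝ w (ψ j)) ≤
      1 / (N : ℝ) * ∑ j, bothLarge η (η / 2) (inner ℝ u (ψ j)) (inner ℝ v (ψ j))
        + empMoment Q ψ (v - w) / (η / 2) ^ Q := by
    unfold empMoment
    rw [mul_div_assoc, ← mul_add, Finset.sum_div, ← Finset.sum_add_distrib]
    exact mul_le_mul_of_nonneg_left (Finset.sum_le_sum fun j _ => hterm j) (by positivity)
  have h3 : empMoment Q ψ (v - w) / (η / 2) ^ Q ≤ c / 4 := by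
    rw [div_le_iff₀ hη2]
    refine (hM _).trans (le_trans ?_ hδ)
    gcongr
  linarith

/-! ### Stability of the maximizer and of the predictor -/

/-- Every term of the average in `hG` is nonnegative. On a fraction `c / 2` of the samples it is at
least `1/2 * (η T)^(Q-2) * (η ‖Δ‖ / 2)²`. A lower bound quadratic in `‖Δ‖` meets a linear upper
bound; `16` is `2 * 2 * 4`. -/
lemma norm_sub_le_of_smallBall {Q η c G T : ℝ} (hQ : 2 ≤ Q) (hη : 0 < η) (hc : 0 < c)
    (hG0 : 0 ≤ G) (hT : 0 ≤ T)
    (ψ : Fin N → EuclideanSpace ℝ (Fin n)) (u θ : EuclideanSpace ℝ (Fin n))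
    (hsb : ∀ v : EuclideanSpace ℝ (Fin n), ‖v‖ = 1 →
      c / 2 ≤ 1 / (N : ℝ) * ∑ j, bothLarge η (η / 2) (inner ℝ u (ψ j)) (inner ℝ v (ψ j)))
    (hG : 1 / (N : ℝ) * ∑ j, inner ℝ (ψ j) (θ - T • u) *
      (powLink Q (inner ℝ (ψ j) θ) - powLink Q (inner ℝ (ψ j) (T • u)))
        ≤ G * T ^ (Q - 1) * ‖θ - T • u‖) :
    ‖θ - T • u‖ ≤ 16 / c * (G / η ^ Q) * T := by
  set Δ := θ - T • u with hΔ
  rcases eq_or_ne Δ 0 with hΔ0 | hΔ0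
  · rw [hΔ0, norm_zero]; positivity
  have hd : 0 < ‖Δ‖ := norm_pos_iff.mpr hΔ0
  have hsbΔ := hsb _ (norm_inv_norm_smul hΔ0)
  set I : Fin N → ℝ := fun j => bothLarge η (η / 2) (inner ℝ u (ψ j)) (inner ℝ (‖Δ‖⁻¹ • Δ) (ψ j))
    with hI
  have hI1 : ∀ j, I j ≤ 1 := fun j => bothLarge_le_one _ _ _ _
  have hab : ∀ j, inner ℝ (ψ j) Δ = inner ℝ (ψ j) θ - inner ℝ (ψ j) (T • u) := fun j =>
    inner_sub_right _ _ _
  have hIimp : ∀ j, I j = 0 ∨ (η ≤ |inner ℝ (ψ j) u| ∧ η / 2 * ‖Δ‖ ≤ |inner ℝ (ψ j) Δ|) := by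
    intro j
    by_cases h : η ≤ |inner ℝ u (ψ j)| ∧ η / 2 ≤ |inner ℝ (‖Δ‖⁻¹ • Δ) (ψ j)|
    · right
      obtain ⟨h1, h2⟩ := h
      rw [real_inner_comm] at h1
      rw [real_inner_smul_left, real_inner_comm, abs_mul, abs_of_pos (inv_pos.mpr hd),
        le_inv_mul_iff₀ hd, mul_comm] at h2
      exact ⟨h1, h2⟩
    · exact Or.inl (bothLarge_of_not h)
  have hpos : ∀ j, 0 ≤ inner ℝ (ψ j) Δ *
      (powLink Q (inner ℝ (ψ j) θ) - powLink Q (inner ℝ (ψ j) (T • u))) := by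
    intro j
    rw [hab, mul_comm]
    exact le_trans (by positivity) (half_mul_sq_le_powLink_sub_mul hQ _ _)
  have havg : ∀ B : ℝ, 0 ≤ B → (∀ j, I j = 0 ∨ B ≤ inner ℝ (ψ j) Δ *
      (powLink Q (inner ℝ (ψ j) θ) - powLink Q (inner ℝ (ψ j) (T • u)))) →
      c / 2 * B ≤ G * T ^ (Q - 1) * ‖Δ‖ := by
    intro B hB h
    refine le_trans ?_ hG
    refine (mul_le_mul_of_nonneg_right hsbΔ hB).trans ?_
    rw [mul_assoc, Finset.sum_mul]
    refine mul_le_mul_of_nonneg_left (Finset.sum_le_sum fun j _ => ?_) (by positivity)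
    rcases h j with h0 | h0
    · change I j * B ≤ _
      rw [h0, zero_mul]; exact hpos j
    · exact (mul_le_of_le_one_left hB (hI1 j)).trans h0
  -- At `T = 0` the weight at `T • u` may vanish, so the terms are read as `|⟨ψ, Δ⟩|^Q` instead. The
  -- upper bound is then `0`, which contradicts `Δ ≠ 0`.
  rcases hT.eq_or_lt with h | hTpos
  · exfalso
    have h1 := havg ((η / 2 * ‖Δ‖) ^ Q) (by positivity) fun j => by
      rcases hIimp j with h0 | ⟨-, h2⟩
      · exact Or.inl h0
      · right
        have h3 : inner ℝ (ψ j) (T • u) = (0 : ℝ) := by rw [← h, zero_smul, inner_zero_right]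
        rw [hab, h3, sub_zero] at h2 ⊢
        have h4 : powLink Q 0 = 0 := by simp [powLink]
        rw [h4, sub_zero, mul_powLink (by linarith)]
        exact Real.rpow_le_rpow (by positivity) h2 (by linarith)
    rw [← h, Real.zero_rpow (by linarith), mul_zero, zero_mul] at h1
    have : 0 < c / 2 * (η / 2 * ‖Δ‖) ^ Q := by positivity
    linarith
  · have h1 := havg (1 / 2 * (η * T) ^ (Q - 2) * (η / 2 * ‖Δ‖) ^ 2) (by positivity) fun j => by
      rcases hIimp j with h0 | ⟨h2, h3⟩
      · exact Or.inl h0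
      · right
        have h4 : (η * T) ^ (Q - 2) ≤ |inner ℝ (ψ j) (T • u)| ^ (Q - 2) := by
          refine Real.rpow_le_rpow (by positivity) ?_ (by linarith)
          rw [real_inner_smul_right, abs_mul, abs_of_pos hTpos, mul_comm]
          gcongr
        have h5 : (η / 2 * ‖Δ‖) ^ 2 ≤ (inner ℝ (ψ j) Δ) ^ 2 := by
          rw [← sq_abs (inner ℝ (ψ j) Δ)]
          gcongr
        have h6 := half_mul_sq_le_powLink_sub_mul hQ (inner ℝ (ψ j) (T • u)) (inner ℝ (ψ j) θ)
        rw [← hab] at h6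
        rw [mul_comm (inner ℝ (ψ j) Δ)]
        refine le_trans ?_ h6
        gcongr
    have e1 : T ^ (Q - 1) = T ^ (Q - 2) * T := by
      rw [← Real.rpow_add_one hTpos.ne']; congr 1; ring
    have e2 : η ^ Q = η ^ (Q - 2) * η ^ 2 := by
      rw [← Real.rpow_natCast η 2, ← Real.rpow_add hη]; congr 1; push_cast; ring
    have hTQ : 0 < T ^ (Q - 2) := by positivity
    have hηQ : 0 < η ^ (Q - 2) := by positivity
    rw [e1, Real.mul_rpow hη.le hTpos.le] at h1
    have h2 : (T ^ (Q - 2) * ‖Δ‖) * (‖Δ‖ * (c * (η ^ (Q - 2) * η ^ 2)))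
        ≤ (T ^ (Q - 2) * ‖Δ‖) * (16 * G * T) := by nlinarith
    have h3 := le_of_mul_le_mul_left h2 (by positivity)
    rw [e2]
    have h4 : 16 / c * (G / (η ^ (Q - 2) * η ^ 2)) * T
        = 16 * G * T / (c * (η ^ (Q - 2) * η ^ 2)) := by field_simp
    rw [h4, le_div_iff₀ (by positivity)]
    exact h3

lemma mul_rpow_mul_le_add {Q x y z : ℝ} (hQ : 2 ≤ Q) (hx : 0 ≤ x) (hy : 0 ≤ y) (hz : 0 ≤ z) :
    x * y ^ (Q - 2) * z ≤ x ^ Q + y ^ Q + z ^ Q := by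
  set m := max x (max y z) with hm
  have h1 : x ≤ m := le_max_left _ _
  have h2 : y ≤ m := (le_max_left _ _).trans (le_max_right _ _)
  have h3 : z ≤ m := (le_max_right _ _).trans (le_max_right _ _)
  have hm0 : 0 ≤ m := hx.trans h1
  have hxQ := Real.rpow_nonneg hx Q
  have hyQ := Real.rpow_nonneg hy Q
  have hzQ := Real.rpow_nonneg hz Q
  have h4 : x * y ^ (Q - 2) * z ≤ m ^ Q := by
    rcases hm0.eq_or_lt with h | h
    · have : x = 0 := by linarith
      rw [this, zero_mul, zero_mul]; positivity
    · have e : m ^ Q = m * m ^ (Q - 2) * m := by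
        rw [mul_comm m, mul_assoc, ← sq, ← Real.rpow_natCast m 2, ← Real.rpow_add h]
        congr 1; push_cast; ring
      rw [e]
      have := Real.rpow_le_rpow hy h2 (by linarith : 0 ≤ Q - 2)
      gcongr
  refine h4.trans ?_
  rcases max_choice x (max y z) with h | h
  · rw [hm, h]; linarith
  · rw [hm, h]
    rcases max_choice y z with h | h <;> rw [h] <;> linarith

/-- The Lipschitz bound for the link produces products of degree `Q` in `f`, the base point and the
increment. Scaling `θ` by `2T` and the increment by `D T` puts the vectors in the unit ball, and
each product is at most a sum of `Q`-th powers, so empirical moments suffice and the factor `D` is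
kept. -/
lemma abs_mean_mul_powLink_sub_le {Q D T M : ℝ} (hQ : 2 ≤ Q) (hD : 0 < D) (hD1 : D ≤ 1)
    (hT : 0 ≤ T) (hM0 : 0 ≤ M) (ψ : Fin N → EuclideanSpace ℝ (Fin n))
    (u θ : EuclideanSpace ℝ (Fin n)) (hu : ‖u‖ = 1) (h : ‖θ - T • u‖ ≤ D * T)
    (hM : ∀ v, empMoment Q ψ v ≤ M * ‖v‖ ^ Q) (f : Fin N → ℝ) :
    |1 / (N : ℝ) * ∑ j, f j * powLink Q (inner ℝ (ψ j) θ)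
      - 1 / (N : ℝ) * ∑ j, f j * powLink Q (inner ℝ (ψ j) (T • u))|
      ≤ (Q - 1) * 2 ^ Q * D * T ^ (Q - 1) * (2 * (1 / (N : ℝ) * ∑ j, |f j| ^ Q) + 4 * M) := by
  have hf0 : 0 ≤ 1 / (N : ℝ) * ∑ j, |f j| ^ Q :=
    mul_nonneg (by positivity) (Finset.sum_nonneg fun _ _ => by positivity)
  rcases hT.eq_or_lt with h0 | hTpos
  · have hθ : θ = 0 := by
      rw [← h0, zero_smul, sub_zero, mul_zero] at h
      exact norm_le_zero_iff.mp h
    rw [hθ, ← h0, zero_smul, sub_self, abs_zero]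
    have : 0 ≤ Q - 1 := by linarith
    positivity
  set v := (D * T)⁻¹ • (θ - T • u) with hv
  set w := (2 * T)⁻¹ • θ with hw
  have hball : ∀ z : EuclideanSpace ℝ (Fin n), ‖z‖ ≤ 1 → empMoment Q ψ z ≤ M := fun z hz =>
    (hM z).trans (mul_le_of_le_one_right hM0
      (Real.rpow_le_one (norm_nonneg _) hz (by linarith)))
  have hvn : ‖v‖ ≤ 1 := by
    rw [hv, norm_smul, norm_inv, Real.norm_of_nonneg (by positivity), inv_mul_le_iff₀ (by positivity),
      mul_one]
    exact h
  have hθn : ‖θ‖ ≤ 2 * T := by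
    have h1 : ‖θ‖ ≤ ‖θ - T • u‖ + ‖T • u‖ := by
      simpa using norm_add_le (θ - T • u) (T • u)
    rw [norm_smul, hu, Real.norm_of_nonneg hT] at h1
    nlinarith
  have hwn : ‖w‖ ≤ 1 := by
    rw [hw, norm_smul, norm_inv, Real.norm_of_nonneg (by positivity), inv_mul_le_iff₀ (by positivity),
      mul_one]
    exact hθn
  have hterm : ∀ j, |f j * powLink Q (inner ℝ (ψ j) θ) - f j * powLink Q (inner ℝ (ψ j) (T • u))|
      ≤ (Q - 1) * 2 ^ Q * D * T ^ (Q - 1) * (2 * |f j| ^ Q + |inner ℝ (ψ j) u| ^ Q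
        + |inner ℝ (ψ j) w| ^ Q + 2 * |inner ℝ (ψ j) v| ^ Q) := by
    intro j
    set x := |f j|
    set a := |inner ℝ (ψ j) u|
    set b := |inner ℝ (ψ j) w|
    set d := |inner ℝ (ψ j) v|
    have ha : |inner ℝ (ψ j) (T • u)| = T * a := by
      rw [real_inner_smul_right, abs_mul, abs_of_pos hTpos]
    have hb : |inner ℝ (ψ j) θ| = 2 * T * b := by
      have : θ = (2 * T) • w := by rw [hw, smul_smul, mul_inv_cancel₀ (by positivity), one_smul]
      conv_lhs => rw [this]
      rw [real_inner_smul_right, abs_mul, abs_of_pos (by positivity)]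
    have hdd : |inner ℝ (ψ j) θ - inner ℝ (ψ j) (T • u)| = D * T * d := by
      have : θ - T • u = (D * T) • v := by
        rw [hv, smul_smul, mul_inv_cancel₀ (by positivity), one_smul]
      rw [← inner_sub_right, this, real_inner_smul_right, abs_mul, abs_of_pos (by positivity)]
    have h1 := abs_powLink_sub_le hQ (inner ℝ (ψ j) (T • u)) (inner ℝ (ψ j) θ)
    rw [ha, hb, hdd, Real.mul_rpow hT (abs_nonneg _), Real.mul_rpow (by positivity) (abs_nonneg _),
      Real.mul_rpow (by norm_num) hT] at h1
    have e1 : T ^ (Q - 1) = T ^ (Q - 2) * T := by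
      rw [← Real.rpow_add_one hTpos.ne']; congr 1; ring
    have h2 : (2 : ℝ) ^ (Q - 2) ≤ 2 ^ Q :=
      Real.rpow_le_rpow_of_exponent_le (by norm_num) (by linarith)
    have h3 : (1 : ℝ) ≤ 2 ^ Q := Real.one_le_rpow (by norm_num) (by linarith)
    have hQ1 : 0 ≤ Q - 1 := by linarith
    have p1 := mul_rpow_mul_le_add hQ (abs_nonneg (f j)) (abs_nonneg (inner ℝ (ψ j) u))
      (abs_nonneg (inner ℝ (ψ j) v))
    have p2 := mul_rpow_mul_le_add hQ (abs_nonneg (f j)) (abs_nonneg (inner ℝ (ψ j) w))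
      (abs_nonneg (inner ℝ (ψ j) v))
    rw [← mul_sub, abs_mul]
    calc x * |powLink Q (inner ℝ (ψ j) θ) - powLink Q (inner ℝ (ψ j) (T • u))|
        ≤ x * ((Q - 1) * (T ^ (Q - 2) * a ^ (Q - 2) + 2 ^ (Q - 2) * T ^ (Q - 2) * b ^ (Q - 2))
            * (D * T * d)) := by gcongr
      _ ≤ x * ((Q - 1) * (2 ^ Q * T ^ (Q - 2) * a ^ (Q - 2) + 2 ^ Q * T ^ (Q - 2) * b ^ (Q - 2))
            * (D * T * d)) := by
          gcongr
          exact le_mul_of_one_le_left (by positivity) h3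
      _ = (Q - 1) * 2 ^ Q * D * T ^ (Q - 1) *
            (x * a ^ (Q - 2) * d + x * b ^ (Q - 2) * d) := by rw [e1]; ring
      _ ≤ _ := mul_le_mul_of_nonneg_left (by linarith) (by positivity)
  rw [← mul_sub, ← Finset.sum_sub_distrib, abs_mul, abs_of_nonneg (by positivity : 0 ≤ 1 / (N : ℝ))]
  calc _ ≤ 1 / (N : ℝ) * ∑ j, (Q - 1) * 2 ^ Q * D * T ^ (Q - 1) * (2 * |f j| ^ Q +
        |inner ℝ (ψ j) u| ^ Q + |inner ℝ (ψ j) w| ^ Q + 2 * |inner ℝ (ψ j) v| ^ Q) := by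
        gcongr
        exact (Finset.abs_sum_le_sum_abs _ _).trans (Finset.sum_le_sum fun j _ => hterm j)
    _ = (Q - 1) * 2 ^ Q * D * T ^ (Q - 1) * (2 * (1 / (N : ℝ) * ∑ j, |f j| ^ Q) +
          (empMoment Q ψ u + empMoment Q ψ w + 2 * empMoment Q ψ v)) := by
        unfold empMoment
        simp only [← Finset.mul_sum, Finset.sum_add_distrib]
        ring
    _ ≤ _ := by
        have h1 := hball u hu.le
        have h2 := hball w hwn
        have h3 := hball v hvn
        have hQ1 : 0 ≤ Q - 1 := by linarith
        gcongr
        linarith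

end RandomFeatures

end

noncomputable section

namespace RandomFeatures

open ProbabilityTheory

/-! ### Good samples -/

variable {n N : ℕ}

/-- The deviations of all empirical means entering the analysis are at most `K A R` (or `K R`). -/
structure GoodSample {Ω 𝒳 : Type*} [MeasurableSpace Ω] [MeasurableSpace 𝒳] (Q η K A R : ℝ)
    (μ : Measure Ω) (P : Measure 𝒳) (ψ : Ω → EuclideanSpace ℝ (Fin n)) (f : 𝒳 → Ω → ℝ)
    (u : EuclideanSpace ℝ (Fin n)) (S : Finset (EuclideanSpace ℝ (Fin n))) (ω : Fin N → Ω) :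
    Prop where
  moment : ∀ w ∈ S, |1 / (N : ℝ) * ∑ j, |inner ℝ (ψ (ω j)) w| ^ Q
    - ∫ a, |inner ℝ (ψ a) w| ^ Q ∂μ| ≤ K * A * R
  small_ball : ∀ w ∈ S, |1 / (N : ℝ) * ∑ j, bothLarge η η (inner ℝ u (ψ (ω j))) (inner ℝ w (ψ (ω j)))
    - ∫ a, bothLarge η η (inner ℝ u (ψ a)) (inner ℝ w (ψ a)) ∂μ| ≤ K * 1 * R
  gradient : ∀ w ∈ S, |1 / (N : ℝ) * ∑ j, inner ℝ (ψ (ω j)) w * powLink Q (inner ℝ (ψ (ω j)) u)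
    - ∫ a, inner ℝ (ψ a) w * powLink Q (inner ℝ (ψ a) u) ∂μ| ≤ K * A * R
  predictor : eLpNorm (fun x => 1 / (N : ℝ) * ∑ j, f x (ω j) * powLink Q (inner ℝ (ψ (ω j)) u)
    - ∫ a, f x a * powLink Q (inner ℝ (ψ a) u) ∂μ) 2 P ≤ ENNReal.ofReal (K * A * R)
  feature : eLpNorm (fun x => 1 / (N : ℝ) * ∑ j, |f x (ω j)| ^ Q - ∫ a, |f x a| ^ Q ∂μ) 2 P
    ≤ ENNReal.ofReal (K * A * R)

lemma eLpNorm_le_of_abs_le {𝒳 : Type*} [MeasurableSpace 𝒳] {P : Measure 𝒳} [IsProbabilityMeasure P]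
    {h h₁ h₂ : 𝒳 → ℝ} (hm₁ : Measurable h₁) (hm₂ : Measurable h₂) {a b e B₁ B₂ : ℝ} (ha : 0 ≤ a)
    (hb : 0 ≤ b) (he : 0 ≤ e) (hB₁ : 0 ≤ B₁) (hB₂ : 0 ≤ B₂)
    (hle : ∀ᵐ x ∂P, |h x| ≤ a * |h₁ x| + b * |h₂ x| + e)
    (h₁B : eLpNorm h₁ 2 P ≤ ENNReal.ofReal B₁) (h₂B : eLpNorm h₂ 2 P ≤ ENNReal.ofReal B₂) :
    eLpNorm h 2 P ≤ ENNReal.ofReal (a * B₁ + b * B₂ + e) := by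
  have n₁ : eLpNorm (fun x => a * |h₁ x|) 2 P ≤ ENNReal.ofReal (a * B₁) := by
    rw [ENNReal.ofReal_mul ha]
    have : eLpNorm (fun x => a * |h₁ x|) 2 P = ‖a‖ₑ * eLpNorm (fun x => ‖h₁ x‖) 2 P :=
      eLpNorm_const_smul a (fun x => ‖h₁ x‖) 2 P
    rw [this, eLpNorm_norm, Real.enorm_eq_ofReal ha]
    gcongr
  have n₂ : eLpNorm (fun x => b * |h₂ x|) 2 P ≤ ENNReal.ofReal (b * B₂) := by
    rw [ENNReal.ofReal_mul hb]
    have : eLpNorm (fun x => b * |h₂ x|) 2 P = ‖b‖ₑ * eLpNorm (fun x => ‖h₂ x‖) 2 P :=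
      eLpNorm_const_smul b (fun x => ‖h₂ x‖) 2 P
    rw [this, eLpNorm_norm, Real.enorm_eq_ofReal hb]
    gcongr
  have n₃ : eLpNorm (fun _ : 𝒳 => e) 2 P = ENNReal.ofReal e := by
    rw [eLpNorm_const _ (by simp) (IsProbabilityMeasure.ne_zero P)]
    simp [Real.enorm_eq_ofReal he]
  calc eLpNorm h 2 P ≤ eLpNorm (fun x => a * |h₁ x| + b * |h₂ x| + e) 2 P :=
        eLpNorm_mono_ae_real hle
    _ ≤ eLpNorm (fun x => a * |h₁ x| + b * |h₂ x|) 2 P + eLpNorm (fun _ => e) 2 P :=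
        eLpNorm_add_le (by fun_prop) (by fun_prop) (by norm_num)
    _ ≤ (eLpNorm (fun x => a * |h₁ x|) 2 P + eLpNorm (fun x => b * |h₂ x|) 2 P) +
          eLpNorm (fun _ => e) 2 P := by
        gcongr
        exact eLpNorm_add_le (by fun_prop) (by fun_prop) (by norm_num)
    _ ≤ (ENNReal.ofReal (a * B₁) + ENNReal.ofReal (b * B₂)) + ENNReal.ofReal e := by
        rw [n₃]; gcongr
    _ = _ := by
        rw [← ENNReal.ofReal_add (by positivity) (by positivity),
          ← ENNReal.ofReal_add (by positivity) he]

/-- Maximizer of the empirical dual objective under the small-ball property. -/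
lemma exists_isArgmax_empirical {Q η c : ℝ} (hQ : 2 ≤ Q) (hη : 0 < η) (hc : 0 < c) (hN : 0 < N)
    (ψ : Fin N → EuclideanSpace ℝ (Fin n)) (u y : EuclideanSpace ℝ (Fin n))
    (hsb : ∀ v : EuclideanSpace ℝ (Fin n), ‖v‖ = 1 →
      c / 2 ≤ 1 / (N : ℝ) * ∑ j, bothLarge η (η / 2) (inner ℝ u (ψ j)) (inner ℝ v (ψ j))) :
    ∃ θ, IsArgmax (fun θ => inner ℝ θ y - 1 / (N : ℝ) * ∑ j, |inner ℝ (ψ j) θ| ^ Q / Q) θ ∧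
      ∀ v, 1 / (N : ℝ) * ∑ j, inner ℝ (ψ j) v * powLink Q (inner ℝ (ψ j) θ) = inner ℝ v y := by
  have hNr : (0 : ℝ) < N := by exact_mod_cast hN
  -- The empirical average is an integral against normalized counting measure, so the existence
  -- lemma for integrals applies; its coercivity comes from the small-ball fraction.
  set ν : Measure (Fin N) := ENNReal.ofReal (1 / (N : ℝ)) • Measure.count with hν
  have hint : ∀ g : Fin N → ℝ, ∫ j, g j ∂ν = 1 / (N : ℝ) * ∑ j, g j := by
    intro g
    rw [hν, integral_smul_measure, integral_count, ENNReal.toReal_ofReal (by positivity),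
      smul_eq_mul]
  have hfin : IsFiniteMeasure ν := by
    rw [hν]
    exact Measure.smul_finite _ (by simp)
  have hcoer : ∀ θ, c / 2 * (η / 2) ^ Q * ‖θ‖ ^ Q ≤ ∫ j, |inner ℝ (ψ j) θ| ^ Q ∂ν := by
    intro θ
    rw [hint]
    rcases eq_or_ne θ 0 with rfl | hθ
    · simp [Real.zero_rpow (by linarith : Q ≠ 0)]
    have h1 := hsb _ (norm_inv_norm_smul hθ)
    have hd : 0 < ‖θ‖ := norm_pos_iff.mpr hθ
    have h2 : ∀ j, bothLarge η (η / 2) (inner ℝ u (ψ j)) (inner ℝ (‖θ‖⁻¹ • θ) (ψ j)) *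
        (η / 2 * ‖θ‖) ^ Q ≤ |inner ℝ (ψ j) θ| ^ Q := by
      intro j
      by_cases h : η ≤ |inner ℝ u (ψ j)| ∧ η / 2 ≤ |inner ℝ (‖θ‖⁻¹ • θ) (ψ j)|
      · rw [bothLarge_of_le h.1 h.2, one_mul]
        have h3 := h.2
        rw [real_inner_smul_left, real_inner_comm, abs_mul, abs_of_pos (inv_pos.mpr hd),
          le_inv_mul_iff₀ hd, mul_comm] at h3
        exact Real.rpow_le_rpow (by positivity) h3 (by linarith)
      · rw [bothLarge_of_not h, zero_mul]; positivity
    rw [mul_assoc, ← Real.mul_rpow (by positivity) (norm_nonneg _)]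
    refine (mul_le_mul_of_nonneg_right h1 (by positivity)).trans ?_
    rw [mul_assoc, Finset.sum_mul]
    exact mul_le_mul_of_nonneg_left (Finset.sum_le_sum fun j _ => h2 j) (by positivity)
  obtain ⟨θ, h1, h2⟩ := exists_isArgmax_dual (μ := ν) (X := ψ) (measurable_of_finite _) hQ
    (Integrable.of_finite) (by positivity) hcoer y
  refine ⟨θ, ?_, fun v => ?_⟩
  · simpa only [hint] using h1
  · rw [← hint]; exact h2 v

lemma integrable_powLink_smul {Ω : Type*} [MeasurableSpace Ω] {μ : Measure Ω}
    {ψ : Ω → EuclideanSpace ℝ (Fin n)} (hψ : Measurable ψ) {Q : ℝ} (hQ : 2 ≤ Q)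
    (hint : Integrable (fun ω => ‖ψ ω‖ ^ Q) μ) (u : EuclideanSpace ℝ (Fin n)) :
    Integrable (fun ω => powLink Q (inner ℝ (ψ ω) u) • ψ ω) μ := by
  have := measurable_powLink Q
  refine (hint.const_mul (‖u‖ ^ (Q - 1))).mono' (by fun_prop)
    (Filter.Eventually.of_forall fun ω => ?_)
  rw [norm_smul, Real.norm_eq_abs, abs_powLink (by linarith)]
  have h2 : ‖ψ ω‖ ^ Q = ‖ψ ω‖ ^ (Q - 1) * ‖ψ ω‖ := by
    rcases (norm_nonneg (ψ ω)).eq_or_lt with h | h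
    · rw [← h, Real.zero_rpow (by linarith)]; simp
    · rw [← Real.rpow_add_one h.ne']; congr 1; ring
  rw [h2, ← mul_assoc, ← Real.mul_rpow (norm_nonneg _) (norm_nonneg _), mul_comm ‖u‖]
  have := Real.rpow_le_rpow (abs_nonneg _) (abs_real_inner_le_norm (ψ ω) u)
    (by linarith : 0 ≤ Q - 1)
  gcongr

/-- On a good sample the empirical maximizer exists and its predictor is close to the population
predictor. -/
lemma GoodSample.exists_isArgmax {Ω 𝒳 : Type*} [MeasurableSpace Ω] [MeasurableSpace 𝒳]
    {Q η K A R c δ T : ℝ} {μ : Measure Ω} [IsProbabilityMeasure μ] {P : Measure 𝒳}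
    [IsProbabilityMeasure P] {ψ : Ω → EuclideanSpace ℝ (Fin n)} {f : 𝒳 → Ω → ℝ}
    {u : EuclideanSpace ℝ (Fin n)} {S : Finset (EuclideanSpace ℝ (Fin n))} {ω : Fin N → Ω}
    (hgood : GoodSample Q η K A R μ P ψ f u S ω) (hQ : 2 ≤ Q) (hη : 0 < η) (hK : 0 < K)
    (hA : 0 < A) (hR : 0 < R) (hc : 0 < c) (hT : 0 ≤ T) (hN : 0 < N) (hu : ‖u‖ = 1)
    (hψ : Measurable ψ) (hf : Measurable (Function.uncurry f))
    (hint : Integrable (fun ω => ‖ψ ω‖ ^ Q) μ)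
    (hS1 : ∀ w ∈ S, ‖w‖ = 1) (hδ : δ ≤ 1 / 2)
    (hS : ∀ v : EuclideanSpace ℝ (Fin n), ‖v‖ = 1 → ∃ w ∈ S, ‖v - w‖ ≤ δ)
    (hδc : 2 ^ Q * (2 * A) * δ ^ Q ≤ c / 4 * (η / 2) ^ Q)
    (hKR1 : K * R ≤ 1) (hKRc : K * R ≤ c / 4)
    (hD1 : 16 / c * (2 * (K * A * R) / η ^ Q) ≤ 1)
    (hmom : ∀ w, ‖w‖ = 1 → ∫ a, |inner ℝ (ψ a) w| ^ Q ∂μ ≤ A)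
    (hsb : ∀ w, ‖w‖ = 1 → c ≤ ∫ a, bothLarge η η (inner ℝ u (ψ a)) (inner ℝ w (ψ a)) ∂μ)
    (hfeat : ∀ᵐ x ∂P, ∫ a, |f x a| ^ Q ∂μ ≤ A)
    {y : EuclideanSpace ℝ (Fin n)}
    (hfoc : ∀ v, ∫ a, inner ℝ (ψ a) v * powLink Q (inner ℝ (ψ a) (T • u)) ∂μ = inner ℝ v y) :
    ∃ θ, IsArgmax (fun θ => inner ℝ θ y - 1 / (N : ℝ) * ∑ j, |inner ℝ (ψ (ω j)) θ| ^ Q / Q) θ ∧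
      eLpNorm (fun x => 1 / (N : ℝ) * ∑ j, f x (ω j) * powLink Q (inner ℝ (ψ (ω j)) θ)
        - ∫ a, f x a * powLink Q (inner ℝ (ψ a) (T • u)) ∂μ) 2 P ≤
      ENNReal.ofReal (T ^ (Q - 1) * ((Q - 1) * 2 ^ Q * (16 / c * (2 * (K * A * R) / η ^ Q)) *
        (2 * (K * A * R) + 2 * A + 4 * (2 ^ Q * (2 * A))) + K * A * R)) := by
  have hKAR : K * A * R ≤ A := by nlinarith
  have hpl := measurable_powLink Q
  set Ψ : Fin N → EuclideanSpace ℝ (Fin n) := fun j => ψ (ω j) with hΨ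
  have hM : ∀ v, empMoment Q Ψ v ≤ 2 ^ Q * (2 * A) * ‖v‖ ^ Q := by
    refine empMoment_le_of_net (by linarith) hδ Ψ hS fun w hw => ?_
    have h1 := (abs_le.mp (hgood.moment w hw)).2
    have h2 := hmom w (hS1 w hw)
    unfold empMoment
    linarith
  have hsbN := smallBall_of_net (by linarith) hη (by positivity) Ψ hS hM hδc u (fun w hw => by
    have h1 := (abs_le.mp (hgood.small_ball w hw)).1
    have h2 := hsb w (hS1 w hw)
    simp only [hΨ]
    linarith)
  obtain ⟨θ, hθ, hθfoc⟩ := exists_isArgmax_empirical hQ hη hc hN Ψ u y hsbN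
  refine ⟨θ, hθ, ?_⟩
  -- Homogeneity reduces every deviation at `T • u` to one at the unit vector `u`, whatever the size
  -- of `y`.
  have hTu : ∀ a : EuclideanSpace ℝ (Fin n), powLink Q (inner ℝ a (T • u))
      = T ^ (Q - 1) * powLink Q (inner ℝ a u) := fun a => by
    rw [real_inner_smul_right, powLink_mul (by linarith) hT]
  -- the gradient deviation as a vector
  have hgint := integrable_powLink_smul hψ hQ hint u
  set g : EuclideanSpace ℝ (Fin n) := (1 / (N : ℝ)) • ∑ j, powLink Q (inner ℝ (Ψ j) u) • Ψ j
    - ∫ a, powLink Q (inner ℝ (ψ a) u) • ψ a ∂μ with hg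
  have hginner : ∀ v, inner ℝ g v = 1 / (N : ℝ) * ∑ j, inner ℝ (Ψ j) v * powLink Q (inner ℝ (Ψ j) u)
      - ∫ a, inner ℝ (ψ a) v * powLink Q (inner ℝ (ψ a) u) ∂μ := by
    intro v
    rw [hg, inner_sub_left, real_inner_smul_left, sum_inner, real_inner_comm v (∫ a, _ ∂μ),
      ← integral_inner hgint v]
    simp only [real_inner_smul_left, real_inner_smul_right]
    congr 1
    · congr 1
      exact Finset.sum_congr rfl fun j _ => mul_comm _ _
    · refine integral_congr_ae (Filter.Eventually.of_forall fun a => ?_)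
      simp only [real_inner_comm v]
      rw [real_inner_comm (ψ a) v]
      ring
  have hgn : ‖g‖ ≤ 2 * (K * A * R) :=
    norm_le_of_net hδ (by positivity) hS g fun w hw => by
      rw [hginner]; exact hgood.gradient w hw
  have hstab : ‖θ - T • u‖ ≤ 16 / c * (2 * (K * A * R) / η ^ Q) * T := by
    refine norm_sub_le_of_smallBall hQ hη hc (by positivity) hT Ψ u θ hsbN ?_
    -- The two first-order conditions eliminate `y`: the empirical gradient term at `θ` equals the
    -- population one at `T • u`, and only the deviation `g` remains.
    have e1 : 1 / (N : ℝ) * ∑ j, inner ℝ (Ψ j) (θ - T • u) *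
        (powLink Q (inner ℝ (Ψ j) θ) - powLink Q (inner ℝ (Ψ j) (T • u)))
        = - (T ^ (Q - 1) * inner ℝ g (θ - T • u)) := by
      simp only [mul_sub, Finset.sum_sub_distrib]
      rw [hθfoc, ← hfoc, hginner]
      simp only [hTu]
      have e2 : ∀ a : Ω, inner ℝ (ψ a) (θ - T • u) * (T ^ (Q - 1) * powLink Q (inner ℝ (ψ a) u))
          = T ^ (Q - 1) * (inner ℝ (ψ a) (θ - T • u) * powLink Q (inner ℝ (ψ a) u)) :=
        fun a => by ring
      have e3 : ∀ j, inner ℝ (Ψ j) (θ - T • u) * (T ^ (Q - 1) * powLink Q (inner ℝ (Ψ j) u))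
          = T ^ (Q - 1) * (inner ℝ (Ψ j) (θ - T • u) * powLink Q (inner ℝ (Ψ j) u)) :=
        fun a => by ring
      simp only [e2, e3, ← Finset.mul_sum]
      rw [integral_const_mul]
      ring
    rw [e1]
    have h1 := abs_real_inner_le_norm g (θ - T • u)
    have h2 := (abs_le.mp h1).1
    have hTQ : 0 ≤ T ^ (Q - 1) := Real.rpow_nonneg hT _
    have h3 : - inner ℝ g (θ - T • u) ≤ 2 * (K * A * R) * ‖θ - T • u‖ := by
      have := mul_le_mul_of_nonneg_right hgn (norm_nonneg (θ - T • u))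
      linarith
    calc -(T ^ (Q - 1) * inner ℝ g (θ - T • u)) = T ^ (Q - 1) * (- inner ℝ g (θ - T • u)) := by ring
      _ ≤ T ^ (Q - 1) * (2 * (K * A * R) * ‖θ - T • u‖) := by gcongr
      _ = _ := by ring
  set D := 16 / c * (2 * (K * A * R) / η ^ Q) with hD
  have hDpos : 0 < D := by positivity
  have hdiff := fun x => abs_mean_mul_powLink_sub_le hQ hDpos hD1 hT
    (M := 2 ^ Q * (2 * A)) (by positivity) Ψ u θ hu hstab hM (fun j => f x (ω j))
  have hfx : ∀ a, Measurable fun x => f x a := fun a => hf.comp measurable_prodMk_right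
  have hm₁ : Measurable fun x => 1 / (N : ℝ) * ∑ j, |f x (ω j)| ^ Q - ∫ a, |f x a| ^ Q ∂μ := by
    apply Measurable.sub
    · exact (Finset.measurable_sum _ fun j _ => ((hfx _).abs.pow_const Q)).const_mul _
    · exact (StronglyMeasurable.integral_prod_right (f := fun x a => |f x a| ^ Q)
        ((hf.abs.pow_const Q)).stronglyMeasurable).measurable
  have hm₂ : Measurable fun x => 1 / (N : ℝ) * ∑ j, f x (ω j) * powLink Q (inner ℝ (ψ (ω j)) u)
      - ∫ a, f x a * powLink Q (inner ℝ (ψ a) u) ∂μ := by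
    apply Measurable.sub
    · exact (Finset.measurable_sum _ fun j _ => ((hfx _).mul_const _)).const_mul _
    · refine (StronglyMeasurable.integral_prod_right
        (f := fun x a => f x a * powLink Q (inner ℝ (ψ a) u)) ?_).measurable
      have h1 : Measurable fun p : 𝒳 × Ω => powLink Q (inner ℝ (ψ p.2) u) := by fun_prop
      exact (hf.mul h1).stronglyMeasurable
  have hQ1 : 0 ≤ Q - 1 := by linarith
  have hTQ : 0 ≤ T ^ (Q - 1) := Real.rpow_nonneg hT _
  have hKAR0 : 0 ≤ K * A * R := by positivity
  -- The error splits into the displacement of the maximizer and the deviation at `T • u` (weight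
  -- `b`). In the first, the empirical moment of `f` is its mean, at most `A`, plus its own
  -- deviation (weight `a`).
  refine (eLpNorm_le_of_abs_le hm₁ hm₂ (a := (Q - 1) * 2 ^ Q * D * T ^ (Q - 1) * 2)
    (b := T ^ (Q - 1)) (e := (Q - 1) * 2 ^ Q * D * T ^ (Q - 1) * (2 * A + 4 * (2 ^ Q * (2 * A))))
    (by positivity) hTQ (by positivity) hKAR0 hKAR0 ?_ hgood.feature hgood.predictor).trans
    (le_of_eq (by congr 1; ring))
  filter_upwards [hfeat] with x hx
  set p₁ := 1 / (N : ℝ) * ∑ j, f x (ω j) * powLink Q (inner ℝ (ψ (ω j)) θ) with hp₁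
  set p₂ := 1 / (N : ℝ) * ∑ j, f x (ω j) * powLink Q (inner ℝ (ψ (ω j)) (T • u)) with hp₂
  have e2 : p₂ = T ^ (Q - 1) * (1 / (N : ℝ) * ∑ j, f x (ω j) * powLink Q (inner ℝ (ψ (ω j)) u)) := by
    rw [hp₂]
    simp only [hTu]
    rw [mul_left_comm, Finset.mul_sum (a := T ^ (Q - 1))]
    congr 1
    exact Finset.sum_congr rfl fun j _ => by ring
  have e3 : ∫ a, f x a * powLink Q (inner ℝ (ψ a) (T • u)) ∂μ
      = T ^ (Q - 1) * ∫ a, f x a * powLink Q (inner ℝ (ψ a) u) ∂μ := by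
    simp only [hTu]
    rw [← integral_const_mul]
    exact integral_congr_ae (Filter.Eventually.of_forall fun a => by ring)
  have h1 : |p₁ - p₂| ≤ _ := hdiff x
  set r := 1 / (N : ℝ) * ∑ j, |f x (ω j)| ^ Q with hr
  have h2 : r ≤ |r - ∫ a, |f x a| ^ Q ∂μ| + A := by
    linarith [le_abs_self (r - ∫ a, |f x a| ^ Q ∂μ)]
  have h3 : |p₂ - ∫ a, f x a * powLink Q (inner ℝ (ψ a) (T • u)) ∂μ| = T ^ (Q - 1) *
      |1 / (N : ℝ) * ∑ j, f x (ω j) * powLink Q (inner ℝ (ψ (ω j)) u)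
      - ∫ a, f x a * powLink Q (inner ℝ (ψ a) u) ∂μ| := by
    rw [e2, e3, ← mul_sub, abs_mul, abs_of_nonneg hTQ]
  have h4 := abs_sub_le p₁ p₂ (∫ a, f x a * powLink Q (inner ℝ (ψ a) (T • u)) ∂μ)
  rw [h3] at h4
  refine h4.trans ?_
  have h5 : (Q - 1) * 2 ^ Q * D * T ^ (Q - 1) * (2 * r + 4 * (2 ^ Q * (2 * A))) ≤
      (Q - 1) * 2 ^ Q * D * T ^ (Q - 1) *
        (2 * (|r - ∫ a, |f x a| ^ Q ∂μ| + A) + 4 * (2 ^ Q * (2 * A))) := by gcongr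
  calc _ ≤ (Q - 1) * 2 ^ Q * D * T ^ (Q - 1) *
        (2 * (|r - ∫ a, |f x a| ^ Q ∂μ| + A) + 4 * (2 ^ Q * (2 * A))) + _ :=
        add_le_add (h1.trans h5) le_rfl
    _ = _ := by ring

end RandomFeatures

end

noncomputable section

namespace RandomFeatures

open ProbabilityTheory

/-! ### Good samples are likely -/

variable {n N : ℕ}

/-- The exponent `κ + 1` pays for the cardinality of the net and leaves `N^(-n)`. -/
lemma measure_biUnion_net_le {Ω ι : Type*} [MeasurableSpace Ω] {μ : Measure Ω} {S : Finset ι}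
    {κ : ℝ} (hN : 1 ≤ N) (hS : (S.card : ℝ) ≤ (N : ℝ) ^ (κ * n)) {B : ι → Set Ω}
    (hB : ∀ w ∈ S, μ (B w) ≤ ENNReal.ofReal ((N : ℝ) ^ (-((κ + 1) * n)))) :
    μ (⋃ w ∈ S, B w) ≤ ENNReal.ofReal ((N : ℝ) ^ (-(n : ℝ))) := by
  have hNr : (0 : ℝ) < N := by exact_mod_cast hN
  calc μ (⋃ w ∈ S, B w) ≤ ∑ w ∈ S, μ (B w) := measure_biUnion_finset_le S B
    _ ≤ ∑ _w ∈ S, ENNReal.ofReal ((N : ℝ) ^ (-((κ + 1) * n))) := Finset.sum_le_sum hB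
    _ = ENNReal.ofReal (S.card * (N : ℝ) ^ (-((κ + 1) * n))) := by
        rw [Finset.sum_const, nsmul_eq_mul, ENNReal.ofReal_mul (by positivity),
          ENNReal.ofReal_natCast]
    _ ≤ ENNReal.ofReal ((N : ℝ) ^ (κ * n) * (N : ℝ) ^ (-((κ + 1) * n))) := by gcongr
    _ = _ := by rw [← Real.rpow_add hNr]; congr 2; ring

lemma abs_rpow_eq_mul {Q : ℝ} (hQ : 1 < Q) (x : ℝ) : |x| ^ Q = |x| * |x| ^ (Q - 1) := by
  rcases (abs_nonneg x).eq_or_lt with h | h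
  · rw [← h, Real.zero_rpow (by linarith)]; simp
  · rw [mul_comm, ← Real.rpow_add_one h.ne']; congr 1; ring

/-- A union bound over the five requirements of `GoodSample`: three run over the net through
`exists_mean_tail`, two are `L²(P)` deviations through `exists_eLpNorm_mean_tail`. -/
lemma exists_goodSample_prob {Q κ : ℝ} (hQ : 2 ≤ Q) (hκ : 0 ≤ κ) :
    ∃ K : ℝ, 0 < K ∧ ∀ {Ω 𝒳 : Type*} [MeasurableSpace Ω] [MeasurableSpace 𝒳]
      (μ : Measure Ω) [IsProbabilityMeasure μ] (P : Measure 𝒳) [IsProbabilityMeasure P]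
      {n N : ℕ} (ψ : Ω → EuclideanSpace ℝ (Fin n)) (f : 𝒳 → Ω → ℝ)
      (u : EuclideanSpace ℝ (Fin n)) (S : Finset (EuclideanSpace ℝ (Fin n))) (η τ : ℝ),
      0 < τ → 1 ≤ n → 3 ≤ N → Measurable ψ → Measurable (Function.uncurry f) →
      (∀ v, ‖v‖ = 1 → SqrtMoments (2 * Real.exp 1 * τ) (fun a => inner ℝ (ψ a) v) μ) →
      (∀ᵐ x ∂P, SqrtMoments (2 * Real.exp 1 * τ) (f x) μ) →
      ‖u‖ = 1 → (∀ w ∈ S, ‖w‖ = 1) → (S.card : ℝ) ≤ (N : ℝ) ^ (κ * n) →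
      (Measure.pi fun _ => μ) {ω : Fin N → Ω | ¬ GoodSample Q η K (prodConst Q * τ ^ Q)
        (devRate (Q / 2) n N) μ P ψ f u S ω} ≤ ENNReal.ofReal (5 * (N : ℝ) ^ (-(n : ℝ))) := by
  have hq : 1 ≤ Q / 2 := by linarith
  obtain ⟨K₁, hK₁, hK₁b⟩ := exists_mean_tail hq (κ + 1) (by linarith)
  obtain ⟨K₂, hK₂, hK₂b⟩ := exists_eLpNorm_mean_tail hq (κ + 1) (by linarith)
  refine ⟨max K₁ K₂, lt_max_of_lt_left hK₁, ?_⟩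
  intro Ω 𝒳 _ _ μ _ P _ n N ψ f u S η τ hτ hn hN hψ hf hψm hfm hu hS hcard
  have hpl := measurable_powLink Q
  set A := prodConst Q * τ ^ Q with hA
  have hApos : 0 < A := by have := prodConst_pos (by linarith : 0 < Q); positivity
  set R := devRate (Q / 2) n N with hR
  have hR0 : 0 ≤ R := devRate_nonneg _ _ _
  have hNr : (1 : ℝ) ≤ N := by exact_mod_cast (by omega : 1 ≤ N)
  have hle₁ : ∀ B : ℝ, 0 ≤ B → K₁ * B * R ≤ max K₁ K₂ * B * R := fun B hB => by
    gcongr; exact le_max_left _ _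
  have hle₂ : K₂ * A * R ≤ max K₁ K₂ * A * R := by gcongr; exact le_max_right _ _
  have g₁ : ∀ w ∈ S, MomentGrowth A (Q / 2) (fun a => |inner ℝ (ψ a) w| ^ Q) μ := fun w hw =>
    momentGrowth_of_abs_le_mul_rpow (by fun_prop) (by linarith) hτ (hψm w (hS w hw))
      (hψm w (hS w hw)) fun a => by
        rw [abs_of_nonneg (by positivity), ← abs_rpow_eq_mul (by linarith)]
  have g₂ : ∀ w ∈ S, MomentGrowth 1 (Q / 2)
      (fun a => bothLarge η η (inner ℝ u (ψ a)) (inner ℝ w (ψ a))) μ := fun w _ => by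
    refine momentGrowth_of_bounded ((measurable_bothLarge η η).comp
      (f := fun a => (inner ℝ u (ψ a), inner ℝ w (ψ a))) (by fun_prop)) (fun a => ?_) (by linarith)
    exact (abs_of_nonneg (bothLarge_nonneg _ _ _ _)).trans_le (bothLarge_le_one _ _ _ _)
  have g₃ : ∀ w ∈ S, MomentGrowth A (Q / 2)
      (fun a => inner ℝ (ψ a) w * powLink Q (inner ℝ (ψ a) u)) μ := fun w hw =>
    momentGrowth_of_abs_le_mul_rpow (by fun_prop) (by linarith) hτ (hψm w (hS w hw))
      (hψm u hu) fun a => by rw [abs_mul, abs_powLink (by linarith)]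
  have hfxm : ∀ x, Measurable (f x) := fun x => hf.comp measurable_prodMk_left
  have g₄ : ∀ᵐ x ∂P, MomentGrowth A (Q / 2)
      (fun a => f x a * powLink Q (inner ℝ (ψ a) u)) μ := by
    filter_upwards [hfm] with x hx
    have := hfxm x
    exact momentGrowth_of_abs_le_mul_rpow (by fun_prop) (by linarith) hτ hx
      (hψm u hu) fun a => by rw [abs_mul, abs_powLink (by linarith)]
  have g₅ : ∀ᵐ x ∂P, MomentGrowth A (Q / 2) (fun a => |f x a| ^ Q) μ := by
    filter_upwards [hfm] with x hx
    have := hfxm x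
    exact momentGrowth_of_abs_le_mul_rpow (by fun_prop) (by linarith) hτ hx hx fun a => by
        rw [abs_of_nonneg (by positivity), ← abs_rpow_eq_mul (by linarith)]
  set PN := (Measure.pi fun _ : Fin N => μ)
  have b₁ := measure_biUnion_net_le (μ := PN) (by omega) hcard fun w hw =>
    hK₁b μ (fun a => |inner ℝ (ψ a) w| ^ Q) A hApos (by fun_prop) (g₁ w hw) n N hn hN
  have b₂ := measure_biUnion_net_le (μ := PN) (by omega) hcard fun w hw =>
    hK₁b μ (fun a => bothLarge η η (inner ℝ u (ψ a)) (inner ℝ w (ψ a))) 1 one_pos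
      ((measurable_bothLarge η η).comp
        (f := fun a => (inner ℝ u (ψ a), inner ℝ w (ψ a))) (by fun_prop)) (g₂ w hw) n N hn hN
  have b₃ := measure_biUnion_net_le (μ := PN) (by omega) hcard fun w hw =>
    hK₁b μ (fun a => inner ℝ (ψ a) w * powLink Q (inner ℝ (ψ a) u)) A hApos (by fun_prop)
      (g₃ w hw) n N hn hN
  have hmono : ENNReal.ofReal ((N : ℝ) ^ (-((κ + 1) * n))) ≤ ENNReal.ofReal ((N : ℝ) ^ (-(n : ℝ))) := by
    apply ENNReal.ofReal_le_ofReal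
    refine Real.rpow_le_rpow_of_exponent_le hNr ?_
    have : 0 ≤ κ * n := by positivity
    linarith
  have hu₂ : Measurable fun p : 𝒳 × Ω => powLink Q (inner ℝ (ψ p.2) u) := by fun_prop
  have b₄ := (hK₂b μ P (fun x a => f x a * powLink Q (inner ℝ (ψ a) u)) A hApos
    (hf.mul hu₂) g₄ n N hn hN).trans hmono
  have b₅ := (hK₂b μ P (fun x a => |f x a| ^ Q) A hApos (hf.abs.pow_const Q) g₅ n N hn hN).trans hmono
  have hfive : ∀ (B B₁ B₂ B₃ B₄ B₅ : Set (Fin N → Ω)), B ⊆ B₁ ∪ (B₂ ∪ (B₃ ∪ (B₄ ∪ B₅))) →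
      PN B₁ ≤ ENNReal.ofReal ((N : ℝ) ^ (-(n : ℝ))) → PN B₂ ≤ ENNReal.ofReal ((N : ℝ) ^ (-(n : ℝ))) →
      PN B₃ ≤ ENNReal.ofReal ((N : ℝ) ^ (-(n : ℝ))) → PN B₄ ≤ ENNReal.ofReal ((N : ℝ) ^ (-(n : ℝ))) →
      PN B₅ ≤ ENNReal.ofReal ((N : ℝ) ^ (-(n : ℝ))) →
      PN B ≤ ENNReal.ofReal (5 * (N : ℝ) ^ (-(n : ℝ))) := by
    intro B B₁ B₂ B₃ B₄ B₅ hsub b₁ b₂ b₃ b₄ b₅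
    refine (measure_mono hsub).trans ?_
    refine (measure_union_le _ _).trans ((add_le_add b₁ ((measure_union_le _ _).trans
      (add_le_add b₂ ((measure_union_le _ _).trans (add_le_add b₃ ((measure_union_le _ _).trans
        (add_le_add b₄ b₅))))))).trans (le_of_eq ?_))
    have h0 : 0 ≤ (N : ℝ) ^ (-(n : ℝ)) := by positivity
    rw [← ENNReal.ofReal_add h0 h0, ← ENNReal.ofReal_add h0 (by positivity),
      ← ENNReal.ofReal_add h0 (by positivity), ← ENNReal.ofReal_add h0 (by positivity)]
    congr 1; ring
  refine hfive _ _ _ _ _ _ ?_ b₁ b₂ b₃ b₄ b₅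
  · intro ω hω
    by_contra hcon
    simp only [Set.mem_union, not_or] at hcon
    obtain ⟨c₁, c₂, c₃, c₄, c₅⟩ := hcon
    exact hω (GoodSample.mk
      (fun w hw => by
        by_contra h
        exact c₁ (Set.mem_biUnion hw ((hle₁ A hApos.le).trans_lt (not_le.mp h))))
      (fun w hw => by
        by_contra h
        exact c₂ (Set.mem_biUnion hw ((hle₁ 1 zero_le_one).trans_lt (not_le.mp h))))
      (fun w hw => by
        by_contra h
        exact c₃ (Set.mem_biUnion hw ((hle₁ A hApos.le).trans_lt (not_le.mp h))))
      (by
        by_contra h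
        exact c₄ ((ENNReal.ofReal_le_ofReal hle₂).trans_lt (not_le.mp h)))
      (by
        by_contra h
        exact c₅ ((ENNReal.ofReal_le_ofReal hle₂).trans_lt (not_le.mp h))))

/-! ### The population problem -/

lemma integrable_norm_rpow_of_coord {Ω : Type*} [MeasurableSpace Ω] {μ : Measure Ω}
    {ψ : Ω → EuclideanSpace ℝ (Fin n)} (hψ : Measurable ψ) {Q : ℝ} (hQ : 0 < Q)
    (h : ∀ i, Integrable (fun a => |ψ a i| ^ Q) μ) : Integrable (fun a => ‖ψ a‖ ^ Q) μ := by
  rcases isEmpty_or_nonempty (Fin n) with hn | hn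
  · have : ∀ a, ‖ψ a‖ ^ Q = 0 := fun a => by
      rw [Subsingleton.elim (ψ a) 0, norm_zero, Real.zero_rpow hQ.ne']
    simp [this]
  refine ((integrable_finsetSum Finset.univ fun i _ => h i).const_mul ((n : ℝ) ^ Q)).mono'
    (Measurable.aestronglyMeasurable (by fun_prop)) (Filter.Eventually.of_forall fun a => ?_)
  obtain ⟨i, hi⟩ := Finite.exists_max fun i => |ψ a i|
  rw [Real.norm_of_nonneg (by positivity)]
  have hn1 : (1 : ℝ) ≤ n := by
    have : 0 < n := Fin.pos_iff_nonempty.mpr hn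
    exact_mod_cast this
  have h1 : ‖ψ a‖ ≤ n * |ψ a i| := by
    rw [EuclideanSpace.norm_eq, Real.sqrt_le_left (by positivity)]
    calc ∑ j, ‖ψ a j‖ ^ 2 ≤ ∑ _j : Fin n, |ψ a i| ^ 2 :=
          Finset.sum_le_sum fun j _ => pow_le_pow_left₀ (norm_nonneg _) (hi j) 2
      _ = n * |ψ a i| ^ 2 := by simp
      _ ≤ (n * |ψ a i|) ^ 2 := by
          rw [mul_pow]
          gcongr
          nlinarith
  calc ‖ψ a‖ ^ Q ≤ (n * |ψ a i|) ^ Q := Real.rpow_le_rpow (norm_nonneg _) h1 hQ.le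
    _ = (n : ℝ) ^ Q * |ψ a i| ^ Q := Real.mul_rpow (by positivity) (abs_nonneg _)
    _ ≤ (n : ℝ) ^ Q * ∑ j, |ψ a j| ^ Q := by
        gcongr
        exact Finset.single_le_sum (f := fun j => |ψ a j| ^ Q) (fun j _ => by positivity)
          (Finset.mem_univ i)

/-- Jensen through its tangent line: Bernoulli's inequality gives `z^(Q/2) ≥ 1 + Q/2 * (z - 1)` for
`z = ⟨ψ, v⟩²`, and isotropy kills the linear term. This is the coercivity of the population problem,
with constant `1`. -/
lemma norm_rpow_le_integral_of_isotropic {Ω : Type*} [MeasurableSpace Ω] {μ : Measure Ω}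
    [IsProbabilityMeasure μ] {ψ : Ω → EuclideanSpace ℝ (Fin n)} {Q : ℝ} (hQ : 2 ≤ Q)
    (hiso : ∀ v, ‖v‖ = 1 → ∫ a, (inner ℝ (ψ a) v) ^ 2 ∂μ = 1)
    (hint : ∀ v, ‖v‖ = 1 → Integrable (fun a => |inner ℝ (ψ a) v| ^ Q) μ)
    (hint2 : ∀ v, ‖v‖ = 1 → Integrable (fun a => (inner ℝ (ψ a) v) ^ 2) μ)
    (θ : EuclideanSpace ℝ (Fin n)) : ‖θ‖ ^ Q ≤ ∫ a, |inner ℝ (ψ a) θ| ^ Q ∂μ := by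
  rcases eq_or_ne θ 0 with rfl | hθ
  · simp [Real.zero_rpow (by linarith : Q ≠ 0)]
  set v := ‖θ‖⁻¹ • θ with hv
  have hv1 : ‖v‖ = 1 := norm_inv_norm_smul hθ
  have h1 : ∀ a, |inner ℝ (ψ a) θ| ^ Q = ‖θ‖ ^ Q * |inner ℝ (ψ a) v| ^ Q := by
    intro a
    conv_lhs => rw [norm_smul_inv_norm_smul hθ]
    rw [real_inner_smul_right, abs_mul, abs_of_nonneg (norm_nonneg _),
      Real.mul_rpow (norm_nonneg _) (abs_nonneg _)]
  simp_rw [h1]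
  rw [integral_const_mul]
  refine le_mul_of_one_le_right (by positivity) ?_
  have h2 : ∀ a, 1 + Q / 2 * ((inner ℝ (ψ a) v) ^ 2 - 1) ≤ |inner ℝ (ψ a) v| ^ Q := by
    intro a
    have h3 := one_add_mul_self_le_rpow_one_add (s := (inner ℝ (ψ a) v) ^ 2 - 1)
      (by nlinarith [sq_nonneg (inner ℝ (ψ a) v)]) (by linarith : 1 ≤ Q / 2)
    refine h3.trans (le_of_eq ?_)
    rw [add_sub_cancel, ← sq_abs, ← Real.rpow_natCast, ← Real.rpow_mul (abs_nonneg _)]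
    congr 1; push_cast; ring
  have hi : Integrable (fun a => Q / 2 * ((inner ℝ (ψ a) v) ^ 2 - 1)) μ :=
    ((hint2 v hv1).sub (integrable_const 1)).const_mul (Q / 2)
  calc (1 : ℝ) = ∫ a, (1 + Q / 2 * ((inner ℝ (ψ a) v) ^ 2 - 1)) ∂μ := by
        rw [integral_add (integrable_const _) hi, integral_const_mul,
          integral_sub (hint2 v hv1) (integrable_const _), hiso v hv1]
        simp
    _ ≤ _ := integral_mono ((integrable_const _).add hi) (hint v hv1) h2

lemma integral_bothLarge {Ω : Type*} [MeasurableSpace Ω] (μ : Measure Ω) {X Y : Ω → ℝ}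
    (hX : Measurable X) (hY : Measurable Y) (α β : ℝ) :
    ∫ a, bothLarge α β (X a) (Y a) ∂μ = μ.real {a | α ≤ |X a| ∧ β ≤ |Y a|} := by
  have hm : MeasurableSet {a | α ≤ |X a| ∧ β ≤ |Y a|} :=
    (measurableSet_le measurable_const hX.abs).inter (measurableSet_le measurable_const hY.abs)
  rw [← integral_indicator_one hm]
  rfl

end RandomFeatures

end

/-! ### Concentration of the dual problem for isotropic features -/

noncomputable section

namespace RandomFeatures

open ProbabilityTheory

variable {n N : ℕ}

/-- The polynomial bounds on `τ` and `η⁻¹` serve here: with `n` and `5 / c₀` also at most `N`, the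
base of the net cardinality is a fixed power of `N`. -/
lemma net_card_bound_le {C c₀ τ η : ℝ} (hC : 0 < C) (hc₀ : 0 < c₀) (hn : 1 ≤ n) (hnN : n ≤ N)
    (hcN : 5 / c₀ ≤ N) (hτ : 0 < τ) (hτn : τ ≤ (n : ℝ) ^ C) (hη : 0 < η)
    (hηn : (n : ℝ) ^ (-C) ≤ η) :
    (5 * n / (c₀ * η / τ)) ^ n ≤ (N : ℝ) ^ ((2 + 2 * C) * n) := by
  have hnr : (1 : ℝ) ≤ n := by exact_mod_cast hn
  have hnNr : (n : ℝ) ≤ N := by exact_mod_cast hnN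
  have hNr : (1 : ℝ) ≤ N := hnr.trans hnNr
  have hinv : η⁻¹ ≤ (N : ℝ) ^ C := by
    have h1 : η⁻¹ ≤ ((n : ℝ) ^ (-C))⁻¹ := inv_anti₀ (by positivity) hηn
    rw [Real.rpow_neg (by linarith), inv_inv] at h1
    exact h1.trans (Real.rpow_le_rpow (by linarith) hnNr hC.le)
  have hτN : τ ≤ (N : ℝ) ^ C := hτn.trans (Real.rpow_le_rpow (by linarith) hnNr hC.le)
  have hbase : 5 * n / (c₀ * η / τ) ≤ (N : ℝ) ^ (2 + 2 * C) := by
    calc 5 * n / (c₀ * η / τ) = (5 / c₀) * n * (τ * η⁻¹) := by field_simp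
      _ ≤ N * N * ((N : ℝ) ^ C * (N : ℝ) ^ C) := by gcongr
      _ = (N : ℝ) ^ (2 + 2 * C) := by
          rw [← Real.rpow_add (by linarith), ← sq, ← Real.rpow_natCast, ← Real.rpow_add (by linarith)]
          congr 1; push_cast; ring
  calc _ ≤ ((N : ℝ) ^ (2 + 2 * C)) ^ n := pow_le_pow_left₀ (by positivity) hbase n
    _ = _ := by rw [Real.rpow_mul (by linarith), Real.rpow_natCast]

lemma half_mul_le_mul_log (h : 2 ≤ n) : (1 / 2 : ℝ) * n ≤ n * Real.log n := by
  have hn2 : (2 : ℝ) ≤ n := by exact_mod_cast h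
  have hlog : Real.log 2 ≤ Real.log n := Real.log_le_log (by norm_num) hn2
  have hl2 := Real.log_two_gt_d9
  rw [mul_comm]
  exact mul_le_mul_of_nonneg_left (by linarith) (by linarith)

/-- The maximizer of the population objective, in polar form. -/
lemma exists_isArgmax_population {Ω : Type*} [MeasurableSpace Ω] {μ : Measure Ω}
    [IsProbabilityMeasure μ] {ψ : Ω → EuclideanSpace ℝ (Fin n)} {Q B : ℝ} (hQ : 2 ≤ Q)
    (hn : 1 ≤ n) (hψ : Measurable ψ)
    (hψm : ∀ v, ‖v‖ = 1 → SqrtMoments B (fun a => inner ℝ (ψ a) v) μ)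
    (hiso : ∀ v, ‖v‖ = 1 → ∫ a, (inner ℝ (ψ a) v) ^ 2 ∂μ = 1)
    (y : EuclideanSpace ℝ (Fin n)) :
    Integrable (fun a => ‖ψ a‖ ^ Q) μ ∧
    ∃ (T : ℝ) (u : EuclideanSpace ℝ (Fin n)), 0 ≤ T ∧ ‖u‖ = 1 ∧ T ^ (Q - 1) ≤ ‖y‖ ∧
      IsArgmax (fun θ => inner ℝ θ y - ∫ a, |inner ℝ (ψ a) θ| ^ Q / Q ∂μ) (T • u) ∧
      ∀ v, ∫ a, inner ℝ (ψ a) v * powLink Q (inner ℝ (ψ a) (T • u)) ∂μ = inner ℝ v y := by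
  have hint : Integrable (fun a => ‖ψ a‖ ^ Q) μ := by
    refine integrable_norm_rpow_of_coord hψ (by linarith) fun i => ?_
    have h := (hψm (EuclideanSpace.single i 1) (by simp) Q (by linarith)).1
    simpa [EuclideanSpace.inner_single_right] using h
  refine ⟨hint, ?_⟩
  have hint2 : ∀ v, ‖v‖ = 1 → Integrable (fun a => (inner ℝ (ψ a) v) ^ 2) μ := fun v hv => by
    have h := (hψm v hv 2 (by norm_num)).1
    simpa using h
  have hcoer := norm_rpow_le_integral_of_isotropic hQ hiso
    (fun v hv => (hψm v hv Q (by linarith)).1) hint2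
  obtain ⟨θ, hθ, hfoc⟩ := exists_isArgmax_dual hψ hQ hint one_pos
    (fun θ => by rw [one_mul]; exact hcoer θ) y
  -- Test the first-order condition against `θ` itself: `‖θ‖^Q ≤ E|⟨ψ, θ⟩|^Q = ⟨θ, y⟩`.
  have hTy : ‖θ‖ ^ (Q - 1) ≤ ‖y‖ := by
    rcases eq_or_ne θ 0 with rfl | h0
    · rw [norm_zero, Real.zero_rpow (by linarith)]; exact norm_nonneg _
    have h1 := hcoer θ
    have h2 := hfoc θ
    simp only [mul_powLink (by linarith : 1 < Q)] at h2
    rw [h2] at h1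
    have h3 := h1.trans (real_inner_le_norm θ y)
    have hpos : 0 < ‖θ‖ := norm_pos_iff.mpr h0
    have e : ‖θ‖ ^ Q = ‖θ‖ * ‖θ‖ ^ (Q - 1) := by
      rw [mul_comm, ← Real.rpow_add_one hpos.ne']; congr 1; ring
    rw [e] at h3
    exact le_of_mul_le_mul_left h3 hpos
  have hpolar : ∃ u : EuclideanSpace ℝ (Fin n), ‖u‖ = 1 ∧ θ = ‖θ‖ • u := by
    rcases eq_or_ne θ 0 with rfl | h0
    · exact ⟨EuclideanSpace.single ⟨0, hn⟩ 1, by simp, by simp⟩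
    · exact ⟨_, norm_inv_norm_smul h0, norm_smul_inv_norm_smul h0⟩
  obtain ⟨u, hu, hθu⟩ := hpolar
  refine ⟨‖θ‖, u, norm_nonneg _, hu, hTy, ?_, ?_⟩
  · rw [← hθu]; exact hθ
  · rw [← hθu]; exact hfoc

set_option maxHeartbeats 1600000 in
/-- Concentration of the empirical dual problem for an isotropic sub-Gaussian feature vector. -/
theorem exists_dual_concentration {Q C c : ℝ} (hQ : 2 ≤ Q) (hC : 0 < C) (hc : 0 < c) :
    ∃ C' : ℝ, 0 < C' ∧ ∀ {Ω 𝒳 : Type*} [MeasurableSpace Ω] [MeasurableSpace 𝒳]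
      (μ : Measure Ω) [IsProbabilityMeasure μ] (P : Measure 𝒳) [IsProbabilityMeasure P]
      {n N : ℕ} (ψ : Ω → EuclideanSpace ℝ (Fin n)) (f : 𝒳 → Ω → ℝ)
      (y : EuclideanSpace ℝ (Fin n)) (η τ : ℝ),
      1 ≤ n → 0 < N → 1 ≤ τ → τ ≤ (n : ℝ) ^ C → 0 < η → η ≤ 1 → (n : ℝ) ^ (-C) ≤ η →
      Measurable ψ → Measurable (Function.uncurry f) →
      (∀ v, ‖v‖ = 1 → SqrtMoments (2 * Real.exp 1 * τ) (fun a => inner ℝ (ψ a) v) μ) →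
      (∀ v, ‖v‖ = 1 → ∫ a, (inner ℝ (ψ a) v) ^ 2 ∂μ = 1) →
      (∀ᵐ x ∂P, SqrtMoments (2 * Real.exp 1 * τ) (f x) μ) →
      (∀ u v : EuclideanSpace ℝ (Fin n), ‖u‖ = 1 → ‖v‖ = 1 →
        c ≤ μ.real {a | η ≤ |inner ℝ u (ψ a)| ∧ η ≤ |inner ℝ v (ψ a)|}) →
      C' * max ((τ ^ Q / η ^ max Q 3) ^ 2 * (n * Real.log n))
            ((τ ^ Q / η ^ max Q 3) * (n * Real.log n) ^ (Q / 2)) ≤ N →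
      ∃ θ₀, IsArgmax (fun θ => inner ℝ θ y - ∫ a, |inner ℝ (ψ a) θ| ^ Q / Q ∂μ) θ₀ ∧
        (Measure.pi fun _ => μ) {ω : Fin N → Ω | ∃ θ,
          IsArgmax (fun θ => inner ℝ θ y - 1 / (N : ℝ) * ∑ j, |inner ℝ (ψ (ω j)) θ| ^ Q / Q) θ ∧
          eLpNorm (fun x => 1 / (N : ℝ) * ∑ j, f x (ω j) * powLink Q (inner ℝ (ψ (ω j)) θ)
            - ∫ a, f x a * powLink Q (inner ℝ (ψ a) θ₀) ∂μ) 2 P ≤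
          ENNReal.ofReal (C' * (τ ^ (2 * Q) / η ^ max Q 3) * devRate (Q / 2) n N * ‖y‖)}ᶜ
          ≤ ENNReal.ofReal (C' * (N : ℝ) ^ (-(n : ℝ))) := by
  obtain ⟨K, hK, hKb⟩ := exists_goodSample_prob hQ (by positivity : 0 ≤ 2 + 2 * C)
  set pc := prodConst Q with hpc
  have hpcpos : 0 < pc := prodConst_pos (by linarith)
  -- With `δ = c₀ η / τ` and `A = pc τ^Q`, the bound `c₀^Q ≤ b` is exactly the net condition `hδc`;
  -- all powers of `τ` and `η` cancel.
  set b : ℝ := c / (4 * 2 ^ Q * 2 ^ Q * 2 * pc) with hb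
  have hbpos : 0 < b := by positivity
  set c₀ : ℝ := min (1 / 2) (b ^ (1 / Q)) with hc₀
  have hc₀pos : 0 < c₀ := lt_min (by norm_num) (by positivity)
  have hc₀Q : c₀ ^ Q ≤ b := by
    calc c₀ ^ Q ≤ (b ^ (1 / Q)) ^ Q :=
          Real.rpow_le_rpow hc₀pos.le (min_le_right _ _) (by linarith)
      _ = b := by
          rw [← Real.rpow_mul hbpos.le, one_div, inv_mul_cancel₀ (by linarith), Real.rpow_one]
  -- The three summands secure in turn `K R ≤ 1`, `K R ≤ c / 4` and a displacement factor at most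
  -- `1`.
  set ε : ℝ := (K + 4 * K / c + 32 * K * pc / c)⁻¹ with hε
  have hεpos : 0 < ε := by positivity
  have hmQ : 0 ≤ max Q 3 := le_max_of_le_left (by linarith)
  obtain ⟨C₀, N₁, hC₀, hrate⟩ := exists_devRate_bound (q := Q / 2)
    (κ := C * Q + C * max Q 3) (ε := ε) (by linarith)
    (by have : 0 ≤ C * max Q 3 := by positivity
        have : 0 ≤ C * Q := by positivity
        linarith) hεpos
  set Cf : ℝ := (Q - 1) * 2 ^ Q * (32 / c) * K * pc ^ 2 * (4 + 8 * 2 ^ Q) + K * pc with hCf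
  have hQ1 : 0 < Q - 1 := by linarith
  have hCfpos : 0 < Cf := by positivity
  -- From `N₂` on, the rate estimate, the net cardinality bound and `N ≥ 3` are all available. The
  -- size condition forces `N ≥ C' ≥ N₂` unless `n = 1`, where `log n = 0`; there `C' ≥ N₂` makes
  -- the claimed probability bound at least `1`.
  set N₂ : ℝ := N₁ + 5 / c₀ + 3 with hN₂
  have hN₂3 : 3 ≤ N₂ := by
    have : 0 ≤ 5 / c₀ := by positivity
    have : (0 : ℝ) ≤ N₁ := by positivity
    linarith
  set C' : ℝ := C₀ + N₂ + Cf + 5 with hC'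
  refine ⟨C', by positivity, ?_⟩
  intro Ω 𝒳 _ _ μ _ P _ n N ψ f y η τ hn hN hτ1 hτn hη hη1 hηn hψ hf hψm hiso hfm hsb hsize
  have hτ : 0 < τ := by linarith
  have hnr : (1 : ℝ) ≤ n := by exact_mod_cast hn
  have hNr : (1 : ℝ) ≤ N := by exact_mod_cast hN
  obtain ⟨hint, T, u, hT, hu, hTy, hmax, hfoc⟩ := exists_isArgmax_population hQ hn hψ hψm hiso y
  refine ⟨T • u, hmax, ?_⟩
  set A₀ : ℝ := τ ^ Q / η ^ max Q 3 with hA₀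
  have hηm : 0 < η ^ max Q 3 := by positivity
  have hηm1 : η ^ max Q 3 ≤ 1 := Real.rpow_le_one hη.le hη1 hmQ
  have hτQ1 : 1 ≤ τ ^ Q := Real.one_le_rpow hτ1 (by linarith)
  have hA₀τ : τ ^ Q ≤ A₀ := by
    rw [hA₀, le_div_iff₀ hηm]; exact mul_le_of_le_one_right (by linarith) hηm1
  have hA₀1 : 1 ≤ A₀ := hτQ1.trans hA₀τ
  have hmaxnn : 0 ≤ max (A₀ ^ 2 * (n * Real.log n)) (A₀ * (n * Real.log n) ^ (Q / 2)) := by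
    have := Real.log_natCast_nonneg n
    exact le_max_of_le_left (by positivity)
  by_cases hsmall : (N : ℝ) < N₂
  · -- here `n = 1`, and the probability bound is trivial
    have hn1 : n = 1 := by
      by_contra hne
      have hn2 : (2 : ℝ) ≤ n := by exact_mod_cast (by omega : 2 ≤ n)
      have h1 : 1 ≤ n * Real.log n := by
        linarith [half_mul_le_mul_log (by omega : 2 ≤ n)]
      have h2 : 1 ≤ A₀ ^ 2 * (n * Real.log n) := one_le_mul_of_one_le_of_one_le (one_le_pow₀ hA₀1) h1
      have h3 : C' * 1 ≤ N := by
        refine le_trans ?_ hsize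
        gcongr
        exact h2.trans (le_max_left _ _)
      linarith
    refine prob_le_one.trans ?_
    rw [← ENNReal.ofReal_one]
    apply ENNReal.ofReal_le_ofReal
    rw [hn1, Nat.cast_one, Real.rpow_neg_one, ← div_eq_mul_inv, one_le_div (by linarith)]
    linarith
  push Not at hsmall
  have hN3 : 3 ≤ N := by exact_mod_cast hN₂3.trans hsmall
  have h5c : 0 ≤ 5 / c₀ := by positivity
  have hN₁0 : (0 : ℝ) ≤ N₁ := by positivity
  have hN₁ : N₁ ≤ N := by
    have : (N₁ : ℝ) ≤ N := by linarith
    exact_mod_cast this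
  have hcN : 5 / c₀ ≤ N := by linarith
  have hnN : n ≤ N := by
    rcases Nat.lt_or_ge n 2 with h | h
    · omega
    · have hn2 : (2 : ℝ) ≤ n := by exact_mod_cast h
      have h1 : (1 / 2 : ℝ) * n ≤ n * Real.log n := half_mul_le_mul_log h
      have h2 : (1 / 2 : ℝ) * n ≤ A₀ ^ 2 * (n * Real.log n) :=
        h1.trans (le_mul_of_one_le_left (by linarith) (one_le_pow₀ hA₀1))
      have h3 : 2 * ((1 / 2 : ℝ) * n) ≤ N := by
        refine le_trans ?_ hsize
        refine mul_le_mul (by linarith) (h2.trans (le_max_left _ _)) (by positivity) (by positivity)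
      have : (n : ℝ) ≤ N := by linarith
      exact_mod_cast this
  set R := devRate (Q / 2) n N with hR
  have hRpos : 0 < R := devRate_pos hn hN3
  have hA₀R : A₀ * R ≤ ε := by
    refine hrate n N A₀ hn hN₁ hN hA₀1 ?_ (le_trans ?_ hsize)
    · have h1 : (η ^ max Q 3)⁻¹ ≤ (n : ℝ) ^ (C * max Q 3) := by
        rw [Real.rpow_mul (by linarith), ← Real.inv_rpow hη.le]
        refine Real.rpow_le_rpow (by positivity) ?_ hmQ
        have := inv_anti₀ (by positivity) hηn
        rwa [Real.rpow_neg (by linarith), inv_inv] at this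
      have h2 : τ ^ Q ≤ (n : ℝ) ^ (C * Q) := by
        rw [Real.rpow_mul (by linarith)]
        exact Real.rpow_le_rpow hτ.le hτn (by linarith)
      rw [hA₀, div_eq_mul_inv, Real.rpow_add (by linarith)]
      gcongr
    · gcongr
      linarith
  have hηQ : 0 < η ^ Q := by positivity
  -- The argument costs only `η^Q`; since `η ≤ 1`, the exponent `max Q 3` gives a weaker bound.
  have hηQm : τ ^ Q / η ^ Q ≤ A₀ := by
    rw [hA₀]
    exact div_le_div_of_nonneg_left (by linarith) hηm
      (Real.rpow_le_rpow_of_exponent_ge hη hη1 (le_max_left _ _))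
  set A := pc * τ ^ Q with hA
  have hApos : 0 < A := by positivity
  have hεle : ∀ z : ℝ, 0 < z → z ≤ K + 4 * K / c + 32 * K * pc / c → z * (A₀ * R) ≤ 1 := by
    intro z hz hzle
    calc z * (A₀ * R) ≤ (K + 4 * K / c + 32 * K * pc / c) * ε := by gcongr
      _ = 1 := by rw [hε]; exact mul_inv_cancel₀ (by positivity)
  have p1 : 0 < 4 * K / c := by positivity
  have p2 : 0 < 32 * K * pc / c := by positivity
  have hRA : R ≤ A₀ * R := le_mul_of_one_le_left hRpos.le hA₀1
  have hKR1 : K * R ≤ 1 := by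
    have := hεle K hK (by linarith)
    exact (mul_le_mul_of_nonneg_left hRA hK.le).trans this
  have hKRc : K * R ≤ c / 4 := by
    have h1 := hεle (4 * K / c) p1 (by linarith)
    have h2 : 4 * K / c * R ≤ 1 := (mul_le_mul_of_nonneg_left hRA p1.le).trans h1
    rw [div_mul_eq_mul_div, div_le_one hc] at h2
    linarith
  have hDeq : 16 / c * (2 * (K * A * R) / η ^ Q) = 32 * K * pc / c * (τ ^ Q / η ^ Q * R) := by
    rw [hA]; field_simp; ring
  have hD1 : 16 / c * (2 * (K * A * R) / η ^ Q) ≤ 1 := by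
    rw [hDeq]
    refine le_trans ?_ (hεle _ p2 (by linarith))
    gcongr
  set δ := c₀ * η / τ with hδ
  have hδpos : 0 < δ := by positivity
  have hδhalf : δ ≤ 1 / 2 := by
    rw [hδ, div_le_iff₀ hτ]
    have : c₀ ≤ 1 / 2 := min_le_left _ _
    exact mul_le_mul this (hη1.trans hτ1) hη.le (by norm_num)
  obtain ⟨S, hS1, hScard, hS⟩ := exists_sphere_net (n := n) hn hδpos (by linarith)
  have hδc : 2 ^ Q * (2 * A) * δ ^ Q ≤ c / 4 * (η / 2) ^ Q := by
    rw [hδ, Real.div_rpow (by positivity) hτ.le, Real.mul_rpow hc₀pos.le hη.le,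
      Real.div_rpow hη.le (by norm_num)]
    calc 2 ^ Q * (2 * A) * (c₀ ^ Q * η ^ Q / τ ^ Q) = 2 ^ Q * (2 * pc) * η ^ Q * c₀ ^ Q := by
          rw [hA]; field_simp
      _ ≤ 2 ^ Q * (2 * pc) * η ^ Q * b := by gcongr
      _ = _ := by rw [hb]; field_simp
  have hpl := measurable_powLink Q
  have hmom : ∀ w, ‖w‖ = 1 → ∫ a, |inner ℝ (ψ a) w| ^ Q ∂μ ≤ A := by
    intro w hw
    have hg : MomentGrowth A (Q / 2) (fun a => |inner ℝ (ψ a) w| ^ Q) μ :=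
      momentGrowth_of_abs_le_mul_rpow (by fun_prop) (by linarith) hτ (hψm w hw) (hψm w hw)
        fun a => by rw [abs_of_nonneg (by positivity), ← abs_rpow_eq_mul (by linarith)]
    exact (le_abs_self _).trans hg.abs_integral_le
  have hfeat : ∀ᵐ x ∂P, ∫ a, |f x a| ^ Q ∂μ ≤ A := by
    filter_upwards [hfm] with x hx
    have hfxm : Measurable (f x) := hf.comp measurable_prodMk_left
    have hg : MomentGrowth A (Q / 2) (fun a => |f x a| ^ Q) μ :=
      momentGrowth_of_abs_le_mul_rpow (by fun_prop) (by linarith) hτ hx hx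
        fun a => by rw [abs_of_nonneg (by positivity), ← abs_rpow_eq_mul (by linarith)]
    exact (le_abs_self _).trans hg.abs_integral_le
  have hsb' : ∀ w, ‖w‖ = 1 → c ≤ ∫ a, bothLarge η η (inner ℝ u (ψ a)) (inner ℝ w (ψ a)) ∂μ := by
    intro w hw
    rw [integral_bothLarge μ (by fun_prop) (by fun_prop)]
    exact hsb u w hu hw
  have hprob := hKb μ P ψ f u S η τ hτ hn hN3 hψ hf hψm hfm hu hS1
    (hScard.trans (net_card_bound_le hC hc₀pos hn hnN hcN hτ hτn hη hηn))
  refine (measure_mono fun ω hω => ?_).trans (hprob.trans (ENNReal.ofReal_le_ofReal (by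
    gcongr; linarith)))
  intro hgood
  refine hω ?_
  obtain ⟨θ, hθ, hθb⟩ := hgood.exists_isArgmax hQ hη hK hApos hRpos hc hT hN hu hψ hf hint hS1
    hδhalf hS hδc hKR1 hKRc hD1 hmom hsb' hfeat hfoc
  refine ⟨θ, hθ, hθb.trans (ENNReal.ofReal_le_ofReal ?_)⟩
  have hKAR : K * A * R ≤ A := by
    rw [mul_right_comm]; exact mul_le_of_le_one_left hApos.le hKR1
  have hτ2 : τ ^ (2 * Q) = τ ^ Q * τ ^ Q := by
    rw [← Real.rpow_add hτ]; congr 1; ring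
  have hηinv : (η ^ Q)⁻¹ ≤ (η ^ max Q 3)⁻¹ :=
    inv_anti₀ hηm (Real.rpow_le_rpow_of_exponent_ge hη hη1 (le_max_left _ _))
  have hone : 1 ≤ τ ^ Q * (η ^ max Q 3)⁻¹ := by
    rw [← div_eq_mul_inv]; exact hA₀1
  have hTQ : 0 ≤ T ^ (Q - 1) := Real.rpow_nonneg hT _
  calc T ^ (Q - 1) * ((Q - 1) * 2 ^ Q * (16 / c * (2 * (K * A * R) / η ^ Q)) *
        (2 * (K * A * R) + 2 * A + 4 * (2 ^ Q * (2 * A))) + K * A * R)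
      ≤ T ^ (Q - 1) * ((Q - 1) * 2 ^ Q * (32 * K * pc / c * (τ ^ Q / η ^ Q * R)) *
        (2 * A + 2 * A + 4 * (2 ^ Q * (2 * A))) + K * A * R) := by
        rw [hDeq]; gcongr
    _ = T ^ (Q - 1) * R * ((Q - 1) * 2 ^ Q * (32 / c) * K * pc ^ 2 * (4 + 8 * 2 ^ Q) *
          (τ ^ Q * τ ^ Q * (η ^ Q)⁻¹) + K * pc * (τ ^ Q * 1)) := by
        rw [hA]; field_simp; ring
    _ ≤ ‖y‖ * R * ((Q - 1) * 2 ^ Q * (32 / c) * K * pc ^ 2 * (4 + 8 * 2 ^ Q) *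
          (τ ^ Q * τ ^ Q * (η ^ max Q 3)⁻¹) + K * pc * (τ ^ Q * (τ ^ Q * (η ^ max Q 3)⁻¹))) := by
        gcongr
    _ = Cf * (τ ^ (2 * Q) / η ^ max Q 3) * R * ‖y‖ := by
        rw [hCf, hτ2]; ring
    _ ≤ C' * (τ ^ (2 * Q) / η ^ max Q 3) * R * ‖y‖ := by
        gcongr
        linarith

end RandomFeatures

end

noncomputable section

namespace RandomFeatures

open ProbabilityTheory

/-! ### Whitening -/

variable {n N d : ℕ}

lemma inner_act (B : Matrix (Fin n) (Fin n) ℝ) (hB : B.IsHermitian)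
    (u v : EuclideanSpace ℝ (Fin n)) : inner ℝ u (act B v) = inner ℝ (act B u) v := by
  have hBt : B.transpose = B := hB
  simp only [act, EuclideanSpace.inner_eq_star_dotProduct, star_trivial]
  rw [Matrix.dotProduct_mulVec, ← Matrix.mulVec_transpose, hBt, dotProduct_comm]

lemma act_act (A B : Matrix (Fin n) (Fin n) ℝ) (v : EuclideanSpace ℝ (Fin n)) :
    act A (act B v) = act (A * B) v := by
  simp [act, Matrix.mulVec_mulVec]

lemma act_one (v : EuclideanSpace ℝ (Fin n)) : act 1 v = v := by
  simp [act]

lemma act_smul (A : Matrix (Fin n) (Fin n) ℝ) (a : ℝ) (v : EuclideanSpace ℝ (Fin n)) :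
    act A (a • v) = a • act A v := by
  simp [act, Matrix.mulVec_smul]

lemma continuous_act (A : Matrix (Fin n) (Fin n) ℝ) : Continuous (act A) := by
  unfold act
  fun_prop

variable {𝒱 𝒵 : Type*} [MeasurableSpace 𝒱] [MeasurableSpace 𝒵]

lemma measurable_featVec {φ : EuclideanSpace ℝ (Fin d) → 𝒱 → 𝒵 → ℝ}
    (hφ : ∀ x', Measurable fun q : 𝒱 × 𝒵 => φ x' q.1 q.2) (x : Fin n → EuclideanSpace ℝ (Fin d)) :
    Measurable (featVec φ x) := by
  unfold featVec
  refine (WithLp.measurable_toLp 2 (Fin n → ℝ)).comp (measurable_pi_lambda _ fun i => ?_)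
  exact (hφ (x i)).comp (measurable_fst.prodMk ((measurable_pi_apply i).comp measurable_snd))

lemma kernelMatrix_isHermitian (φ : EuclideanSpace ℝ (Fin d) → 𝒱 → 𝒵 → ℝ) (μ : Measure 𝒱)
    (ν : Measure 𝒵) (x : Fin n → EuclideanSpace ℝ (Fin d)) :
    (kernelMatrix φ μ ν x).IsHermitian := by
  ext i k
  simp [kernelMatrix, mul_comm]

lemma invSqrt_isHermitian (K : Matrix (Fin n) (Fin n) ℝ) : (invSqrt K).IsHermitian :=
  cfc_predicate (fun t : ℝ => (√t)⁻¹) K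

/-- If `K^{-1/2}` (with junk value `0` on nonpositive eigenvalues) is injective, then it whitens
`K`. -/
lemma invSqrt_mul_mul_invSqrt {K : Matrix (Fin n) (Fin n) ℝ} (hK : K.IsHermitian)
    (hinj : ∀ u : EuclideanSpace ℝ (Fin n), u ≠ 0 → act (invSqrt K) u ≠ 0) :
    invSqrt K * K * invSqrt K = 1 := by
  have hK' : IsSelfAdjoint K := hK
  have hc : ∀ f : ℝ → ℝ, ContinuousOn f (spectrum ℝ K) := fun f =>
    (Matrix.finite_real_spectrum).continuousOn f
  have hspec : spectrum ℝ (invSqrt K) = (fun t : ℝ => (√t)⁻¹) '' spectrum ℝ K :=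
    cfc_map_spectrum _ _ hK' (hc _)
  -- At `t ≤ 0` the function `(√t)⁻¹` takes the value `0`, which would put `0` in the spectrum of
  -- `invSqrt K`.
  have hpos : ∀ t ∈ spectrum ℝ K, 0 < t := by
    intro t ht
    by_contra hle
    have h0 : (0 : ℝ) ∈ spectrum ℝ (invSqrt K) := by
      rw [hspec]
      exact ⟨t, ht, by simp [Real.sqrt_eq_zero_of_nonpos (not_lt.mp hle)]⟩
    have hnu : ¬ IsUnit (invSqrt K) := fun hu => (spectrum.zero_notMem_iff ℝ).mpr hu h0
    rw [Matrix.isUnit_iff_isUnit_det, isUnit_iff_ne_zero, not_not] at hnu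
    obtain ⟨v, hv, hv0⟩ := Matrix.exists_mulVec_eq_zero_iff.mpr hnu
    refine hinj (WithLp.toLp 2 v) (by simpa using hv) ?_
    simp [act, hv0]
  unfold invSqrt
  conv_lhs => enter [1, 2]; rw [← cfc_id ℝ K]
  rw [← cfc_mul _ _ K (hc _) (hc _), ← cfc_mul _ _ K (hc _) (hc _), ← cfc_one ℝ K]
  apply cfc_congr
  intro t ht
  have h1 := hpos t ht
  have h2 := Real.sqrt_pos.mpr h1
  simp only [id, Pi.one_apply]
  field_simp
  rw [Real.sq_sqrt h1.le]

lemma IsSubGaussian.sqrtMoments {Ω : Type*} [MeasurableSpace Ω] {P : Measure Ω}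
    {Z : Ω → EuclideanSpace ℝ (Fin n)} {τ : ℝ} (h : IsSubGaussian Z (τ ^ 2) P) (hZ : Measurable Z)
    (hτ : 0 < τ) {v : EuclideanSpace ℝ (Fin n)} (hv : ‖v‖ = 1) :
    SqrtMoments (2 * Real.exp 1 * τ) (fun a => inner ℝ (Z a) v) P := by
  refine sqrtMoments_of_exp_moments (by fun_prop) hτ fun t => ?_
  have ht := h (t • v)
  have e : ∀ a, inner ℝ (t • v) (Z a) = t * inner ℝ (Z a) v := fun a => by
    rw [real_inner_smul_left, real_inner_comm]
  simp only [e, norm_smul, hv, mul_one, Real.norm_eq_abs, sq_abs] at ht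
  exact ht

lemma IsSubGaussian.sqrtMoments_fst {μ : Measure 𝒱} [IsProbabilityMeasure μ] {ν : Measure 𝒵}
    [IsProbabilityMeasure ν] {X : 𝒱 → ℝ} {τ : ℝ} (h : IsSubGaussian X (τ ^ 2) μ)
    (hX : Measurable X) (hτ : 0 < τ) :
    SqrtMoments (2 * Real.exp 1 * τ) (fun q : 𝒱 × (Fin n → 𝒵) => X q.1) (featLaw n μ ν) := by
  refine sqrtMoments_of_exp_moments (X := fun q : 𝒱 × (Fin n → 𝒵) => X q.1)
    (hX.comp measurable_fst) hτ fun t => ?_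
  have ht := h t
  simp only [Real.inner_apply, Real.norm_eq_abs, sq_abs] at ht
  unfold featLaw
  refine ⟨Integrable.comp_fst (f := fun w => Real.exp (t * X w)) ht.1 _, ?_⟩
  rw [integral_fun_fst (fun w => Real.exp (t * X w))]
  simpa using ht.2

/-- Isotropy of the whitened features. -/
lemma integral_inner_whitened_sq {φ : EuclideanSpace ℝ (Fin d) → 𝒱 → 𝒵 → ℝ} {μ : Measure 𝒱}
    {ν : Measure 𝒵} {x : Fin n → EuclideanSpace ℝ (Fin d)} {B : ℝ}
    (hmeas : Measurable (featVec φ x))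
    (hBKB : invSqrt (kernelMatrix φ μ ν x) * kernelMatrix φ μ ν x *
      invSqrt (kernelMatrix φ μ ν x) = 1)
    (hm : ∀ v, ‖v‖ = 1 → SqrtMoments B (fun a => inner ℝ (whitened φ μ ν x a) v) (featLaw n μ ν))
    (v : EuclideanSpace ℝ (Fin n)) (hv : ‖v‖ = 1) :
    ∫ a, (inner ℝ (whitened φ μ ν x a) v) ^ 2 ∂(featLaw n μ ν) = 1 := by
  set K := kernelMatrix φ μ ν x with hK
  set S := invSqrt K with hS
  have hSh : S.IsHermitian := invSqrt_isHermitian K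
  have hwm : Measurable (whitened φ μ ν x) := (continuous_act _).measurable.comp hmeas
  -- This recovers `φ_n = K S ψ_n`, so the coordinates of `φ_n` inherit square integrability from
  -- `ψ_n`. The entries of `K` are then genuine second moments rather than default zeros, and
  -- integrals may be exchanged with the finite sums.
  have hinv : K * S * S = 1 := mul_eq_one_comm.mp (by rw [← mul_assoc]; exact hBKB)
  have hL2 : ∀ w : EuclideanSpace ℝ (Fin n),
      MemLp (fun a => inner ℝ (whitened φ μ ν x a) w) 2 (featLaw n μ ν) := by
    intro w
    rcases eq_or_ne w 0 with rfl | hw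
    · simp
    have h1 := (hm _ (norm_inv_norm_smul hw) 2 (by norm_num)).1
    have h2 : MemLp (fun a => inner ℝ (whitened φ μ ν x a) (‖w‖⁻¹ • w)) 2 (featLaw n μ ν) := by
      rw [memLp_two_iff_integrable_sq (by fun_prop)]
      simpa using h1
    have h3 := h2.const_mul ‖w‖
    convert h3 using 2 with a
    rw [← real_inner_smul_right, ← norm_smul_inv_norm_smul hw]
  have hcoord : ∀ i a, featVec φ x a i = inner ℝ (whitened φ μ ν x a)
      (act (K * S).transpose (EuclideanSpace.single i 1)) := by
    intro i a
    have h1 : featVec φ x a = act (K * S) (whitened φ μ ν x a) := by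
      rw [whitened, ← hK, ← hS, act_act, hinv, act_one]
    conv_lhs => rw [h1]
    generalize K * S = D
    simp [act, EuclideanSpace.inner_eq_star_dotProduct, Matrix.mulVec, dotProduct]
  have hprod : ∀ i k, Integrable (fun a => featVec φ x a i * featVec φ x a k) (featLaw n μ ν) := by
    intro i k
    simp only [hcoord]
    exact (hL2 _).integrable_mul (hL2 _)
  set b := act S v with hb
  have hexp : ∀ a, (inner ℝ (whitened φ μ ν x a) v) ^ 2
      = ∑ i, ∑ k, b i * b k * (featVec φ x a i * featVec φ x a k) := by
    intro a
    have h1 : inner ℝ (whitened φ μ ν x a) v = ∑ i, b i * featVec φ x a i := by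
      rw [whitened, ← hK, ← hS, ← inner_act S hSh, ← hb]
      simp [PiLp.inner_apply]
    rw [h1, sq, Finset.sum_mul_sum]
    exact Finset.sum_congr rfl fun i _ => Finset.sum_congr rfl fun k _ => by ring
  simp_rw [hexp]
  rw [integral_finsetSum _ fun i _ => integrable_finsetSum _ fun k _ => (hprod i k).const_mul _]
  have h2 : ∀ i, ∫ a, ∑ k, b i * b k * (featVec φ x a i * featVec φ x a k) ∂(featLaw n μ ν)
      = b i * ∑ k, K i k * b k := by
    intro i
    rw [integral_finsetSum _ fun k _ => (hprod i k).const_mul _, Finset.mul_sum]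
    refine Finset.sum_congr rfl fun k _ => ?_
    rw [integral_const_mul, hK, kernelMatrix]
    ring
  simp_rw [h2]
  have h3 : ∑ i, b i * ∑ k, K i k * b k = inner ℝ b (act K b) := by
    simp [PiLp.inner_apply, act, Matrix.mulVec, dotProduct, mul_comm]
  rw [h3, hb, ← inner_act S hSh, act_act, act_act, hBKB, act_one,
    real_inner_self_eq_norm_sq, hv, one_pow]

/-- Carries maximizers in the whitened variable `θ` back to `λ`, with uniqueness. -/
lemma IsArgmax.of_comp {α β : Type*} {F : α → ℝ} {G : β → ℝ} {g : β → α}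
    (hg : Function.Surjective g) (hFG : ∀ b, F (g b) = G b) {b : β} (h : IsArgmax G b) :
    IsArgmax F (g b) := by
  intro a ha
  obtain ⟨b', rfl⟩ := hg a
  rw [hFG, hFG]
  exact h b' fun e => ha (by rw [e])

end RandomFeatures

end

/-! ### Reduction of the theorem to whitened features -/

theorem corollary1 (p Q C c r₀ : ℝ) (hp1 : 1 < p) (hp2 : p ≤ 2) (hQ : Q = p / (p - 1))
    (hC : 0 < C) (hc : 0 < c) (hr₀ : 0 < r₀) :
    ∃ C' c' : ℝ, 0 < C' ∧ 0 < c' ∧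
      ∀ (𝒱 𝒵 : Type*) [MeasurableSpace 𝒱] [MeasurableSpace 𝒵]
        (μ : Measure 𝒱) [IsProbabilityMeasure μ] (ν : Measure 𝒵) [IsProbabilityMeasure ν]
        (n d N : ℕ) (τ η : ℝ)
        (φ : EuclideanSpace ℝ (Fin d) → 𝒱 → 𝒵 → ℝ)
        (x : Fin n → EuclideanSpace ℝ (Fin d)) (y : EuclideanSpace ℝ (Fin n))
        (P : Measure (EuclideanSpace ℝ (Fin d))) [IsProbabilityMeasure P],
        (∀ x', Measurable fun q : 𝒱 × 𝒵 => φ x' q.1 q.2) →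
        (∀ x' w, Integrable (φ x' w) ν) →
        (∀ i, ‖x i‖ ≤ r₀ * √(d : ℝ)) →
        P {x' | ‖x'‖ ≤ r₀ * √(d : ℝ)}ᶜ = 0 →
        RandomFeatures.FEAT1 C r₀ τ φ μ ν x →
        RandomFeatures.FEAT2 C τ φ μ ν →
        RandomFeatures.FEAT3 C c η φ μ ν x →
        0 < N →
        C' * max ((τ ^ Q / η ^ max Q 3) ^ 2 * (n * Real.log n))
            ((τ ^ Q / η ^ max Q 3) * (n * Real.log n) ^ (Q / 2)) ≤ N →
        c' * d ≤ n →
        ∃ lamHat : EuclideanSpace ℝ (Fin n),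
          RandomFeatures.IsArgmax
            (RandomFeatures.dualInf (RandomFeatures.powerPenalty p) φ μ ν x y) lamHat ∧
          RandomFeatures.sampleLaw N n μ ν
            {ω | ∃ lamN : EuclideanSpace ℝ (Fin n),
              RandomFeatures.IsArgmax
                (RandomFeatures.dualFin (RandomFeatures.powerPenalty p) φ x y ω) lamN ∧
              eLpNorm (fun x' =>
                  RandomFeatures.predFin (RandomFeatures.powerPenalty p) φ ν x ω lamN x' -
                  RandomFeatures.predInf (RandomFeatures.powerPenalty p) φ μ ν x lamHat x') 2 P ≤
                ENNReal.ofReal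
                  (C' * (τ ^ (2 * Q) / η ^ max Q 3) *
                    max (√(n * Real.log N / N)) ((n * Real.log N) ^ (Q / 2) / N) *
                    ‖RandomFeatures.act
                      (RandomFeatures.invSqrt (RandomFeatures.kernelMatrix φ μ ν x)) y‖)}ᶜ ≤
            ENNReal.ofReal (C' * (N : ℝ) ^ (-(c' * n))) := by
  have hQ2 : 2 ≤ Q := by
    rw [hQ, le_div_iff₀ (by linarith)]; linarith
  obtain ⟨C', hC', hmain⟩ := RandomFeatures.exists_dual_concentration hQ2 hC hc
  refine ⟨C', 1, hC', one_pos, ?_⟩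
  intro 𝒱 𝒵 _ _ μ _ ν _ n d N τ η φ x y P _ hφ _ _ hP h1 h2 h3 hN hsize _
  have hτ : 0 < τ := by linarith [h1.one_le]
  -- For `n = 0` the condition `1 ≤ τ ≤ n^C` fails, because `0^C = 0`.
  have hn : 1 ≤ n := by
    by_contra h
    have hn0 : n = 0 := by omega
    have := h1.one_le.trans h1.le_pow
    rw [hn0, Nat.cast_zero, Real.zero_rpow hC.ne'] at this
    linarith
  have hprob : IsProbabilityMeasure (RandomFeatures.featLaw n μ ν) := by
    unfold RandomFeatures.featLaw; infer_instance
  have hfv := RandomFeatures.measurable_featVec hφ x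
  set K := RandomFeatures.kernelMatrix φ μ ν x with hK
  set S := RandomFeatures.invSqrt K with hS
  have hSh : S.IsHermitian := RandomFeatures.invSqrt_isHermitian K
  have hψ : Measurable (RandomFeatures.whitened φ μ ν x) :=
    (RandomFeatures.continuous_act _).measurable.comp hfv
  -- A kernel vector of `S` is orthogonal to `ψ_n` everywhere, so the small-ball event in its
  -- direction would be empty, against `c > 0`.
  have hinj : ∀ u : EuclideanSpace ℝ (Fin n), u ≠ 0 → RandomFeatures.act S u ≠ 0 := by
    intro u hu h0
    have hu1 := RandomFeatures.norm_inv_norm_smul hu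
    have hsb := h3.small_ball _ _ hu1 hu1
    have hempty : {q | η ≤ |inner ℝ (‖u‖⁻¹ • u) (RandomFeatures.whitened φ μ ν x q)| ∧
        η ≤ |inner ℝ (‖u‖⁻¹ • u) (RandomFeatures.whitened φ μ ν x q)|} = ∅ := by
      rw [Set.eq_empty_iff_forall_notMem]
      intro q hq
      have h4 : inner ℝ (‖u‖⁻¹ • u) (RandomFeatures.whitened φ μ ν x q) = (0 : ℝ) := by
        rw [RandomFeatures.whitened, ← hK, ← hS, RandomFeatures.inner_act S hSh,
          RandomFeatures.act_smul, h0, smul_zero, inner_zero_left]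
      have h5 := hq.1
      rw [h4, abs_zero] at h5
      linarith [h3.pos]
    rw [hempty, measureReal_empty] at hsb
    linarith
  have hBKB := RandomFeatures.invSqrt_mul_mul_invSqrt
    (RandomFeatures.kernelMatrix_isHermitian φ μ ν x) hinj
  have hψm : ∀ v, ‖v‖ = 1 → RandomFeatures.SqrtMoments (2 * Real.exp 1 * τ)
      (fun a => inner ℝ (RandomFeatures.whitened φ μ ν x a) v) (RandomFeatures.featLaw n μ ν) :=
    fun v hv => h1.whitened_subGaussian.sqrtMoments hψ hτ hv
  have hiso := RandomFeatures.integral_inner_whitened_sq hfv hBKB hψm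
  have havg : ∀ x', Measurable (RandomFeatures.avgFeat φ ν x') := fun x' =>
    (StronglyMeasurable.integral_prod_right (f := φ x') (hφ x').stronglyMeasurable).measurable
  obtain ⟨Lc, -, hLip, -, -⟩ := h2
  set f : EuclideanSpace ℝ (Fin d) → 𝒱 × (Fin n → 𝒵) → ℝ :=
    fun x' q => RandomFeatures.avgFeat φ ν x' q.1 with hf
  -- The averaged feature is Lipschitz in `x'` and measurable in `w`, hence jointly measurable; the
  -- Fubini argument relies on this.
  have hfm : Measurable (Function.uncurry f) :=
    measurable_uncurry_of_continuous_of_measurable (fun q => (hLip q.1).continuous)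
      fun x' => (havg x').comp measurable_fst
  have hfs : ∀ᵐ x' ∂P, RandomFeatures.SqrtMoments (2 * Real.exp 1 * τ) (f x')
      (RandomFeatures.featLaw n μ ν) := by
    have hball : ∀ᵐ x' ∂P, ‖x'‖ ≤ r₀ * √(d : ℝ) := hP
    filter_upwards [hball] with x' hx'
    exact (h1.avg_subGaussian x' hx').sqrtMoments_fst (havg x') hτ
  obtain ⟨θ₀, hθ₀, hbound⟩ := hmain (RandomFeatures.featLaw n μ ν) P
    (RandomFeatures.whitened φ μ ν x) f (RandomFeatures.act S y) η τ hn hN h1.one_le h1.le_pow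
    h3.pos h3.le_one h3.pow_le hψ hfm hψm hiso hfs h3.small_ball hsize
  have hconj : RandomFeatures.convexConj (RandomFeatures.powerPenalty p) = fun t => |t| ^ Q / Q :=
    funext (RandomFeatures.convexConj_powerPenalty hp1 hQ)
  have hlink := RandomFeatures.link_powerPenalty hp1 hQ
  have hinner : ∀ q θ, inner ℝ (RandomFeatures.featVec φ x q) (RandomFeatures.act S θ)
      = (inner ℝ (RandomFeatures.whitened φ μ ν x q) θ : ℝ) := fun q θ => by
    rw [RandomFeatures.inner_act S hSh]; rfl
  have hsurj : Function.Surjective (RandomFeatures.act S) := by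
    intro v
    refine ⟨RandomFeatures.act (K * S) v, ?_⟩
    rw [RandomFeatures.act_act, ← mul_assoc, hBKB, RandomFeatures.act_one]
  -- Symmetry of `S` moves the whitening onto `y`, which is where the norm of `K_n^{-1/2} y` in the
  -- bound comes from.
  have hyin : ∀ θ, inner ℝ (RandomFeatures.act S θ) y = (inner ℝ θ (RandomFeatures.act S y) : ℝ) :=
    fun θ => (RandomFeatures.inner_act S hSh θ y).symm
  refine ⟨RandomFeatures.act S θ₀, RandomFeatures.IsArgmax.of_comp hsurj (fun θ => ?_) hθ₀, ?_⟩
  · simp only [RandomFeatures.dualInf, hconj, hinner, hyin]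
  · rw [one_mul]
    refine le_trans (measure_mono (Set.compl_subset_compl.mpr ?_)) hbound
    rintro ω ⟨θ, hθ, hle⟩
    refine ⟨RandomFeatures.act S θ, RandomFeatures.IsArgmax.of_comp hsurj (fun θ => ?_) hθ, ?_⟩
    · simp only [RandomFeatures.dualFin, hconj, hinner, hyin]
    · simp only [RandomFeatures.predFin, RandomFeatures.predInf, hlink, hinner]
      exact hle
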